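/- An instance of Exact Matching Optimization (EM-opt) consists of a finite simple graph $G$ whose edges are coloured red or blue and an integer $k$. For a perfect matching $M$ of $G$ let $R(M)$ be the set of red edges in $M$; $M$ is feasible if $|R(M)| \le k$, and the task is to maximize $|R(M)|$ over all feasible perfect matchings. There is a deterministic polynomial-time 3-approximation algorithm for EM-opt on bipartite graphs. That is, there are a deterministic program for a random access machine (with registers and arrays of natural numbers, addition, truncated subtraction, indirect addressing, tests for zero and loops, where each elementary step costs one unit of time) and a polynomial $p$ such that, for every instance $(G,k)$ with vertex set $\{0,\dots,n-1\}$ and $G$ bipartite, the program, given $n$, $k$ and the coloured adjacency matrix of $G$, halts within $p(L)$ steps, where $L$ is the bit length of the input, and does the following. If a feasible perfect matching exists, it outputs (as an adjacency matrix) a perfect matching $M$ of $G$ with $\tfrac13 k^* \le |R(M)| \le k^*$, where $k^*$ is the largest number of red edges in a feasible perfect matching. Otherwise it outputs "infeasible". The bipartition of $G$ is not part of the input. -/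

import Mathlib

/-! ### Machine model: a deterministic random access machine with a step count -/

/-- Programs of a random access machine. A program mentions finitely many registers and finitely
many (unbounded) arrays; every register and every array cell holds a natural number. There is no
multiplication, so, apart from the constants of the program, one step lengthens the longest binary
number in the store by at most one bit, and unit-cost time is polynomially related to Turing machine
time. -/
inductive RamProgram : Type
  /-- do nothing -/
  | skip : RamProgram
  /-- `reg d := c` -/
  | const (d c : ℕ) : RamProgram
  /-- `reg d := reg x + reg y` -/
  | add (d x y : ℕ) : RamProgram
  /-- `reg d := reg x - reg y`, truncated at `0` -/
  | sub (d x y : ℕ) : RamProgram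
  /-- `reg d := arr a [reg i]` -/
  | load (d a i : ℕ) : RamProgram
  /-- `arr a [reg i] := reg x` -/
  | store (a i x : ℕ) : RamProgram
  /-- first `P`, then `Q` -/
  | seq (P Q : RamProgram) : RamProgram
  /-- `P` if `reg x ≠ 0`, and `Q` otherwise -/
  | cond (x : ℕ) (P Q : RamProgram) : RamProgram
  /-- repeat `P` as long as `reg x ≠ 0` -/
  | loop (x : ℕ) (P : RamProgram) : RamProgram

/-- The store of the machine: `reg r` is the content of register `r`, and `arr a i` the content of
cell `i` of array `a`. -/
structure RamStore : Type where
  reg : ℕ → ℕ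
  arr : ℕ → ℕ → ℕ

namespace RamStore

/-- Write `v` to register `d`. -/
def setReg (s : RamStore) (d v : ℕ) : RamStore :=
  { s with reg := Function.update s.reg d v }

/-- Write `v` to cell `i` of array `a`. -/
def setArr (s : RamStore) (a i v : ℕ) : RamStore :=
  { s with arr := Function.update s.arr a (Function.update (s.arr a) i v) }

/-- The initial store on input `l`: array `0` holds the entries of `l`, register `0` holds the
length of `l`, and everything else is `0`. -/
def init (l : List ℕ) : RamStore where
  reg := Function.update (fun _ => 0) 0 l.length
  arr := Function.update (fun _ _ => 0) 0 (fun i => l.getD i 0)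

/-- The output found in a final store: the first `reg 0` cells of array `1`. -/
def output (s : RamStore) : List ℕ :=
  (List.range (s.reg 0)).map (s.arr 1)

end RamStore

namespace RamProgram

/-- One step of the machine. A configuration consists of the programs that are still to be executed,
in this order, and the store. A configuration with nothing left to execute is halted and does not
change any more. -/
def step : List RamProgram × RamStore → List RamProgram × RamStore
  | ([], s) => ([], s)
  | (skip :: K, s) => (K, s)
  | (const d c :: K, s) => (K, s.setReg d c)
  | (add d x y :: K, s) => (K, s.setReg d (s.reg x + s.reg y))
  | (sub d x y :: K, s) => (K, s.setReg d (s.reg x - s.reg y))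
  | (load d a i :: K, s) => (K, s.setReg d (s.arr a (s.reg i)))
  | (store a i x :: K, s) => (K, s.setArr a (s.reg i) (s.reg x))
  | (seq P Q :: K, s) => (P :: Q :: K, s)
  | (cond x P Q :: K, s) => if s.reg x ≠ 0 then (P :: K, s) else (Q :: K, s)
  | (loop x P :: K, s) => if s.reg x ≠ 0 then (P :: loop x P :: K, s) else (K, s)

/-- On input `l`, the program `P` halts within `t` steps with output `o`. -/
def OutputsWithin (P : RamProgram) (l o : List ℕ) (t : ℕ) : Prop :=
  ∃ s : RamStore, step^[t] ([P], RamStore.init l) = ([], s) ∧ s.output = o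

end RamProgram

/-- The length of an input: the total number of binary digits of its entries, plus one separator per
entry. -/
def bitLength (l : List ℕ) : ℕ :=
  (l.map fun x => Nat.size x + 1).sum

/-- The `n × n` matrix `A` written out row by row: entry `(i, j)` is at position `i * n + j`. -/
def matrixList {n : ℕ} (A : Fin n → Fin n → ℕ) : List ℕ :=
  List.ofFn fun p : Fin (n * n) => A p.divNat p.modNat

/-! ### The problem EM-opt -/

/-- The two edge colours. -/
inductive EdgeColor : Type
  | red
  | blue

/-- An instance of EM-opt: a finite simple graph with vertex set `{0, …, n - 1}` whose edges are
coloured red or blue, and an integer `k`. -/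
structure EMInstance : Type where
  n : ℕ
  G : SimpleGraph (Fin n)
  color : G.EdgeLabeling EdgeColor
  k : ℤ

namespace EMInstance

variable (I : EMInstance)

/-- `R(M)`: the set of red edges in `M`. -/
def redEdges (M : I.G.Subgraph) : Set I.G.edgeSet :=
  {e | (e : Sym2 (Fin I.n)) ∈ M.edgeSet ∧ I.color e = EdgeColor.red}

/-- `|R(M)|`: the number of red edges in `M`. -/
noncomputable def numRed (M : I.G.Subgraph) : ℕ :=
  (I.redEdges M).ncard

/-- `M` is a feasible solution: a perfect matching with at most `k` red edges. -/
def IsFeasible (M : I.G.Subgraph) : Prop :=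
  M.IsPerfectMatching ∧ (I.numRed M : ℤ) ≤ I.k

/-- `v` is the optimum: the largest number of red edges in a feasible solution. -/
def IsOptimum (v : ℕ) : Prop :=
  IsGreatest {r : ℕ | ∃ M : I.G.Subgraph, I.IsFeasible M ∧ I.numRed M = r} v

/-- `out` is a correct answer of a `ρ`-approximation algorithm: the answer `none` (infeasible) is
correct if there is no feasible solution, and the answer `some M` is correct if `M` is a perfect
matching whose number of red edges is at most the optimum and at least the optimum divided by
`ρ`. -/
def IsApproxSolution (ρ : ℚ) : Option I.G.Subgraph → Prop
  | none => ¬ ∃ M : I.G.Subgraph, I.IsFeasible M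
  | some M => M.IsPerfectMatching ∧
      ∃ v : ℕ, I.IsOptimum v ∧ (v : ℚ) / ρ ≤ (I.numRed M : ℚ) ∧ I.numRed M ≤ v

open Classical in
/-- The coloured adjacency matrix: `0` for no edge, `1` for a blue edge, `2` for a red edge. -/
noncomputable def colorMatrix (i j : Fin I.n) : ℕ :=
  if h : I.G.Adj i j then
    match I.color ⟨s(i, j), h⟩ with
    | EdgeColor.blue => 1
    | EdgeColor.red => 2
  else 0

/-- The input that represents the instance: the number of vertices, the sign of `k` (`1` if `k` is
negative, else `0`), the absolute value of `k`, and the coloured adjacency matrix. -/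
noncomputable def encode : List ℕ :=
  I.n :: (if I.k < 0 then 1 else 0) :: I.k.natAbs :: matrixList I.colorMatrix

open Classical in
/-- The output that represents an answer: `[0]` for the answer `none` (infeasible), and `1` followed
by the adjacency matrix of `M` for the answer `some M`. -/
noncomputable def encodeAnswer : Option I.G.Subgraph → List ℕ
  | none => [0]
  | some M => 1 :: matrixList fun i j => if M.Adj i j then 1 else 0

end EMInstance

/-! After the two sides have been computed, a perfect matching is read as a permutation σ of the
vertices: a vertex of side 1 goes to its partner along an arc that has the colour of the edge, and a
vertex of side 2 goes to any vertex of side 1 along a blue arc. The red edges of the matching are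
then the red arcs of σ, and feasibility is a bound on their number.

Let g(e) be the least number of red arcs of a valid permutation through the arc e. Let an optimal
solution have k* > 0 red arcs, and put t = ⌊(k* - 1)/3⌋, so that 3t < k* ≤ 3(t + 1). If some arc e
of it has g(e) > t, then a permutation attaining g(e) has between t + 1 and k* red arcs and is good
enough. Otherwise all its arcs have g ≤ t. Start with a permutation with fewest red arcs. If it has
at most t of them, rotate repeatedly along closed walks of the residual digraph that use only arcs
with g ≤ t, gain red arcs, and bring in at most 2t new red arcs. A step out of the range ≤ t ends in
the range from t + 1 to 3t < k*, which is good enough. As k* is unknown, all t are tried and the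
best feasible permutation seen is kept.

What has to be shown is that the search cannot get stuck at a σ with at most t red arcs
(`not_stuck`). The optimal permutation yields a simple gaining closed walk, whose weight (number of
new red arcs) must exceed 2t. Let C be a lightest simple closed walk of weight N > 2t. Simple closed
walks lighter than N have weight at most 2t, so they do not gain, and hence weigh at most t, the
number of red arcs of σ being at most t. Each arc e of C has g(e) ≤ t, so a cycle of weight at most
t leads back from its end to its start. Such ways back give a covering of one turn around C by
intervals that are closed up by walks back to closed walks of weight at most t. In a covering with
fewest back arcs the walks back are vertex-disjoint and simple: two walks that meet can be
recombined, and one of the two resulting closed walks is lighter than N and can be cut into a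
cheaper covering. None of the closed walks gains, so N is at most the weight that σ has on C plus
that on the walks back, which is at most 2t: a contradiction (`false_of_heavy_cycle`,
`exists_backCover`).

The same local search with an unrestricted budget is cycle cancelling and computes g. An improving
closed walk is found by dynamic programming over length, end points and the two sums
(`IsWalkTable`). The algorithm is written in a small language with bounded loops, whose compilation
to the machine is verified once (`Cmd.exec_comp`); the time bound can be read off the syntax. -/

/-! ### Executions of machine programs and their exact step counts. -/

namespace RamProgram

/-- Started on `s`, the program `P` terminates in `s'` after exactly `t` steps. -/
def Exec (P : RamProgram) (s s' : RamStore) (t : ℕ) : Prop :=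
  ∀ K, step^[t] (P :: K, s) = (K, s')

theorem Exec.seq {P Q : RamProgram} {s s' s'' : RamStore} {t u : ℕ} (hP : P.Exec s s' t)
    (hQ : Q.Exec s' s'' u) : (RamProgram.seq P Q).Exec s s'' (u + t + 1) := by
  intro K
  rw [Function.iterate_succ_apply, Function.iterate_add_apply]
  simp only [step]
  rw [hP, hQ]

theorem exec_const (d c : ℕ) (s : RamStore) : (const d c).Exec s (s.setReg d c) 1 :=
  fun _ => rfl

theorem exec_skip (s : RamStore) : skip.Exec s s 1 :=
  fun _ => rfl

theorem exec_add (d x y : ℕ) (s : RamStore) :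
    (add d x y).Exec s (s.setReg d (s.reg x + s.reg y)) 1 :=
  fun _ => rfl

theorem exec_sub (d x y : ℕ) (s : RamStore) :
    (sub d x y).Exec s (s.setReg d (s.reg x - s.reg y)) 1 :=
  fun _ => rfl

theorem exec_load (d a i : ℕ) (s : RamStore) :
    (load d a i).Exec s (s.setReg d (s.arr a (s.reg i))) 1 :=
  fun _ => rfl

theorem exec_store (a i x : ℕ) (s : RamStore) :
    (store a i x).Exec s (s.setArr a (s.reg i) (s.reg x)) 1 :=
  fun _ => rfl

theorem Exec.cond_true {P Q : RamProgram} {s s' : RamStore} {t x : ℕ} (hx : s.reg x ≠ 0)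
    (hP : P.Exec s s' t) : (cond x P Q).Exec s s' (t + 1) := by
  intro K
  rw [Function.iterate_succ_apply]
  simp only [step, hx, ne_eq, not_false_eq_true, if_true]
  exact hP K

theorem Exec.cond_false {P Q : RamProgram} {s s' : RamStore} {t x : ℕ} (hx : s.reg x = 0)
    (hQ : Q.Exec s s' t) : (cond x P Q).Exec s s' (t + 1) := by
  intro K
  rw [Function.iterate_succ_apply]
  simp only [step, hx, ne_eq, not_true_eq_false, if_false]
  exact hQ K

theorem exec_loop_zero {P : RamProgram} {s : RamStore} {x : ℕ} (hx : s.reg x = 0) :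
    (loop x P).Exec s s 1 := by
  intro K
  simp [step, hx]

theorem Exec.loop_succ {P : RamProgram} {s s' s'' : RamStore} {t u x : ℕ} (hx : s.reg x ≠ 0)
    (hP : P.Exec s s' t) (hL : (loop x P).Exec s' s'' u) :
    (loop x P).Exec s s'' (u + t + 1) := by
  intro K
  rw [Function.iterate_succ_apply, Function.iterate_add_apply]
  simp only [step, hx, ne_eq, not_false_eq_true, if_true]
  rw [hP, hL]

/-- A halted configuration is a fixed point of `step`, so an upper bound on the number of steps
suffices. -/
theorem Exec.outputsWithin {P : RamProgram} {l : List ℕ} {s : RamStore} {t u : ℕ}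
    (h : P.Exec (RamStore.init l) s t) (htu : t ≤ u) : P.OutputsWithin l s.output u := by
  refine ⟨s, ?_, rfl⟩
  obtain ⟨d, rfl⟩ := Nat.exists_eq_add_of_le htu
  rw [Nat.add_comm, Function.iterate_add_apply, h]
  induction d with
  | zero => rfl
  | succ d ih => rw [Function.iterate_succ_apply]; exact ih (by omega)

end RamProgram

namespace RamStore

@[simp] theorem setReg_reg (s : RamStore) (d v r : ℕ) :
    (s.setReg d v).reg r = if r = d then v else s.reg r := by
  simp [setReg, Function.update_apply]

@[simp] theorem setReg_arr (s : RamStore) (d v : ℕ) : (s.setReg d v).arr = s.arr := rfl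

@[simp] theorem setArr_reg (s : RamStore) (a i v : ℕ) : (s.setArr a i v).reg = s.reg := rfl

@[simp] theorem setArr_arr (s : RamStore) (a i v b : ℕ) :
    (s.setArr a i v).arr b = if b = a then Function.update (s.arr a) i v else s.arr b := by
  simp [setArr, Function.update_apply]

/-- The stores agree on the arrays and on the registers below `t`. -/
def Agree (t : ℕ) (s s' : RamStore) : Prop :=
  s.arr = s'.arr ∧ ∀ r < t, s.reg r = s'.reg r

theorem Agree.trans {t : ℕ} {s s' s'' : RamStore} (h : Agree t s s') (h' : Agree t s' s'') :
    Agree t s s'' :=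
  ⟨h.1.trans h'.1, fun r hr => (h.2 r hr).trans (h'.2 r hr)⟩

theorem Agree.mono {t u : ℕ} {s s' : RamStore} (h : Agree u s s') (htu : t ≤ u) : Agree t s s' :=
  ⟨h.1, fun r hr => h.2 r (hr.trans_le htu)⟩

theorem Agree.setReg {t : ℕ} {s s' : RamStore} (h : Agree t s s') (d v : ℕ) :
    Agree t (s.setReg d v) (s'.setReg d v) := by
  refine ⟨h.1, fun r hr => ?_⟩
  simp [h.2 r hr]

theorem Agree.setReg_left {t : ℕ} {s s' : RamStore} (h : Agree t s s') {d : ℕ} (hd : t ≤ d)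
    (v : ℕ) : Agree t (s.setReg d v) s' := by
  refine ⟨h.1, fun r hr => ?_⟩
  have : r ≠ d := by omega
  simp [h.2 r hr, this]

end RamStore

/-! ### Compilation of expressions. -/

/-- Expressions over the registers and arrays of a random access machine. -/
inductive Exp : Type
  | num (c : ℕ) : Exp
  | var (r : ℕ) : Exp
  | add (e f : Exp) : Exp
  | sub (e f : Exp) : Exp
  | get (a : ℕ) (e : Exp) : Exp

namespace Exp

def eval (s : RamStore) : Exp → ℕ
  | num c => c
  | var r => s.reg r
  | add e f => e.eval s + f.eval s
  | sub e f => e.eval s - f.eval s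
  | get a e => s.arr a (e.eval s)

/-- All registers in the expression are below `t`. -/
def ok (t : ℕ) : Exp → Bool
  | num _ => true
  | var r => decide (r < t)
  | add e f => e.ok t && f.ok t
  | sub e f => e.ok t && f.ok t
  | get _ e => e.ok t

/-- A program that writes the value of the expression to register `t`, with the registers from `t`
on as scratch space. -/
def comp : Exp → ℕ → RamProgram
  | num c, t => .const t c
  | var r, t => .seq (.const t 0) (.add t r t)
  | add e f, t => .seq (e.comp t) (.seq (f.comp (t + 1)) (.add t t (t + 1)))
  | sub e f, t => .seq (e.comp t) (.seq (f.comp (t + 1)) (.sub t t (t + 1)))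
  | get a e, t => .seq (e.comp t) (.load t a t)

def time : Exp → ℕ
  | num _ => 1
  | var _ => 3
  | add e f => e.time + f.time + 3
  | sub e f => e.time + f.time + 3
  | get _ e => e.time + 2

theorem eval_congr {t : ℕ} {s s' : RamStore} (h : RamStore.Agree t s s') {e : Exp}
    (he : e.ok t = true) : e.eval s = e.eval s' := by
  induction e with
  | num c => rfl
  | var r => exact h.2 r (by simpa [ok] using he)
  | add e f ihe ihf =>
    simp only [ok, Bool.and_eq_true] at he
    simp [eval, ihe he.1, ihf he.2]
  | sub e f ihe ihf =>
    simp only [ok, Bool.and_eq_true] at he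
    simp [eval, ihe he.1, ihf he.2]
  | get a e ih => simp [eval, ih he, h.1]

theorem ok_mono {t u : ℕ} (htu : t ≤ u) {e : Exp} (he : e.ok t = true) : e.ok u = true := by
  induction e with
  | num c => rfl
  | var r => simp only [ok, decide_eq_true_eq] at he ⊢; omega
  | add e f ihe ihf =>
    simp only [ok, Bool.and_eq_true] at he ⊢
    exact ⟨ihe he.1, ihf he.2⟩
  | sub e f ihe ihf =>
    simp only [ok, Bool.and_eq_true] at he ⊢
    exact ⟨ihe he.1, ihf he.2⟩
  | get a e ih => exact ih he

/-- The second operand is evaluated with scratch registers from `t + 1` on, so the first value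
survives in register `t`. Nothing below `t` changes. -/
theorem exec_comp {e : Exp} {t : ℕ} (he : e.ok t = true) (s : RamStore) :
    ∃ s', (e.comp t).Exec s s' e.time ∧ RamStore.Agree t s' s ∧ s'.reg t = e.eval s := by
  induction e generalizing t s with
  | num c =>
    exact ⟨_, RamProgram.exec_const _ _ _, RamStore.Agree.setReg_left ⟨rfl, fun _ _ => rfl⟩ le_rfl
      _,
      by simp [eval]⟩
  | var r =>
    refine ⟨_, (RamProgram.exec_const _ _ _).seq (RamProgram.exec_add _ _ _ _),
      (RamStore.Agree.setReg_left ⟨rfl, fun _ _ => rfl⟩ le_rfl _).setReg_left le_rfl _, ?_⟩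
    have : r ≠ t := by simp only [ok, decide_eq_true_eq] at he; omega
    simp [eval, this]
  | add e f ihe ihf =>
    simp only [ok, Bool.and_eq_true] at he
    obtain ⟨s₁, h₁, a₁, v₁⟩ := ihe he.1 s
    obtain ⟨s₂, h₂, a₂, v₂⟩ := ihf (ok_mono (Nat.le_succ t) he.2) s₁
    refine ⟨s₂.setReg t (s₂.reg t + s₂.reg (t + 1)), ?_,
      ((a₂.mono (Nat.le_succ t)).trans a₁).setReg_left le_rfl _, ?_⟩
    · have := h₁.seq (h₂.seq (RamProgram.exec_add t t (t + 1) s₂))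
      rwa [show (Exp.add e f).time = 1 + f.time + 1 + e.time + 1 by simp only [time]; omega]
    · rw [eval_congr a₁ he.2] at v₂
      simp [eval, v₂, a₂.2 t (Nat.lt_succ_self t), v₁]
  | sub e f ihe ihf =>
    simp only [ok, Bool.and_eq_true] at he
    obtain ⟨s₁, h₁, a₁, v₁⟩ := ihe he.1 s
    obtain ⟨s₂, h₂, a₂, v₂⟩ := ihf (ok_mono (Nat.le_succ t) he.2) s₁
    refine ⟨s₂.setReg t (s₂.reg t - s₂.reg (t + 1)), ?_,
      ((a₂.mono (Nat.le_succ t)).trans a₁).setReg_left le_rfl _, ?_⟩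
    · have := h₁.seq (h₂.seq (RamProgram.exec_sub t t (t + 1) s₂))
      rwa [show (Exp.sub e f).time = 1 + f.time + 1 + e.time + 1 by simp only [time]; omega]
    · rw [eval_congr a₁ he.2] at v₂
      simp [eval, v₂, a₂.2 t (Nat.lt_succ_self t), v₁]
  | get a e ih =>
    obtain ⟨s₁, h₁, a₁, v₁⟩ := ih he s
    refine ⟨s₁.setReg t (s₁.arr a (s₁.reg t)), ?_, a₁.setReg_left le_rfl _, ?_⟩
    · have := h₁.seq (RamProgram.exec_load t a t s₁)
      rwa [show (Exp.get a e).time = 1 + e.time + 1 by simp only [time]; omega]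
    · simp [eval, v₁, a₁.1]

end Exp

/-! ### Commands with bounded loops: semantics, compilation and polynomial time. -/

/-- Commands of a structured language with bounded loops. -/
inductive Cmd : Type
  | skip : Cmd
  /-- `reg d := e` -/
  | set (d : ℕ) (e : Exp) : Cmd
  /-- `arr a [i] := e` -/
  | put (a : ℕ) (i e : Exp) : Cmd
  | seq (P Q : Cmd) : Cmd
  /-- `P` if `e ≠ 0`, and `Q` otherwise -/
  | ite (e : Exp) (P Q : Cmd) : Cmd
  /-- `P` for `reg i = 0, …, reg r - 1` -/
  | loop (i r : ℕ) (P : Cmd) : Cmd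

namespace Cmd

/-- Apply `f 0`, …, `f (k - 1)` in this order. -/
def iter (f : ℕ → RamStore → RamStore) : ℕ → RamStore → RamStore
  | 0, s => s
  | k + 1, s => f k (iter f k s)

/-- The bound of a loop is read once on entry, and the index is set afresh in each round, so the
body cannot change the number of rounds. -/
def eval : Cmd → RamStore → RamStore
  | skip, s => s
  | set d e, s => s.setReg d (e.eval s)
  | put a i e, s => s.setArr a (i.eval s) (e.eval s)
  | seq P Q, s => Q.eval (P.eval s)
  | ite e P Q, s => if e.eval s ≠ 0 then P.eval s else Q.eval s
  | loop i r P, s => iter (fun j s => P.eval (s.setReg i j)) (s.reg r) s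

/-- The registers that the command may change. -/
def wReg : Cmd → List ℕ
  | skip => []
  | set d _ => [d]
  | put _ _ _ => []
  | seq P Q => P.wReg ++ Q.wReg
  | ite _ P Q => P.wReg ++ Q.wReg
  | loop i _ P => i :: P.wReg

/-- The arrays that the command may change. -/
def wArr : Cmd → List ℕ
  | skip => []
  | set _ _ => []
  | put a _ _ => [a]
  | seq P Q => P.wArr ++ Q.wArr
  | ite _ P Q => P.wArr ++ Q.wArr
  | loop _ _ P => P.wArr

/-- All registers are below `t`, and loop bounds are registers in `F`, which are never changed. -/
def ok (F : List ℕ) (t : ℕ) : Cmd → Bool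
  | skip => true
  | set d e => decide (d < t) && !F.contains d && e.ok t
  | put _ i e => i.ok t && e.ok t
  | seq P Q => P.ok F t && Q.ok F t
  | ite e P Q => e.ok t && P.ok F t && Q.ok F t
  | loop i r P => decide (i < t) && !F.contains i && decide (r < t) && F.contains r && P.ok F t

/-- In a loop, register `t` counts the remaining rounds down, `t + 1` counts the index up, and the
body has its scratch space from `t + 2` on. After the body, `t + 2` holds the constant 1. -/
def comp : Cmd → ℕ → RamProgram
  | skip, _ => .skip
  | set d e, t => .seq (e.comp t) (.seq (.const d 0) (.add d t d))
  | put a i e, t => .seq (i.comp t) (.seq (e.comp (t + 1)) (.store a t (t + 1)))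
  | seq P Q, t => .seq (P.comp t) (Q.comp t)
  | ite e P Q, t => .seq (e.comp t) (.cond t (P.comp t) (Q.comp t))
  | loop i r P, t =>
    .seq (.const t 0) (.seq (.add t r t) (.seq (.const (t + 1) 0) (.loop t
      (.seq (.const i 0) (.seq (.add i (t + 1) i) (.seq (P.comp (t + 2))
        (.seq (.const (t + 2) 1) (.seq (.add (t + 1) (t + 1) (t + 2)) (.sub t t (t + 2))))))))))

open Polynomial in
/-- A bound on the running time as a polynomial in the loop bounds. -/
noncomputable def time : Cmd → Polynomial ℕ
  | skip => 1
  | set _ e => C (e.time + 4)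
  | put _ i e => C (i.time + e.time + 3)
  | seq P Q => P.time + Q.time + 1
  | ite e P Q => C (e.time + 2) + P.time + Q.time
  | loop _ _ P => (P.time + 12) * X + 12

theorem eval_reg {c : Cmd} {r : ℕ} (h : r ∉ c.wReg) (s : RamStore) :
    (c.eval s).reg r = s.reg r := by
  induction c generalizing s with
  | skip => rfl
  | set d e => simp only [wReg, List.mem_singleton] at h; simp [eval, h]
  | put a i e => rfl
  | seq P Q ihP ihQ =>
    simp only [wReg, List.mem_append, not_or] at h
    simp [eval, ihP h.1, ihQ h.2]
  | ite e P Q ihP ihQ =>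
    simp only [wReg, List.mem_append, not_or] at h
    simp only [eval]
    split
    · exact ihP h.1 s
    · exact ihQ h.2 s
  | loop i b P ih =>
    simp only [wReg, List.mem_cons, not_or] at h
    simp only [eval]
    generalize s.reg b = k
    induction k with
    | zero => rfl
    | succ k ihk => simp [iter, ih h.2, ihk, h.1]

theorem eval_arr {c : Cmd} {a : ℕ} (h : a ∉ c.wArr) (s : RamStore) :
    (c.eval s).arr a = s.arr a := by
  induction c generalizing s with
  | skip => rfl
  | set d e => rfl
  | put a i e => simp only [wArr, List.mem_singleton] at h; simp [eval, h]
  | seq P Q ihP ihQ =>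
    simp only [wArr, List.mem_append, not_or] at h
    simp [eval, ihP h.1, ihQ h.2]
  | ite e P Q ihP ihQ =>
    simp only [wArr, List.mem_append, not_or] at h
    simp only [eval]
    split
    · exact ihP h.1 s
    · exact ihQ h.2 s
  | loop i b P ih =>
    simp only [wArr] at h
    simp only [eval]
    generalize s.reg b = k
    induction k with
    | zero => rfl
    | succ k ihk => simp [iter, ih h, ihk]

theorem ok_mono {F : List ℕ} {t u : ℕ} (htu : t ≤ u) {c : Cmd} (hc : c.ok F t = true) :
    c.ok F u = true := by
  induction c with
  | skip => rfl
  | set d e =>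
    simp only [ok, Bool.and_eq_true, decide_eq_true_eq] at hc ⊢
    exact ⟨⟨hc.1.1.trans_le htu, hc.1.2⟩, Exp.ok_mono htu hc.2⟩
  | put a i e =>
    simp only [ok, Bool.and_eq_true] at hc ⊢
    exact ⟨Exp.ok_mono htu hc.1, Exp.ok_mono htu hc.2⟩
  | seq P Q ihP ihQ =>
    simp only [ok, Bool.and_eq_true] at hc ⊢
    exact ⟨ihP hc.1, ihQ hc.2⟩
  | ite e P Q ihP ihQ =>
    simp only [ok, Bool.and_eq_true] at hc ⊢
    exact ⟨⟨Exp.ok_mono htu hc.1.1, ihP hc.1.2⟩, ihQ hc.2⟩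
  | loop i r P ih =>
    simp only [ok, Bool.and_eq_true, decide_eq_true_eq] at hc ⊢
    exact ⟨⟨⟨⟨hc.1.1.1.1.trans_le htu, hc.1.1.1.2⟩, hc.1.1.2.trans_le htu⟩, hc.1.2⟩, ih hc.2⟩

theorem eval_congr {F : List ℕ} {t : ℕ} {s s' : RamStore} (h : RamStore.Agree t s s') {c : Cmd}
    (hc : c.ok F t = true) : RamStore.Agree t (c.eval s) (c.eval s') := by
  induction c generalizing s s' with
  | skip => exact h
  | set d e =>
    simp only [ok, Bool.and_eq_true] at hc
    simp only [eval, Exp.eval_congr h hc.2]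
    exact h.setReg _ _
  | put a i e =>
    simp only [ok, Bool.and_eq_true] at hc
    simp only [eval, Exp.eval_congr h hc.1, Exp.eval_congr h hc.2]
    exact ⟨by simp [RamStore.setArr, h.1], h.2⟩
  | seq P Q ihP ihQ =>
    simp only [ok, Bool.and_eq_true] at hc
    exact ihQ (ihP h hc.1) hc.2
  | ite e P Q ihP ihQ =>
    simp only [ok, Bool.and_eq_true] at hc
    simp only [eval, Exp.eval_congr h hc.1.1]
    split
    · exact ihP h hc.1.2
    · exact ihQ h hc.2
  | loop i r P ih =>
    simp only [ok, Bool.and_eq_true, decide_eq_true_eq] at hc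
    simp only [eval, h.2 r hc.1.1.2]
    generalize s'.reg r = k
    induction k with
    | zero => exact h
    | succ k ihk => exact ih (ihk.setReg _ _) hc.2

/-- This is why a single number bounds all loops during a whole run: the registers of `F` keep their
initial values. -/
theorem eval_reg_of_ok {F : List ℕ} {t : ℕ} {c : Cmd} (hc : c.ok F t = true) {r : ℕ} (hr : r ∈ F)
    (s : RamStore) : (c.eval s).reg r = s.reg r := by
  refine eval_reg ?_ s
  induction c with
  | skip => simp [wReg]
  | set d e =>
    simp only [ok, Bool.and_eq_true, Bool.not_eq_true', List.contains_eq_mem,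
      decide_eq_false_iff_not] at hc
    simp only [wReg, List.mem_singleton]
    rintro rfl
    exact hc.1.2 hr
  | put a i e => simp [wReg]
  | seq P Q ihP ihQ =>
    simp only [ok, Bool.and_eq_true] at hc
    simp [wReg, ihP hc.1, ihQ hc.2]
  | ite e P Q ihP ihQ =>
    simp only [ok, Bool.and_eq_true] at hc
    simp [wReg, ihP hc.1.2, ihQ hc.2]
  | loop i b P ih =>
    simp only [ok, Bool.and_eq_true, Bool.not_eq_true', List.contains_eq_mem,
      decide_eq_false_iff_not] at hc
    simp only [wReg, List.mem_cons, not_or]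
    refine ⟨?_, ih hc.2⟩
    rintro rfl
    exact hc.1.1.1.2 hr

theorem wReg_lt {F : List ℕ} {t : ℕ} {c : Cmd} (hc : c.ok F t = true) {r : ℕ} (hr : r ∈ c.wReg) :
    r < t := by
  induction c with
  | skip => simp [wReg] at hr
  | set d e =>
    simp only [ok, Bool.and_eq_true, decide_eq_true_eq] at hc
    simp only [wReg, List.mem_singleton] at hr
    exact hr ▸ hc.1.1
  | put a i e => simp [wReg] at hr
  | seq P Q ihP ihQ =>
    simp only [ok, Bool.and_eq_true] at hc
    simp only [wReg, List.mem_append] at hr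
    exact hr.elim (ihP hc.1) (ihQ hc.2)
  | ite e P Q ihP ihQ =>
    simp only [ok, Bool.and_eq_true] at hc
    simp only [wReg, List.mem_append] at hr
    exact hr.elim (ihP hc.1.2) (ihQ hc.2)
  | loop i b P ih =>
    simp only [ok, Bool.and_eq_true, decide_eq_true_eq] at hc
    simp only [wReg, List.mem_cons] at hr
    exact hr.elim (fun h => h ▸ hc.1.1.1.1) (ih hc.2)

/-- Every loop, however deeply nested, runs at most `N` rounds, since its bound is a register of
`F`. The structural polynomial `time` therefore bounds the steps at `N`. The stores are compared
only below `t`, where the scratch space begins. -/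
theorem exec_comp {F : List ℕ} {c : Cmd} {t : ℕ} (hF : ∀ r ∈ F, r < t) (hc : c.ok F t = true)
    (N : ℕ) (s : RamStore) (hs : ∀ r ∈ F, s.reg r ≤ N) :
    ∃ s' T, (c.comp t).Exec s s' T ∧ T ≤ c.time.eval N ∧ RamStore.Agree t s' (c.eval s) := by
  induction c generalizing t s with
  | skip => exact ⟨s, 1, RamProgram.exec_skip s, by simp [time], rfl, fun _ _ => rfl⟩
  | set d e =>
    simp only [ok, Bool.and_eq_true, decide_eq_true_eq] at hc
    obtain ⟨s₁, h₁, a₁, v₁⟩ := Exp.exec_comp hc.2 s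
    refine ⟨_, _, h₁.seq ((RamProgram.exec_const d 0 s₁).seq (RamProgram.exec_add d t d _)), ?_,
      ?_, ?_⟩
    · simp only [time, Polynomial.eval_C]; omega
    · exact a₁.1
    · intro r hr
      have : t ≠ d := by omega
      by_cases hrd : r = d <;> simp [eval, hrd, v₁, this, a₁.2 r hr]
  | put a i e =>
    simp only [ok, Bool.and_eq_true] at hc
    obtain ⟨s₁, h₁, a₁, v₁⟩ := Exp.exec_comp hc.1 s
    obtain ⟨s₂, h₂, a₂, v₂⟩ := Exp.exec_comp (Exp.ok_mono (Nat.le_succ t) hc.2) s₁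
    refine ⟨_, _, h₁.seq (h₂.seq (RamProgram.exec_store a t (t + 1) s₂)), ?_, ?_, ?_⟩
    · simp only [time, Polynomial.eval_C]; omega
    · rw [Exp.eval_congr a₁ hc.2] at v₂
      simp [eval, RamStore.setArr, v₂, a₂.2 t (Nat.lt_succ_self t), v₁, a₂.1, a₁.1]
    · intro r hr
      simp [eval, a₂.2 r (by omega), a₁.2 r hr]
  | seq P Q ihP ihQ =>
    simp only [ok, Bool.and_eq_true] at hc
    obtain ⟨s₁, T₁, h₁, l₁, a₁⟩ := ihP hF hc.1 s hs
    obtain ⟨s₂, T₂, h₂, l₂, a₂⟩ := ihQ hF hc.2 s₁ (fun r hr => by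
      rw [a₁.2 r (hF r hr), eval_reg_of_ok hc.1 hr]; exact hs r hr)
    refine ⟨_, _, h₁.seq h₂, ?_, a₂.trans (eval_congr a₁ hc.2)⟩
    simp only [time, Polynomial.eval_add, Polynomial.eval_one]; omega
  | ite e P Q ihP ihQ =>
    simp only [ok, Bool.and_eq_true] at hc
    obtain ⟨s₁, h₁, a₁, v₁⟩ := Exp.exec_comp hc.1.1 s
    have hs₁ : ∀ r ∈ F, s₁.reg r ≤ N := fun r hr => by rw [a₁.2 r (hF r hr)]; exact hs r hr
    by_cases he : e.eval s = 0
    · obtain ⟨s₂, T₂, h₂, l₂, a₂⟩ := ihQ hF hc.2 s₁ hs₁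
      refine ⟨_, _, h₁.seq (h₂.cond_false (v₁.trans he)), ?_, ?_⟩
      · simp only [time, Polynomial.eval_add, Polynomial.eval_C]; omega
      · simpa [eval, he] using a₂.trans (eval_congr a₁ hc.2)
    · obtain ⟨s₂, T₂, h₂, l₂, a₂⟩ := ihP hF hc.1.2 s₁ hs₁
      refine ⟨_, _, h₁.seq (h₂.cond_true (v₁.trans_ne he)), ?_, ?_⟩
      · simp only [time, Polynomial.eval_add, Polynomial.eval_C]; omega
      · simpa [eval, he] using a₂.trans (eval_congr a₁ hc.1.2)
  | loop i r P ih =>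
    simp only [ok, Bool.and_eq_true, decide_eq_true_eq, Bool.not_eq_true', List.contains_eq_mem,
      decide_eq_false_iff_not] at hc
    obtain ⟨⟨⟨⟨hit, hiF⟩, hrt⟩, hrF⟩, hP⟩ := hc
    set f : ℕ → RamStore → RamStore := fun j s => P.eval (s.setReg i j) with hf
    have hreg : ∀ j, ∀ b ∈ F, (iter f j s).reg b = s.reg b := by
      intro j b hb
      induction j with
      | zero => rfl
      | succ j ihj =>
        have : b ≠ i := fun h => hiF (h ▸ hb)
        simp [iter, hf, eval_reg_of_ok hP hb, this, ← ihj]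
    -- Induction on the number `k` of remaining rounds, with `j` rounds done.
    have key : ∀ k j (u : RamStore), u.reg t = k → u.reg (t + 1) = j →
        RamStore.Agree t u (iter f j s) →
        ∃ u' T, (RamProgram.loop t
          (.seq (.const i 0) (.seq (.add i (t + 1) i) (.seq (P.comp (t + 2))
            (.seq (.const (t + 2) 1) (.seq (.add (t + 1) (t + 1) (t + 2)) (.sub t t (t +
              2)))))))).Exec
          u u' T ∧ T ≤ (P.time.eval N + 11) * k + 1 ∧ RamStore.Agree t u' (iter f (j + k) s) := by
      intro k
      induction k with
      | zero =>
        intro j u hk hj ha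
        exact ⟨u, 1, RamProgram.exec_loop_zero hk, by simp, ha⟩
      | succ k ihk =>
        intro j u hk hj ha
        set u₁ := (u.setReg i 0).setReg i ((u.setReg i 0).reg (t + 1) + (u.setReg i 0).reg i)
          with hu₁
        have hne : t + 1 ≠ i := by omega
        have hne' : t ≠ i := by omega
        have hi : u₁.reg i = j := by simp [hu₁, hne, hj]
        have hag : RamStore.Agree t u₁ ((iter f j s).setReg i j) := by
          refine ⟨ha.1, fun b hb => ?_⟩
          by_cases hbi : b = i
          · subst hbi; simp [hi]
          · simp [hu₁, hbi, ha.2 b hb]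
        obtain ⟨u₂, T₂, h₂, l₂, a₂⟩ := ih (t := t + 2) (fun b hb => (hF b hb).trans (by omega))
          (ok_mono (by omega) hP) u₁ (fun b hb => by
            have : b ≠ i := fun h => hiF (h ▸ hb)
            rw [hag.2 b (hF b hb)]
            simp only [RamStore.setReg_reg, this, if_false, hreg j b hb]
            exact hs b hb)
        -- The counters in `t` and `t + 1` survive the body: its scratch space begins at `t + 2`,
        -- and its own registers are below `t`.
        have ht : u₂.reg t = k + 1 := by
          rw [a₂.2 t (by omega), eval_reg]
          · simp [hu₁, hne', hk]
          · intro hmem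
            exact absurd (wReg_lt hP hmem) (by omega)
        have ht₁ : u₂.reg (t + 1) = j := by
          rw [a₂.2 (t + 1) (by omega), eval_reg]
          · simp [hu₁, hne, hj]
          · intro hmem
            exact absurd (wReg_lt hP hmem) (by omega)
        set u₃ := u₂.setReg (t + 2) 1 with hu₃
        set u₄ := u₃.setReg (t + 1) (u₃.reg (t + 1) + u₃.reg (t + 2)) with hu₄
        set u₅ := u₄.setReg t (u₄.reg t - u₄.reg (t + 2)) with hu₅
        obtain ⟨u', T, h', l', a'⟩ := ihk (j + 1) u₅ (by simp [hu₅, hu₄, hu₃, ht])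
          (by simp [hu₅, hu₄, hu₃, ht₁]) (by
            refine RamStore.Agree.setReg_left ?_ le_rfl _
            refine RamStore.Agree.setReg_left ?_ (by omega) _
            refine RamStore.Agree.setReg_left ?_ (by omega) _
            exact (a₂.mono (by omega)).trans (eval_congr hag hP))
        refine ⟨u', _, RamProgram.Exec.loop_succ (by omega)
          ((RamProgram.exec_const _ _ _).seq ((RamProgram.exec_add _ _ _ _).seq (h₂.seq
          ((RamProgram.exec_const _ _ _).seq ((RamProgram.exec_add _ _ _ _).seq
          (RamProgram.exec_sub _ _ _ _)))))) h', ?_, ?_⟩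
        · rw [Nat.mul_succ]; omega
        · rwa [show j + (k + 1) = j + 1 + k by omega]
    set s₁ := s.setReg t 0 with hs₁
    set s₂ := s₁.setReg t (s₁.reg r + s₁.reg t) with hs₂
    set s₃ := s₂.setReg (t + 1) 0 with hs₃
    obtain ⟨u', T, h', l', a'⟩ := key (s.reg r) 0 s₃ (by
        have : r ≠ t := by omega
        simp [hs₃, hs₂, hs₁, this]) (by simp [hs₃])
      (by
        refine RamStore.Agree.setReg_left ?_ (by omega) _
        refine RamStore.Agree.setReg_left ?_ (by omega) _
        exact RamStore.Agree.setReg_left ⟨rfl, fun _ _ => rfl⟩ (by omega) _)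
    refine ⟨u', _, (RamProgram.exec_const _ _ _).seq ((RamProgram.exec_add _ _ _ _).seq
      ((RamProgram.exec_const _ _ _).seq h')), ?_, by simpa [eval] using a'⟩
    have := Nat.mul_le_mul_left (P.time.eval N + 11) (hs r hrF)
    simp only [time, Polynomial.eval_add, Polynomial.eval_mul, Polynomial.eval_X,
      Polynomial.eval_ofNat]
    nlinarith

end Cmd

/-! ### Weighted walks, cutting and splitting. -/

section Walks

variable {V : Type*} {A : V → V → Prop} {p : V → V → ℕ}

/-- `Wk A p x y P S`: there is a walk from `x` to `y` along arcs in `A`, of total weight `P`, such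
that `S` is the multiset of the tails of its arcs. -/
inductive Wk (A : V → V → Prop) (p : V → V → ℕ) : V → V → ℕ → Multiset V → Prop
  | nil (x : V) : Wk A p x x 0 0
  | cons {x y z : V} {P : ℕ} {S : Multiset V} (h : A x y) (w : Wk A p y z P S) :
      Wk A p x z (p x y + P) (x ::ₘ S)

theorem Wk.append {x y z : V} {P P' : ℕ} {S S' : Multiset V} (h : Wk A p x y P S)
    (h' : Wk A p y z P' S') : Wk A p x z (P + P') (S + S') := by
  induction h with
  | nil x => simpa using h'
  | cons hA w ih =>
    rw [add_assoc, Multiset.cons_add]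
    exact .cons hA (ih h')

theorem Wk.single {x y : V} (h : A x y) : Wk A p x y (p x y) {x} :=
  Wk.cons h (.nil y)

/-- The cut is made at the first visit of `v` as a tail. The last conjunct says that the second
piece still leaves `v`, so it is not empty. -/
theorem Wk.split {x y v : V} {P : ℕ} {S : Multiset V} (h : Wk A p x y P S) (hv : v ∈ S) :
    ∃ P₁ S₁ P₂ S₂, Wk A p x v P₁ S₁ ∧ Wk A p v y P₂ S₂ ∧ P₁ + P₂ = P ∧ S₁ + S₂ = S ∧ v ∈ S₂ := by
  induction h with
  | nil x => simp at hv
  | @cons x y z P S hA w ih =>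
    by_cases hvx : v = x
    · subst hvx
      exact ⟨0, 0, _, _, .nil v, .cons hA w, by simp, by simp, hv⟩
    · obtain ⟨P₁, S₁, P₂, S₂, h₁, h₂, hP, hS, hm⟩ := ih ((Multiset.mem_cons.1 hv).resolve_left hvx)
      exact ⟨_, _, P₂, S₂, .cons hA h₁, h₂, by rw [← hP, add_assoc], by rw [← hS,
        Multiset.cons_add],
        hm⟩

/-- A walk that is not simple contains a closed walk that can be cut out. -/
theorem Wk.exists_cut {x y : V} {P : ℕ} {S : Multiset V} (h : Wk A p x y P S) (hS : ¬ S.Nodup) :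
    ∃ v P₁ S₁ P₂ S₂, Wk A p v v P₁ S₁ ∧ Wk A p x y P₂ S₂ ∧ P₁ + P₂ = P ∧ S₁ + S₂ = S ∧ S₁ ≠ 0 ∧
      S₂ ≠ 0 := by
  induction h with
  | nil x => simp at hS
  | @cons x y z P S hA w ih =>
    by_cases hx : x ∈ S
    · obtain ⟨P₁, S₁, P₂, S₂, h₁, h₂, hP, hS', hm⟩ := w.split hx
      refine ⟨x, _, _, P₂, S₂, .cons hA h₁, h₂, by rw [← hP, add_assoc],
        by rw [← hS', Multiset.cons_add], by simp, ?_⟩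
      rintro rfl
      simp at hm
    · have : ¬ S.Nodup := fun h => hS (Multiset.nodup_cons.2 ⟨hx, h⟩)
      obtain ⟨v, P₁, S₁, P₂, S₂, h₁, h₂, hP, hS', hne, -⟩ := ih this
      exact ⟨v, P₁, S₁, _, _, h₁, .cons hA h₂, by omega, by rw [← hS', Multiset.add_cons], hne,
        by simp⟩

/-- If light simple closed walks do not gain, then light closed walks do not gain. -/
theorem Wk.le_of_simple {q : V → ℕ} {N : ℕ}
    (h : ∀ x P S, Wk A p x x P S → S.Nodup → P < N → P ≤ (S.map q).sum) {x : V} {P : ℕ}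
    {S : Multiset V} (hw : Wk A p x x P S) (hP : P < N) : P ≤ (S.map q).sum := by
  induction hn : S.card using Nat.strong_induction_on generalizing x P S with
  | _ n ih =>
    by_cases hS : S.Nodup
    · exact h x P S hw hS hP
    · obtain ⟨v, P₁, S₁, P₂, S₂, h₁, h₂, rfl, rfl, hn₁, hn₂⟩ := hw.exists_cut hS
      have c₁ := Multiset.card_pos.2 hn₁
      have c₂ := Multiset.card_pos.2 hn₂
      rw [Multiset.card_add] at hn
      have i₁ := ih _ (by omega) h₁ (by omega) rfl
      have i₂ := ih _ (by omega) h₂ (by omega) rfl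
      rw [Multiset.map_add, Multiset.sum_add]
      omega

/-- The vertices of a walk as a function. -/
theorem Wk.exists_fun {x y : V} {P : ℕ} {S : Multiset V} (h : Wk A p x y P S) :
    ∃ c : ℕ → V, c 0 = x ∧ c S.card = y ∧ (∀ i < S.card, A (c i) (c (i + 1))) ∧
      P = ∑ i ∈ Finset.range S.card, p (c i) (c (i + 1)) ∧
      S = (Multiset.range S.card).map c := by
  induction h with
  | nil x => exact ⟨fun _ => x, rfl, rfl, by simp, by simp, by simp⟩
  | @cons x y z P S hA w ih =>
    obtain ⟨c, h0, h1, h2, h3, h4⟩ := ih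
    refine ⟨fun i => Nat.casesOn i x c, rfl, by simpa using h1, ?_, ?_, ?_⟩
    · rintro (_ | i) hi
      · simpa [h0] using hA
      · exact h2 i (by simpa using hi)
    · rw [Multiset.card_cons, Finset.sum_range_succ', add_comm]
      simp only [h0]
      rw [← h3]
      rfl
    · rw [Multiset.card_cons]
      conv_lhs => rw [h4]
      rw [← Multiset.coe_range, ← Multiset.coe_range, List.range_succ_eq_map, Multiset.map_coe,
        Multiset.map_coe, Multiset.cons_coe]
      simp [Function.comp_def]

theorem Wk.of_fun (c : ℕ → V) {a b : ℕ} (hab : a ≤ b) (h : ∀ i ∈ Finset.Ico a b, A (c i) (c (i +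
    1))) :
    Wk A p (c a) (c b) (∑ i ∈ Finset.Ico a b, p (c i) (c (i + 1))) ((Finset.Ico a b).val.map c) :=
      by
  induction b, hab using Nat.le_induction with
  | base => simpa using Wk.nil (c a)
  | succ b hab ih =>
    have h₁ := ih (fun i hi => h i (by simp only [Finset.mem_Ico] at hi ⊢; omega))
    have h₂ := h₁.append (Wk.single (p := p) (h b (by simp [hab])))
    rw [Finset.sum_Ico_succ_top hab]
    convert h₂ using 1
    rw [← Finset.insert_Ico_right_eq_Ico_add_one hab, Finset.insert_val_of_notMem (by simp),
      Multiset.map_cons,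
      add_comm, Multiset.singleton_add]

end Walks

/-! ### A lightest heavy cycle cannot exist: coverings by closed walks. -/

section BackCover

variable {V : Type*} {A : V → V → Prop} {p : V → V → ℕ}

/-- `BackCover A p c m a b P Q`: the interval from `a` to `b` of the walk `c` can be divided into
intervals, each of which is closed up by a walk from its end back to its start, giving a closed walk
of weight at most `m`. The total weight of the walks back is `P`, and `Q` is the multiset of
the tails of their arcs. -/
inductive BackCover (A : V → V → Prop) (p : V → V → ℕ) (c : ℕ → V) (m : ℕ) :
    ℕ → ℕ → ℕ → Multiset V → Prop
  | nil (a : ℕ) : BackCover A p c m a a 0 0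
  | cons {a b d P P' : ℕ} {S Q : Multiset V} (hab : a < b) (w : Wk A p (c b) (c a) P S)
      (hm : ∑ i ∈ Finset.Ico a b, p (c i) (c (i + 1)) + P ≤ m) (h : BackCover A p c m b d P' Q) :
      BackCover A p c m a d (P + P') (S + Q)

namespace BackCover

variable {c : ℕ → V} {m : ℕ}

theorem le {a b P : ℕ} {Q : Multiset V} (h : BackCover A p c m a b P Q) : a ≤ b := by
  induction h with
  | nil => exact le_rfl
  | cons hab _ _ _ ih => omega

theorem append {a b d P P' : ℕ} {Q Q' : Multiset V} (h : BackCover A p c m a b P Q)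
    (h' : BackCover A p c m b d P' Q') : BackCover A p c m a d (P + P') (Q + Q') := by
  induction h with
  | nil => simpa using h'
  | cons hab w hm _ ih =>
    rw [add_assoc, add_assoc]
    exact .cons hab w hm (ih h')

theorem shift {L : ℕ} (hc : ∀ i, c (i + L) = c i) {a b P : ℕ} {Q : Multiset V}
    (h : BackCover A p c m a b P Q) : BackCover A p c m (a + L) (b + L) P Q := by
  induction h with
  | nil => exact .nil _
  | @cons a b d P P' S Q hab w hm _ ih =>
    refine .cons (by omega) (by rwa [hc, hc]) ?_ ih
    rw [← Finset.sum_Ico_add' (fun i => p (c i) (c (i + 1)))]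
    simpa [add_right_comm _ L 1, hc] using hm

/-- The interval whose walk back visits a given vertex. -/
theorem exists_item {a d P : ℕ} {Q : Multiset V} (h : BackCover A p c m a d P Q) {v : V}
    (hv : v ∈ Q) : ∃ b b' P₁ Q₁ P₂ S P₃ Q₃, BackCover A p c m a b P₁ Q₁ ∧ b < b' ∧
      Wk A p (c b') (c b) P₂ S ∧ ∑ i ∈ Finset.Ico b b', p (c i) (c (i + 1)) + P₂ ≤ m ∧
      BackCover A p c m b' d P₃ Q₃ ∧ Q = Q₁ + S + Q₃ ∧ v ∈ S := by
  induction h with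
  | nil => simp at hv
  | @cons a b d P P' S Q hab w hm h ih =>
    by_cases hS : v ∈ S
    · exact ⟨a, b, 0, 0, P, S, P', Q, .nil a, hab, w, hm, h, by simp, hS⟩
    · obtain ⟨b₁, b₂, P₁, Q₁, P₂, S₂, P₃, Q₃, h₁, h₂, h₃, h₄, h₅, h₆, h₇⟩ :=
        ih ((Multiset.mem_add.1 hv).resolve_left hS)
      exact ⟨b₁, b₂, _, _, P₂, S₂, P₃, Q₃, .cons hab w hm h₁, h₂, h₃, h₄, h₅,
        by rw [h₆]; simp only [add_assoc], h₇⟩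

/-- Each interval together with its walk back is a closed walk of weight at most `m < N`, so it does
not gain. The inequalities are added up. -/
theorem le_sum {q : V → ℕ} {N : ℕ} (hmN : m < N) (hA : ∀ i, A (c i) (c (i + 1)))
    (hq : ∀ x P S, Wk A p x x P S → P < N → P ≤ (S.map q).sum) {a d P : ℕ} {Q : Multiset V}
    (h : BackCover A p c m a d P Q) :
    ∑ i ∈ Finset.Ico a d, p (c i) (c (i + 1)) + P
      ≤ ∑ i ∈ Finset.Ico a d, q (c i) + (Q.map q).sum := by
  induction h with
  | nil => simp
  | @cons a b d P P' S Q hab w hm h ih =>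
    have hbd := h.le
    rw [← Finset.sum_Ico_consecutive _ hab.le hbd, ← Finset.sum_Ico_consecutive _ hab.le hbd]
    have := hq _ _ _ ((Wk.of_fun c hab.le (fun i _ => hA i)).append w) (by omega)
    rw [Multiset.map_add, Multiset.sum_add, Multiset.map_map] at this
    rw [Multiset.map_add, Multiset.sum_add]
    change _ ≤ ∑ i ∈ Finset.Ico a b, q (c i) + _ at this
    omega

end BackCover

/-- A walk back that closes an interval to a closed walk lighter than `N` is cut at its repeated
vertices and where it meets the interval. The pieces are simple closed walks lighter than `N`, hence
of weight at most `m`, and no back arcs are added. -/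
theorem exists_backCover {c : ℕ → V} {m N L : ℕ} (hA : ∀ i, A (c i) (c (i + 1)))
    (hinj : ∀ i j, i < j → j < i + L → c i ≠ c j)
    (hN : ∀ i, ∑ j ∈ Finset.Ico i (i + L), p (c j) (c (j + 1)) = N)
    (hm : ∀ x P S, Wk A p x x P S → S.Nodup → P < N → P ≤ m)
    {a b P : ℕ} {S : Multiset V} (hab : a < b) (hbL : b ≤ a + L) (w : Wk A p (c b) (c a) P S)
    (hP : ∑ i ∈ Finset.Ico a b, p (c i) (c (i + 1)) + P < N) :
    ∃ P' Q, BackCover A p c m a b P' Q ∧ Q.card ≤ S.card := by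
  induction hn : (b - a) + S.card using Nat.strong_induction_on generalizing a b P S with
  | _ n ih =>
  -- A full turn alone would have weight `N`.
  have hbL' : b < a + L := by
    rcases hbL.lt_or_eq with h | rfl
    · exact h
    · rw [hN] at hP; omega
  by_cases hS : S.Nodup
  swap
  · obtain ⟨v, P₁, S₁, P₂, S₂, -, h₂, rfl, rfl, hn₁, -⟩ := w.exists_cut hS
    have := Multiset.card_pos.2 hn₁
    rw [Multiset.card_add] at hn
    obtain ⟨P', Q, h, hQ⟩ := ih (b - a + S₂.card) (by omega) hab hbL h₂ (by omega) rfl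
    exact ⟨P', Q, h, by rw [Multiset.card_add]; omega⟩
  -- If the walk back passes an inner vertex `c z`, its two halves close the intervals from `z` to
  -- `b` and from `a` to `z` separately.
  by_cases hz : ∃ z, a < z ∧ z < b ∧ c z ∈ S
  · obtain ⟨z, haz, hzb, hzS⟩ := hz
    obtain ⟨P₁, S₁, P₂, S₂, h₁, h₂, rfl, rfl, -⟩ := w.split hzS
    rw [← Finset.sum_Ico_consecutive _ haz.le hzb.le] at hP
    rw [Multiset.card_add] at hn ⊢
    obtain ⟨P', Q', h', hQ'⟩ := ih (b - z + S₁.card) (by omega) hzb (by omega) h₁ (by omega) rfl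
    obtain ⟨P'', Q'', h'', hQ''⟩ := ih (z - a + S₂.card) (by omega) haz (by omega) h₂ (by omega) rfl
    exact ⟨_, _, h''.append h', by rw [Multiset.card_add]; omega⟩
  -- A walk that reaches `c a` before its end can be stopped there.
  by_cases ha : c a ∈ S
  · obtain ⟨P₁, S₁, P₂, S₂, h₁, h₂, rfl, rfl, hmem⟩ := w.split ha
    have := Multiset.card_pos_iff_exists_mem.2 ⟨_, hmem⟩
    rw [Multiset.card_add] at hn ⊢
    obtain ⟨P', Q', h', hQ'⟩ := ih (b - a + S₁.card) (by omega) hab hbL h₁ (by omega) rfl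
    exact ⟨_, _, h', by omega⟩
  -- Now the interval and the walk back share no tail, so the closed walk is simple.
  · refine ⟨P + 0, S + 0, .cons hab w ?_ (.nil b), by simp⟩
    refine hm (c a) _ _ ((Wk.of_fun c hab.le (fun i _ => hA i)).append w) ?_ hP
    rw [Multiset.nodup_add]
    refine ⟨?_, hS, ?_⟩
    · refine Multiset.Nodup.map_on ?_ (Finset.nodup _)
      intro i hi j hj hij
      simp only [Finset.mem_val, Finset.mem_Ico] at hi hj
      rcases lt_trichotomy i j with h | h | h
      · exact absurd hij (hinj i j h (by omega))
      · exact h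
      · exact absurd hij.symm (hinj j i h (by omega))
    · rw [Multiset.disjoint_left]
      intro v hv hvS
      obtain ⟨i, hi, rfl⟩ := Multiset.mem_map.1 hv
      simp only [Finset.mem_val, Finset.mem_Ico] at hi
      rcases hi.1.lt_or_eq with h | rfl
      · exact hz ⟨i, h, hi.2, hvS⟩
      · exact ha hvS

/-- A closed simple walk whose weight exceeds twice the total gain cannot exist if all lighter
closed
walks do not gain and each of its arcs lies on a lighter closed walk. -/
theorem false_of_heavy_cycle [Fintype V] {q : V → ℕ} {c : ℕ → V} {m N L : ℕ}
    (hL : 0 < L) (hc : ∀ i, c (i + L) = c i) (hA : ∀ i, A (c i) (c (i + 1)))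
    (hinj : ∀ i j, i < j → j < i + L → c i ≠ c j)
    (hN : ∑ j ∈ Finset.range L, p (c j) (c (j + 1)) = N)
    (hqm : ∑ v, q v ≤ m) (hmN : 2 * m < N)
    (hq : ∀ x P S, Wk A p x x P S → P < N → P ≤ (S.map q).sum)
    (hback : ∀ i, ∃ P S, Wk A p (c (i + 1)) (c i) P S ∧ p (c i) (c (i + 1)) + P < N) : False := by
  classical
  -- By periodicity, every full turn has weight `N`, wherever it starts.
  have hN' : ∀ i, ∑ j ∈ Finset.Ico i (i + L), p (c j) (c (j + 1)) = N := by
    intro i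
    induction i with
    | zero => rwa [Nat.zero_add, ← Finset.range_eq_Ico]
    | succ i ih =>
      rw [Finset.sum_eq_sum_Ico_succ_bot (by omega)] at ih
      rw [show i + 1 + L = i + L + 1 by omega, Finset.sum_Ico_succ_top (by omega), hc,
        show i + L + 1 = i + 1 + L by omega, hc]
      omega
  have hnodup : ∀ S : Multiset V, S.Nodup → (S.map q).sum ≤ m := by
    intro S hS
    refine le_trans ?_ hqm
    have hsub : (Finset.mk S hS) ⊆ Finset.univ := Finset.subset_univ _
    exact Finset.sum_le_sum_of_subset (f := q) hsub
  have hm : ∀ x P S, Wk A p x x P S → S.Nodup → P < N → P ≤ m := fun x P S w hS hP =>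
    (hq x P S w hP).trans (hnodup S hS)
  have key := fun {a b P : ℕ} {S : Multiset V} => exists_backCover hA hinj hN' hm (a := a) (b := b)
    (P := P) (S := S)
  -- The walks back along the single arcs give some covering of a full turn. One with the fewest
  -- back arcs is chosen, with the starting point left free.
  have hex : ∃ n a P Q, BackCover A p c m a (a + L) P Q ∧ Q.card = n := by
    have : ∀ k, ∃ P Q, BackCover A p c m 0 k P Q := by
      intro k
      induction k with
      | zero => exact ⟨0, 0, .nil 0⟩
      | succ k ih =>
        obtain ⟨P, Q, h⟩ := ih
        obtain ⟨P', S, w, hw⟩ := hback k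
        obtain ⟨P'', Q'', h'', -⟩ := key (Nat.lt_succ_self k) (by omega) w (by simpa using hw)
        exact ⟨_, _, h.append h''⟩
    obtain ⟨P, Q, h⟩ := this L
    exact ⟨_, 0, P, Q, by simpa using h, rfl⟩
  obtain ⟨a, P, Q, hcov, hcard⟩ := Nat.find_spec hex
  have hmin : ∀ a P Q', BackCover A p c m a (a + L) P Q' → Q.card ≤ Q'.card := by
    intro a P Q' h
    rw [hcard]
    exact Nat.find_min' hex ⟨a, P, Q', h, rfl⟩
  -- Two walks back that meet in `v` exchange their ends: one new walk closes the interval from `b`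
  -- to `d'`, the other the interval from `d` to `b' + L`.
  have cross : ∀ {b b' d d' P₁ P₂ P₃ P₄ P₅ : ℕ} {Q₁ Q₂ Q₃ S S' : Multiset V} {v : V},
      BackCover A p c m a b P₁ Q₁ → b < b' → Wk A p (c b') (c b) P₂ S →
      ∑ i ∈ Finset.Ico b b', p (c i) (c (i + 1)) + P₂ ≤ m → BackCover A p c m b' d P₃ Q₂ →
      d < d' → Wk A p (c d') (c d) P₄ S' → ∑ i ∈ Finset.Ico d d', p (c i) (c (i + 1)) + P₄ ≤ m →
      BackCover A p c m d' (a + L) P₅ Q₃ → Q = Q₁ + S + Q₂ + S' + Q₃ → v ∈ S → v ∈ S' → False := by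
    intro b b' d d' P₁ P₂ P₃ P₄ P₅ Q₁ Q₂ Q₃ S S' v h₁ hb w₁ hm₁ h₂ hd w₂ hm₂ h₃ hQ hv hv'
    obtain ⟨Pa, Sa, Pb, Sb, wa, wb, rfl, rfl, hSb⟩ := w₁.split hv
    obtain ⟨Pc, Sc, Pd, Sd, wc, wd, rfl, rfl, hSd⟩ := w₂.split hv'
    have cb := Multiset.card_pos_iff_exists_mem.2 ⟨_, hSb⟩
    have cd := Multiset.card_pos_iff_exists_mem.2 ⟨_, hSd⟩
    have l₁ := h₁.le
    have l₂ := h₂.le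
    have l₃ := h₃.le
    have hcardQ := congrArg Multiset.card hQ
    simp only [Multiset.card_add] at hcardQ
    have e₁ := Finset.sum_Ico_consecutive (fun i => p (c i) (c (i + 1))) hb.le (l₂.trans hd.le)
    have e₂ := Finset.sum_Ico_consecutive (fun i => p (c i) (c (i + 1))) l₂ hd.le
    have e₃ := Finset.sum_Ico_consecutive (fun i => p (c i) (c (i + 1))) hd.le
      (show d' ≤ b' + L by omega)
    have e₄ := Finset.sum_Ico_consecutive (fun i => p (c i) (c (i + 1))) (hb.le.trans (l₂.trans
      hd.le))
      (show d' ≤ b + L by omega)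
    have e₅ := Finset.sum_Ico_consecutive (fun i => p (c i) (c (i + 1))) (show d' ≤ b + L by omega)
      (show b + L ≤ b' + L by omega)
    have e₆ := hN' b
    have e₇ : ∑ i ∈ Finset.Ico (b + L) (b' + L), p (c i) (c (i + 1))
        = ∑ i ∈ Finset.Ico b b', p (c i) (c (i + 1)) := by
      rw [← Finset.sum_Ico_add' (fun i => p (c i) (c (i + 1)))]
      simp [add_right_comm _ L 1, hc]
    -- The two new closed walks together weigh `N` plus the two old ones, at most `N + 2 * m < 2 *
    -- N`, so one of them is lighter than `N`. It yields a covering of a full turn in which a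
    -- nonempty part of a walk back is dropped, against minimality. In the second case the new turn
    -- starts at `d`.
    rcases Nat.lt_or_ge (∑ i ∈ Finset.Ico b d', p (c i) (c (i + 1)) + (Pc + Pb)) N with h | h
    · obtain ⟨P', Q', h', hQ'⟩ := key (by omega) (by omega) (wc.append wb) h
      have := hmin _ _ _ ((h₁.append h').append h₃)
      simp only [Multiset.card_add] at this hQ'
      omega
    · obtain ⟨P', Q', h', hQ'⟩ := key (a := d) (b := b' + L) (by omega) (by omega)
        (by rw [hc]; exact wa.append wd) (by omega)
      have := hmin _ _ _ (h'.append (h₂.shift hc))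
      simp only [Multiset.card_add] at this hQ'
      omega
  have hQ : Q.Nodup := by
    by_contra hQ
    rw [Multiset.nodup_iff_ne_cons_cons] at hQ
    push Not at hQ
    obtain ⟨v, Q₀, hQ₀⟩ := hQ
    obtain ⟨b, b', P₁, Q₁, P₂, S, P₃, Q₃, h₁, hb, w, hm', h₃, hQe, hvS⟩ :=
      hcov.exists_item (v := v) (by rw [hQ₀]; simp)
    by_cases hS : S.Nodup
    -- If the walk back through `v` is simple, the second occurrence of `v` is on another walk back,
    -- before or after it, and `cross` applies.
    · have hcount : Multiset.count v Q₁ + Multiset.count v S + Multiset.count v Q₃ ≥ 2 := by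
        rw [← Multiset.count_add, ← Multiset.count_add, ← hQe, hQ₀]
        simp
      have := Multiset.nodup_iff_count_le_one.1 hS v
      rcases Nat.eq_zero_or_pos (Multiset.count v Q₁) with h0 | h0
      · obtain ⟨d, d', P₄, Q₄, P₅, S', P₆, Q₆, h₄, hd, w', hm'', h₆, hQe', hvS'⟩ :=
          h₃.exists_item (v := v) (Multiset.count_pos.1 (by omega))
        exact cross h₁ hb w hm' h₄ hd w' hm'' h₆ (by rw [hQe, hQe']; simp only [add_assoc]) hvS hvS'
      · obtain ⟨d, d', P₄, Q₄, P₅, S', P₆, Q₆, h₄, hd, w', hm'', h₆, hQe', hvS'⟩ :=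
          h₁.exists_item (v := v) (Multiset.count_pos.1 h0)
        exact cross h₄ hd w' hm'' h₆ hb w hm' h₃ (by rw [hQe, hQe']) hvS' hvS
    -- A walk back that is not simple could be shortened by cutting out a closed part.
    · obtain ⟨u, P₄, S₄, P₅, S₅, -, w', rfl, rfl, hn, -⟩ := w.exists_cut hS
      have := hmin _ _ _ (h₁.append (.cons hb w' (by omega) h₃))
      have := Multiset.card_pos.2 hn
      have := congrArg Multiset.card hQe
      simp only [Multiset.card_add] at *
      omega
  -- The cycle weighs `N`, but the gains on the cycle and on the walks back are each at most `m`, as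
  -- neither visits a vertex twice.
  have h₁ := hcov.le_sum (by omega) hA hq
  rw [hN'] at h₁
  have h₂ := hnodup Q hQ
  have h₃ : ∑ i ∈ Finset.Ico a (a + L), q (c i) ≤ m := by
    refine hnodup ((Finset.Ico a (a + L)).val.map c) ?_ |>.trans' ?_
    · refine Multiset.Nodup.map_on ?_ (Finset.nodup _)
      intro i hi j hj hij
      simp only [Finset.mem_val, Finset.mem_Ico] at hi hj
      rcases lt_trichotomy i j with h | h | h
      · exact absurd hij (hinj i j h (by omega))
      · exact h
      · exact absurd hij.symm (hinj j i h (by omega))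
    · rw [Multiset.map_map]; rfl
  omega

end BackCover

/-! ### Cycles of permutations as closed walks. -/

section Permutations

variable {V : Type*}

theorem Wk.mono {A A' : V → V → Prop} {p : V → V → ℕ} (hA : ∀ x y, A x y → A' x y) {x y : V} {P : ℕ}
    {S : Multiset V} (h : Wk A p x y P S) : Wk A' p x y P S := by
  induction h with
  | nil x => exact .nil x
  | cons h _ ih => exact .cons (hA _ _ h) ih

theorem Wk.eq_sum {τ : V → V} {p : V → V → ℕ} {x y : V} {P : ℕ}
    {S : Multiset V} (h : Wk (fun x y => y = τ x) p x y P S) :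
    P = (S.map fun x => p x (τ x)).sum := by
  induction h with
  | nil x => simp
  | cons h _ ih => subst h; simp [ih]

theorem Multiset.Nodup.sum_map_le [Fintype V] {S : Multiset V} (hS : S.Nodup) (f : V → ℕ) :
    (S.map f).sum ≤ ∑ x, f x := by
  have hsub : (Finset.mk S hS) ⊆ Finset.univ := Finset.subset_univ _
  exact Finset.sum_le_sum_of_subset (f := f) hsub

theorem Multiset.Nodup.card_le [Fintype V] {S : Multiset V} (hS : S.Nodup) :
    S.card ≤ Fintype.card V :=
  Finset.card_le_univ (Finset.mk S hS)

variable [Fintype V]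

/-- If a permutation has positive gain, then one of its cycles has. -/
theorem Equiv.Perm.exists_cycle_gain (τ : Equiv.Perm V) (p : V → V → ℕ) (q : V → ℕ)
    (h : ∑ x, q x < ∑ x, p x (τ x)) :
    ∃ x P S, Wk (fun x y => y = τ x) p x x P S ∧ S.Nodup ∧ (S.map q).sum < P := by
  by_contra! hcon
  have hN : 0 < orderOf τ := orderOf_pos τ
  -- After `orderOf τ` steps all orbits close up simultaneously. Summing over all starting points
  -- then counts each vertex `orderOf τ` times, so the cycles need not be listed.
  have hle : ∀ x, ∑ i ∈ Finset.range (orderOf τ), p ((τ ^ i) x) (τ ((τ ^ i) x))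
      ≤ ∑ i ∈ Finset.range (orderOf τ), q ((τ ^ i) x) := by
    intro x
    have hw := Wk.of_fun (A := fun x y => y = τ x) (p := p) (fun i => (τ ^ i) x)
      (Nat.zero_le (orderOf τ)) (fun i _ => by rw [pow_succ', Equiv.Perm.mul_apply])
    simp only [pow_orderOf_eq_one, pow_zero] at hw
    have := Wk.le_of_simple (q := q) (fun x P S w hS _ => hcon x P S w hS) hw (Nat.lt_succ_self _)
    rw [Multiset.map_map] at this
    rw [Finset.range_eq_Ico]
    refine (le_of_eq ?_).trans (this.trans (le_of_eq rfl))
    simp only [pow_succ', Equiv.Perm.mul_apply]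
  have hsum : ∀ f : V → ℕ, ∑ x, ∑ i ∈ Finset.range (orderOf τ), f ((τ ^ i) x)
      = orderOf τ * ∑ x, f x := by
    intro f
    rw [Finset.sum_comm]
    simp only [Equiv.sum_comp, Finset.sum_const, Finset.card_range, smul_eq_mul]
  have := Finset.sum_le_sum (s := Finset.univ) (fun x _ => hle x)
  rw [hsum (fun x => p x (τ x)), hsum] at this
  exact absurd (Nat.le_of_mul_le_mul_left this hN) (by omega)

/-- The cycle of a permutation leads back from `τ u` to `u`. -/
theorem Equiv.Perm.exists_walk_back (τ : Equiv.Perm V) (p : V → V → ℕ) (u : V) :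
    ∃ P S, Wk (fun x y => y = τ x) p (τ u) u P S ∧ p u (τ u) + P ≤ ∑ x, p x (τ x) := by
  have hpos : 0 < Function.minimalPeriod τ u :=
    Function.minimalPeriod_pos_of_mem_periodicPts
      ((Function.Injective.mem_periodicPts τ.injective u))
  obtain ⟨k, hk⟩ := Nat.exists_eq_add_of_lt hpos
  rw [Nat.zero_add] at hk
  have hw := Wk.of_fun (A := fun x y => y = τ x) (p := p) (fun i => τ^[i] u)
    (show 1 ≤ k + 1 by omega) (fun i _ => Function.iterate_succ_apply' τ i u)
  have h1 : τ^[k + 1] u = u := by rw [← hk]; exact Function.iterate_minimalPeriod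
  simp only [h1, Function.iterate_one] at hw
  refine ⟨_, _, hw, ?_⟩
  have h2 := Finset.sum_eq_sum_Ico_succ_bot (show 0 < k + 1 by omega)
    (fun i => p (τ^[i] u) (τ^[i + 1] u))
  simp only [Function.iterate_zero, id, Nat.zero_add, Function.iterate_one] at h2
  rw [← h2]
  -- Within one minimal period the orbit does not repeat, so its weight is part of the total weight.
  have hnd : ((Finset.Ico 0 (k + 1)).val.map (fun i => τ^[i] u)).Nodup := by
    refine Multiset.Nodup.map_on ?_ (Finset.nodup _)
    intro i hi j hj hij
    simp only [Finset.mem_val, Finset.mem_Ico] at hi hj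
    exact Function.iterate_injOn_Iio_minimalPeriod (by simp [hk]; omega) (by simp [hk]; omega) hij
  refine le_trans (le_of_eq ?_) (hnd.sum_map_le (fun x => p x (τ x)))
  rw [Multiset.map_map]
  simp only [Function.iterate_succ_apply']
  rfl

end Permutations

/-! ### The local search and why it does not get stuck. -/

section LocalSearch

variable {V : Type*}

/-- Weights for the local search that uses only arcs `x, y` with `g x y ≤ t`. -/
def redWeight (col g : V → V → ℕ) (t : ℕ) (x y : V) : ℕ :=
  if col x y = 0 then 2 * t + 1 else if g x y ≤ t then col x y - 1 else 2 * t + 1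

theorem redWeight_of_allowed {col g : V → V → ℕ} (hcol : ∀ x y, col x y ≤ 2) {t : ℕ} {x y : V}
    (h0 : col x y ≠ 0) (hg : g x y ≤ t) : redWeight col g t x y = if col x y = 2 then 1 else 0 := by
  have : col x y = 1 ∨ col x y = 2 := by have := hcol x y; omega
  rcases this with h | h <;> simp [redWeight, hg, h]

theorem allowed_of_redWeight_le {col g : V → V → ℕ} {t : ℕ} {x y : V}
    (h : redWeight col g t x y ≤ 2 * t) : col x y ≠ 0 ∧ g x y ≤ t := by
  unfold redWeight at h
  split_ifs at h with h1 h2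
  · omega
  · exact ⟨h1, h2⟩
  · omega

variable [Fintype V]

/-- The weight of an assignment. -/
def weight (W : V → V → ℕ) (σ : Equiv.Perm V) : ℕ := ∑ x, W x (σ x)

/-- No closed walk of at most `card V` arcs and of weight at most `B` in the residual digraph of `σ`
improves the weight. -/
def Stuck (W : V → V → ℕ) (B : ℕ) (σ : Equiv.Perm V) : Prop :=
  ∀ x P S, Wk (fun _ _ => True) (fun x y => W x (σ y)) x x P S → S.card ≤ Fintype.card V → P ≤ B →
    P ≤ (S.map fun x => W x (σ x)).sum

/-- `σ'` arises from `σ` by a step of the local search with budget `B`. -/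
def Improves (W : V → V → ℕ) (B : ℕ) (σ σ' : Equiv.Perm V) : Prop :=
  (Stuck W B σ ∧ σ' = σ) ∨ (¬ Stuck W B σ ∧ weight W σ < weight W σ' ∧ weight W σ' ≤ weight W σ + B
      ∧
    ∀ x, σ' x = σ x ∨ W x (σ' x) ≤ B)

/-- If `σ'` were heavier, some cycle of `σ⁻¹ * σ'` would gain. The weight of this cycle is part of
the weight of `σ'`, so it is within the budget. With a large enough budget, stuck therefore means
optimal. -/
theorem Stuck.weight_le {W : V → V → ℕ} {B : ℕ} {σ : Equiv.Perm V} (h : Stuck W B σ)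
    (σ' : Equiv.Perm V) (hB : weight W σ' ≤ B) : weight W σ' ≤ weight W σ := by
  by_contra! hlt
  set τ : Equiv.Perm V := σ⁻¹ * σ' with hτ
  have hστ : ∀ x, σ (τ x) = σ' x := fun x => by simp [hτ]
  obtain ⟨x, P, S, w, hS, hgain⟩ := τ.exists_cycle_gain (fun x y => W x (σ y))
    (fun x => W x (σ x)) (by simp only [hστ]; exact hlt)
  have hP := w.eq_sum
  have := hS.sum_map_le (fun x => W x (σ (τ x)))
  have hw : ∑ x, W x (σ (τ x)) = weight W σ' := by simp only [hστ]; rfl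
  have := h x P S (w.mono fun _ _ _ => trivial) hS.card_le (by omega)
  omega

/-- Each step that is not stuck raises the weight by at least 1, and a stuck assignment no longer
changes. -/
theorem Improves.stuck_of_iterate {W : V → V → ℕ} {B K : ℕ} {f : ℕ → Equiv.Perm V}
    (hf : ∀ i < K, Improves W B (f i) (f (i + 1))) (hK : ∀ σ, weight W σ < K) : Stuck W B (f K) :=
      by
  have : ∀ i ≤ K, Stuck W B (f i) ∨ i ≤ weight W (f i) := by
    intro i
    induction i with
    | zero => intro _; right; exact Nat.zero_le _
    | succ i ih =>
      intro hi
      rcases hf i (by omega) with ⟨h, he⟩ | ⟨hs, h, -⟩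
      · left; rwa [he]
      · right
        have := (ih (by omega)).resolve_left hs
        omega
  rcases this K le_rfl with h | h
  · exact h
  · exact absurd (hK (f K)) (by omega)

/-- All arcs of the assignment are present in the colour matrix. -/
def Valid (col : V → V → ℕ) (σ : Equiv.Perm V) : Prop := ∀ x, col x (σ x) ≠ 0

/-- The number of red arcs of the assignment. -/
def numTwo (col : V → V → ℕ) (σ : Equiv.Perm V) : ℕ :=
  (Finset.univ.filter fun x => col x (σ x) = 2).card

theorem numTwo_le (col : V → V → ℕ) (σ : Equiv.Perm V) : numTwo col σ ≤ Fintype.card V :=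
  Finset.card_filter_le _ _

/-- Weights whose maximum is attained at the assignments with fewest red arcs among the valid ones
that use only arcs in `ok`. -/
def minRedWeight (n : ℕ) (col : V → V → ℕ) (ok : V → V → Prop) [∀ x y, Decidable (ok x y)]
    (x y : V) : ℕ :=
  if ok x y then (if col x y = 0 then 0 else if col x y = 1 then n + 1 else n) else 0

/-- For an admissible valid assignment, weight plus number of red arcs is n(n + 1), where n is the
number of vertices, so more weight means fewer red arcs. -/
theorem minRedWeight_max {col : V → V → ℕ} (hcol : ∀ x y, col x y ≤ 2) {ok : V → V → Prop}
    [∀ x y, Decidable (ok x y)] {σ ρ : Equiv.Perm V}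
    (h : weight (minRedWeight (Fintype.card V) col ok) ρ
      ≤ weight (minRedWeight (Fintype.card V) col ok) σ)
    (hρ : Valid col ρ) (hok : ∀ x, ok x (ρ x)) :
    Valid col σ ∧ (∀ x, ok x (σ x)) ∧ numTwo col σ ≤ numTwo col ρ := by
  classical
  set n := Fintype.card V with hn
  have key : ∀ σ : Equiv.Perm V, Valid col σ → (∀ x, ok x (σ x)) →
      weight (minRedWeight n col ok) σ + numTwo col σ = n * (n + 1) := by
    intro σ hσ hok
    rw [weight, numTwo, Finset.card_filter, ← Finset.sum_add_distrib]
    rw [Finset.sum_congr rfl (g := fun _ => n + 1), Finset.sum_const, Finset.card_univ, ← hn,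
      smul_eq_mul]
    intro x _
    have h0 := hσ x
    have h2 := hcol x (σ x)
    have : col x (σ x) = 1 ∨ col x (σ x) = 2 := by omega
    rcases this with h | h <;> simp [minRedWeight, hok x, h]
  -- One arc of weight 0 leaves at most (n - 1)(n + 1) < n², whereas `ρ` already has weight at least
  -- n².
  have hbad : ∀ x, minRedWeight n col ok x (σ x) ≠ 0 := by
    intro x hx
    have h1 : weight (minRedWeight n col ok) σ ≤ (n - 1) * (n + 1) := by
      rw [weight, ← Finset.add_sum_erase _ _ (Finset.mem_univ x), hx, Nat.zero_add]
      refine (Finset.sum_le_card_nsmul _ _ (n + 1) ?_).trans ?_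
      · intro y _
        unfold minRedWeight
        split_ifs <;> omega
      · rw [Finset.card_erase_of_mem (Finset.mem_univ x), Finset.card_univ, smul_eq_mul]
    have h2 := key ρ hρ hok
    have h3 := numTwo_le col ρ
    have h4 : 0 < n := Fintype.card_pos_iff.2 ⟨x⟩
    obtain ⟨k, hk⟩ : ∃ k, n = k + 1 := ⟨n - 1, by omega⟩
    rw [← hn] at h3
    rw [hk] at h1 h2 h3 h
    simp only [Nat.add_sub_cancel] at h1
    nlinarith
  have hv : Valid col σ := fun x hx => hbad x (by simp [minRedWeight, hx])
  have hokσ : ∀ x, ok x (σ x) := fun x => by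
    by_contra hx
    exact hbad x (by simp [minRedWeight, hx])
  refine ⟨hv, hokσ, ?_⟩
  have h1 := key σ hv hokσ
  have h2 := key ρ hρ hok
  omega

theorem weight_redWeight {col g : V → V → ℕ} (hcol : ∀ x y, col x y ≤ 2) {t : ℕ} {σ : Equiv.Perm V}
    (hσ : Valid col σ) (hg : ∀ x, g x (σ x) ≤ t) : weight (redWeight col g t) σ = numTwo col σ := by
  rw [weight, numTwo, Finset.card_filter]
  exact Finset.sum_congr rfl fun x _ => redWeight_of_allowed hcol (hσ x) (hg x)

/-- `g x y` is the minimum number of red arcs of a valid assignment that maps `x` to `y`, and larger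
than the number of vertices if there is none. -/
def IsMinRed (col g : V → V → ℕ) : Prop :=
  ∀ x y, (∀ ρ, Valid col ρ → ρ x = y → g x y ≤ numTwo col ρ) ∧
    (g x y ≤ Fintype.card V → ∃ ρ, Valid col ρ ∧ ρ x = y ∧ numTwo col ρ = g x y)

/-- The combinatorial core. The bound on `g` along `σ'` makes its arcs usable and gives each of them
a light way back, which is what `false_of_heavy_cycle` needs, with `m = t`. -/
theorem not_stuck {col g : V → V → ℕ} (hcol : ∀ x y, col x y ≤ 2) (hg : IsMinRed col g) {t : ℕ}
    (ht : t ≤ Fintype.card V) {σ σ' : Equiv.Perm V} (hσ : Valid col σ) (hσg : ∀ x, g x (σ x) ≤ t)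
    (hσt : numTwo col σ ≤ t) (hσ' : Valid col σ') (hσ'g : ∀ x, g x (σ' x) ≤ t)
    (hσ't : t < numTwo col σ') : ¬ Stuck (redWeight col g t) (2 * t) σ := by
  classical
  intro hstuck
  set A : V → V → Prop := fun x y => col x (σ y) ≠ 0 ∧ g x (σ y) ≤ t with hA
  set p : V → V → ℕ := fun x y => redWeight col g t x (σ y) with hp
  set q : V → ℕ := fun x => redWeight col g t x (σ x) with hq
  have hqm : ∑ v, q v ≤ t := (weight_redWeight hcol hσ hσg).trans_le hσt
  have perm : ∀ ρ : Equiv.Perm V, Valid col ρ → (∀ x, g x (ρ x) ≤ t) →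
      (∀ x y, y = (σ⁻¹ * ρ) x → A x y) ∧ ∑ x, p x ((σ⁻¹ * ρ) x) = numTwo col ρ := by
    intro ρ hρ hρg
    refine ⟨?_, ?_⟩
    · rintro x y rfl
      simpa [hA] using ⟨hρ x, hρg x⟩
    · rw [← weight_redWeight hcol hρ hρg]
      simp [hp, weight]
  -- light simple closed walks do not gain
  have hlight : ∀ x P S, Wk A p x x P S → S.Nodup → P ≤ 2 * t → P ≤ (S.map q).sum :=
    fun x P S w hS hP => hstuck x P S (w.mono fun _ _ _ => trivial) hS.card_le hP
  -- Some cycle of `σ⁻¹ * σ'` gains, as `σ'` has more red arcs than `σ`. Being stuck excludes weight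
  -- at most `2 * t`.
  have hex : ∃ N x S, Wk A p x x N S ∧ S.Nodup ∧ 2 * t < N := by
    obtain ⟨h1, h2⟩ := perm σ' hσ' hσ'g
    have h3 := weight_redWeight hcol hσ hσg
    obtain ⟨x, P, S, w, hS, hgain⟩ := (σ⁻¹ * σ').exists_cycle_gain p q (by
      rw [h2]; exact hqm.trans_lt hσ't)
    refine ⟨P, x, S, w.mono h1, hS, ?_⟩
    by_contra! hP
    exact absurd (hlight x P S (w.mono h1) hS hP) (by omega)
  obtain ⟨x, S, w, hS, hN⟩ := Nat.find_spec hex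
  have hmin : ∀ x P S, Wk A p x x P S → S.Nodup → P < Nat.find hex → P ≤ 2 * t := by
    intro x P S w hS hP
    by_contra! h
    exact absurd (Nat.find_min' hex ⟨x, S, w, hS, h⟩) (by omega)
  generalize Nat.find hex = N at w hN hmin
  obtain ⟨c, h0, h1, h2, h3, h4⟩ := w.exists_fun
  set L := S.card with hL
  have hLpos : 0 < L := by
    rcases Nat.eq_zero_or_pos L with h | h
    · rw [h] at h3; simp at h3; omega
    · exact h
  have hcinj : ∀ i < L, ∀ j < L, c i = c j → i = j := by
    intro i hi j hj hij
    rw [h4] at hS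
    exact Multiset.inj_on_of_nodup_map hS i (Multiset.mem_range.2 hi) j (Multiset.mem_range.2 hj)
      hij
  have hmod : ∀ i, c ((i + 1) % L) = c (i % L + 1) := by
    intro i
    have hlt := Nat.mod_lt i hLpos
    rw [← Nat.mod_add_mod]
    rcases Nat.lt_or_ge (i % L + 1) L with h | h
    · rw [Nat.mod_eq_of_lt h]
    · have h5 : i % L + 1 = L := by omega
      rw [h5, Nat.mod_self, h0, h1]
  -- Reducing the index modulo `L` turns the closed walk into a periodic sequence.
  refine false_of_heavy_cycle (A := A) (p := p) (q := q) (c := fun i => c (i % L)) (m := t) (N := N)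
    hLpos (fun i => by simp) (fun i => ?_) ?_ ?_ hqm hN ?_ (fun i => ?_)
  · rw [hmod]
    exact h2 _ (Nat.mod_lt i hLpos)
  · intro i j hij hjL hc
    have := hcinj _ (Nat.mod_lt i hLpos) _ (Nat.mod_lt j hLpos) hc
    have hd := (Nat.modEq_iff_dvd' hij.le).1 this
    have := Nat.le_of_dvd (by omega) hd
    omega
  · rw [h3]
    refine Finset.sum_congr rfl fun i hi => ?_
    simp only [hmod, Nat.mod_eq_of_lt (Finset.mem_range.1 hi)]
  · intro x P S w hP
    exact w.le_of_simple (fun x P S w hS hP => hlight x P S w hS (hmin x P S w hS hP)) hP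
  · simp only [hmod]
    obtain ⟨hc0, hcg⟩ := h2 _ (Nat.mod_lt i hLpos)
    -- A valid assignment `ρ` through this arc with at most `t` red arcs uses only arcs with `g ≤
    -- t`. The cycle of `σ⁻¹ * ρ` through the arc leads back with weight at most `t`.
    obtain ⟨ρ, hρ, hρe, hρr⟩ := (hg _ _).2 (hcg.trans ht)
    have hρt : numTwo col ρ ≤ t := by omega
    obtain ⟨h5, h6⟩ := perm ρ hρ (fun x => ((hg x (ρ x)).1 ρ hρ rfl).trans hρt)
    obtain ⟨P, S, w, hw⟩ := (σ⁻¹ * ρ).exists_walk_back p (c (i % L))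
    have h7 : (σ⁻¹ * ρ) (c (i % L)) = c (i % L + 1) := by simp [hρe]
    rw [h6] at hw
    rw [h7] at hw w
    exact ⟨P, S, w.mono h5, by omega⟩

/-- The local search from an assignment with at most `t` red arcs reaches an assignment with more
than `t` and at most `3 * t` red arcs, if there is a valid assignment with more than `t` red arcs.
-/
theorem exists_numTwo_between {col g : V → V → ℕ} (hcol : ∀ x y, col x y ≤ 2) (hg : IsMinRed col g)
    {t K : ℕ}
    (ht : t ≤ Fintype.card V) {f : ℕ → Equiv.Perm V}
    (hf : ∀ i < K, Improves (redWeight col g t) (2 * t) (f i) (f (i + 1)))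
    (hK : ∀ σ, weight (redWeight col g t) σ < K) (h0 : Valid col (f 0)) (h0t : numTwo col (f 0) ≤ t)
    {σ' : Equiv.Perm V} (hσ' : Valid col σ') (hσ'g : ∀ x, g x (σ' x) ≤ t)
    (hσ't : t < numTwo col σ') :
    ∃ i < K, Valid col (f (i + 1)) ∧ t < numTwo col (f (i + 1)) ∧ numTwo col (f (i + 1)) ≤ 3 * t :=
      by
  by_contra! hcon
  -- If the range from `t + 1` to `3 * t` is never hit, the search remains below: a step adds at
  -- most `2 * t`, and the budget rules out forbidden arcs, whose weight is `2 * t + 1`. After `K`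
  -- steps it would be stuck.
  have : ∀ i ≤ K, Valid col (f i) ∧ (∀ x, g x (f i x) ≤ t) ∧ numTwo col (f i) ≤ t := by
    intro i
    induction i with
    | zero => exact fun _ => ⟨h0, fun x => ((hg x _).1 _ h0 rfl).trans h0t, h0t⟩
    | succ i ih =>
      intro hi
      obtain ⟨i1, i2, i3⟩ := ih (by omega)
      rcases hf i (by omega) with ⟨-, he⟩ | ⟨-, -, h2, h3⟩
      · rw [he]; exact ⟨i1, i2, i3⟩
      · have hall : ∀ x, col x (f (i + 1) x) ≠ 0 ∧ g x (f (i + 1) x) ≤ t := by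
          intro x
          rcases h3 x with h | h
          · rw [h]; exact ⟨i1 x, i2 x⟩
          · exact allowed_of_redWeight_le h
        have hv : Valid col (f (i + 1)) := fun x => (hall x).1
        have hgt := fun x => (hall x).2
        refine ⟨hv, hgt, ?_⟩
        by_contra! hlt
        have := hcon i (by omega) hv hlt
        rw [weight_redWeight hcol hv hgt, weight_redWeight hcol i1 i2] at h2
        omega
  obtain ⟨h1, h2, h3⟩ := this K le_rfl
  exact not_stuck hcol hg ht h1 h2 h3 hσ' hσ'g hσ't (Improves.stuck_of_iterate hf hK)

end LocalSearch

/-! ### Rotating an assignment along a closed walk. -/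

section Shift

variable {V : Type*}

theorem Wk.weight_le {A : V → V → Prop} {p : V → V → ℕ} {w : ℕ} (hp : ∀ x y, p x y ≤ w) {x y : V}
    {P : ℕ} {S : Multiset V} (h : Wk A p x y P S) : P ≤ S.card * w := by
  induction h with
  | nil x => simp
  | @cons x y z P S _ _ ih =>
    rw [Multiset.card_cons, Nat.succ_mul]
    have := hp x y
    omega

variable [Fintype V]

/-- Rotating an assignment along a simple closed walk. -/
theorem exists_rotate (σ : Equiv.Perm V) (W : V → V → ℕ) (c : ℕ → V) (L : ℕ)
    (hc : ∀ i < L, ∀ j < L, c i = c j → i = j) (hcL : c L = c 0) (f : V → V)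
    (hf : ∀ i < L, f (c i) = σ (c (i + 1))) (hf' : ∀ x, (∀ i < L, c i ≠ x) → f x = σ x) :
    ∃ σ' : Equiv.Perm V, (∀ x, σ' x = f x) ∧
      weight W σ' + ∑ i ∈ Finset.range L, W (c i) (σ (c i))
        = weight W σ + ∑ i ∈ Finset.range L, W (c i) (σ (c (i + 1))) := by
  classical
  set l : List V := (List.range L).map c with hl
  have hlen : l.length = L := by simp [hl]
  have hnd : l.Nodup := by
    refine List.Nodup.map_on ?_ List.nodup_range
    intro i hi j hj
    exact hc i (List.mem_range.1 hi) j (List.mem_range.1 hj)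
  have hget : ∀ i (h : i < L), l[i]'(by omega) = c i := by
    intro i h
    simp [hl]
  have hτ : ∀ i < L, l.formPerm (c i) = c (i + 1) := by
    intro i hi
    rw [← hget i hi, List.formPerm_apply_getElem l hnd i (by omega), hget _ (by
      rw [hlen]; exact Nat.mod_lt _ (by omega))]
    rw [hlen]
    rcases Nat.lt_or_ge (i + 1) L with h | h
    · rw [Nat.mod_eq_of_lt h]
    · have : i + 1 = L := by omega
      rw [this, Nat.mod_self, hcL]
  have hτ' : ∀ x, (∀ i < L, c i ≠ x) → l.formPerm x = x := by
    intro x hx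
    refine List.formPerm_apply_of_notMem ?_
    simp only [hl, List.mem_map, List.mem_range, not_exists, not_and]
    exact hx
  -- The new assignment is `σ` after the cyclic shift along `c`: each vertex takes over the image of
  -- its successor.
  have hσ' : ∀ x, (σ * l.formPerm) x = f x := by
    intro x
    by_cases hx : ∃ i < L, c i = x
    · obtain ⟨i, hi, rfl⟩ := hx
      simp [hτ i hi, hf i hi]
    · push Not at hx
      simp [hτ' x hx, hf' x hx]
  refine ⟨_, hσ', ?_⟩
  set T := (Finset.range L).image c with hT
  have hinj : Set.InjOn c (Finset.range L) := fun i hi j hj =>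
    hc i (Finset.mem_range.1 hi) j (Finset.mem_range.1 hj)
  rw [weight, weight, ← Finset.sum_add_sum_compl T, ← Finset.sum_add_sum_compl T (fun x => W x (σ
      x)),
    hT, Finset.sum_image hinj, Finset.sum_image hinj]
  have h1 : ∑ i ∈ Finset.range L, W (c i) ((σ * l.formPerm) (c i))
      = ∑ i ∈ Finset.range L, W (c i) (σ (c (i + 1))) :=
    Finset.sum_congr rfl fun i hi => by simp [hτ i (Finset.mem_range.1 hi)]
  have h2 : ∑ x ∈ ((Finset.range L).image c)ᶜ, W x ((σ * l.formPerm) x)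
      = ∑ x ∈ ((Finset.range L).image c)ᶜ, W x (σ x) := by
    refine Finset.sum_congr rfl fun x hx => ?_
    have : ∀ i < L, c i ≠ x := by
      simpa using hx
    simp [hτ' x this]
  rw [h1, h2]
  omega

end Shift

/-! ### Finding improving closed walks by dynamic programming. -/

section WalkTable

variable {n : ℕ}

/-- `R l s v a b ≠ 0` records that there is a walk of `l ≤ n` arcs from `s` to `v` with sums `a` of
the weights `p` and `b` of the weights `q`, and `R l s v a b - 1` is then the tail of the last arc
of
such a walk. -/
structure IsWalkTable (n K : ℕ) (p : Fin n → Fin n → ℕ) (q : Fin n → ℕ)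
    (R : ℕ → Fin n → Fin n → ℕ → ℕ → ℕ) : Prop where
  eq_of_zero : ∀ s v a b, a < K → b < K → R 0 s v a b ≠ 0 → v = s ∧ a = 0 ∧ b = 0
  exists_pred : ∀ l < n, ∀ s y a b, a < K → b < K → R (l + 1) s y a b ≠ 0 →
    ∃ x : Fin n, R (l + 1) s y a b = x + 1 ∧ p x y ≤ a ∧ q x ≤ b ∧
      R l s x (a - p x y) (b - q x) ≠ 0
  zero_ne : ∀ s, R 0 s s 0 0 ≠ 0
  succ_ne : ∀ l < n, ∀ s v y a b, R l s v a b ≠ 0 → a + p v y < K → b + q v < K →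
    R (l + 1) s y (a + p v y) (b + q v) ≠ 0

namespace IsWalkTable

variable {K : ℕ} {p : Fin n → Fin n → ℕ} {q : Fin n → ℕ}
  {R : ℕ → Fin n → Fin n → ℕ → ℕ → ℕ}

/-- Completeness of the table. Both sums only grow along the walk, so all intermediate entries lie
in range when the last one does. -/
theorem ne_of_walk (h : IsWalkTable n K p q R) {A : Fin n → Fin n → Prop} {s x y : Fin n}
    {P : ℕ} {S : Multiset (Fin n)} (w : Wk A p x y P S) {l a b : ℕ} (hR : R l s x a b ≠ 0)
    (hl : l + S.card ≤ n) (ha : a + P < K) (hb : b + (S.map q).sum < K) :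
    R (l + S.card) s y (a + P) (b + (S.map q).sum) ≠ 0 := by
  induction w generalizing l a b with
  | nil x => simpa using hR
  | @cons x y z P S _ w ih =>
    simp only [Multiset.card_cons, Multiset.map_cons, Multiset.sum_cons] at hl hb ⊢
    have := ih (h.succ_ne l (by omega) s x y a b hR (by omega) (by omega)) (by omega) (by omega)
      (by omega)
    rwa [show l + 1 + S.card = l + (S.card + 1) by omega, add_assoc, add_assoc] at this

/-- Soundness of the table. The stored tails are followed back from the end; `f` and `g` are the
partial sums at each vertex. -/
theorem exists_trace (h : IsWalkTable n K p q R) {L : ℕ} (hL : L ≤ n) {s y : Fin n} {a b : ℕ}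
    (ha : a < K) (hb : b < K) (hR : R L s y a b ≠ 0) :
    ∃ (c : ℕ → Fin n) (f g : ℕ → ℕ), c L = y ∧ c 0 = s ∧ f L = a ∧ g L = b ∧ f 0 = 0 ∧ g 0 = 0 ∧
      ∀ i < L, R (i + 1) s (c (i + 1)) (f (i + 1)) (g (i + 1)) = c i + 1 ∧
        f (i + 1) = f i + p (c i) (c (i + 1)) ∧ g (i + 1) = g i + q (c i) := by
  induction L generalizing y a b with
  | zero =>
    obtain ⟨rfl, rfl, rfl⟩ := h.eq_of_zero s y a b ha hb hR
    exact ⟨fun _ => y, fun _ => 0, fun _ => 0, rfl, rfl, rfl, rfl, rfl, rfl, by simp⟩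
  | succ L ih =>
    obtain ⟨x, hx, hpa, hqb, hR'⟩ := h.exists_pred L (by omega) s y a b ha hb hR
    obtain ⟨c, f, g, h1, h2, h3, h4, h5, h6, h7⟩ := ih (by omega) (by omega) (by omega) hR'
    refine ⟨Function.update c (L + 1) y, Function.update f (L + 1) a, Function.update g (L + 1) b,
      by simp, by simp [h2], by simp, by simp, by simp [h5], by simp [h6], ?_⟩
    intro i hi
    rcases Nat.lt_or_ge i L with hiL | hiL
    · have e1 : i + 1 ≠ L + 1 := by omega
      have e2 : i ≠ L + 1 := by omega
      simpa [Function.update_of_ne e1, Function.update_of_ne e2] using h7 i hiL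
    · have : i = L := by omega
      subst this
      have e2 : i ≠ i + 1 := by omega
      simp only [Function.update_self, Function.update_of_ne e2, h1, h3, h4]
      refine ⟨hx, by omega, by omega⟩

theorem sum_eq {f : ℕ → ℕ} {r : ℕ → ℕ} {L : ℕ} (h0 : f 0 = 0)
    (h : ∀ i < L, f (i + 1) = f i + r i) : f L = ∑ i ∈ Finset.range L, r i := by
  induction L with
  | zero => simpa using h0
  | succ L ih => rw [h L (by omega), ih (fun i hi => h i (by omega)), Finset.sum_range_succ]

variable {W : Fin n → Fin n → ℕ} {σ : Equiv.Perm (Fin n)} {B w : ℕ}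

/-- The sums along at most `n` arcs of weight at most `w` are below `K`, so any improving walk would
have left an entry. -/
theorem stuck (h : IsWalkTable n K (fun x y => W x (σ y)) (fun x => W x (σ x)) R)
    (hW : ∀ x y, W x y ≤ w) (hK : n * w < K)
    (hR : ∀ l ≤ n, ∀ s, ∀ a < K, ∀ b < K, b < a → a ≤ B → R l s s a b = 0) : Stuck W B σ := by
  intro x P S hw hS hP
  rw [Fintype.card_fin] at hS
  by_contra! hlt
  have hPK : P < K := (hw.weight_le (fun x y => hW x (σ y))).trans_lt
    ((Nat.mul_le_mul_right w hS).trans_lt hK)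
  have := h.ne_of_walk hw (h.zero_ne x) (by simpa using hS) (by omega) (by omega)
  simp only [Nat.zero_add] at this
  exact this (hR _ hS x P hPK _ (by omega) hlt hP)

/-- A shortest improving closed walk found in the table is simple. -/
theorem trace_injective (h : IsWalkTable n K (fun x y => W x (σ y)) (fun x => W x (σ x)) R)
    {L a b : ℕ} (hL : L ≤ n) (ha : a < K) (hab : b < a) (haB : a ≤ B)
    (hmin : ∀ l < L, ∀ s, ∀ a < K, ∀ b < K, b < a → a ≤ B → R l s s a b = 0)
    {c : ℕ → Fin n} (hc : c L = c 0)
    (hfa : a = ∑ i ∈ Finset.range L, W (c i) (σ (c (i + 1))))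
    (hgb : b = ∑ i ∈ Finset.range L, W (c i) (σ (c i))) :
    ∀ i < L, ∀ j < L, c i = c j → i = j := by
  have hw := Wk.of_fun (A := fun _ _ => True) (p := fun x y => W x (σ y)) c (Nat.zero_le L)
    (fun _ _ => trivial)
  rw [hc, ← Finset.range_eq_Ico, ← hfa] at hw
  by_cases hnd : ((Finset.range L).val.map c).Nodup
  · intro i hi j hj
    exact Multiset.inj_on_of_nodup_map hnd i (by simpa using hi) j (by simpa using hj)
  exfalso
  obtain ⟨v, P₁, S₁, P₂, S₂, h₁, h₂, hP, hS, hn₁, hn₂⟩ := hw.exists_cut hnd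
  have c₁ := Multiset.card_pos.2 hn₁
  have c₂ := Multiset.card_pos.2 hn₂
  have hcard := congrArg Multiset.card hS
  have hsum := congrArg (fun S => (Multiset.map (fun x => W x (σ x)) S).sum) hS
  simp only [Multiset.card_add, Multiset.card_map, Finset.card_val, Finset.card_range,
    Multiset.map_add, Multiset.sum_add, Multiset.map_map] at hcard hsum
  have hsum' : (Multiset.map ((fun x => W x (σ x)) ∘ c) (Finset.range L).val).sum = b := hgb.symm
  rw [hsum'] at hsum
  have key : ∀ {v P S}, Wk (fun _ _ => True) (fun x y => W x (σ y)) v v P S → S.card < L →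
      P ≤ a → (S.map fun x => W x (σ x)).sum < P → False := by
    intro v P S hw hS hP hlt
    have := h.ne_of_walk hw (h.zero_ne v) (by omega) (by omega) (by omega)
    simp only [Nat.zero_add] at this
    exact this (hmin _ hS v P (by omega) _ (by omega) hlt (by omega))
  -- The gains of the two closed parts add up to that of the whole, so one part gains. It is shorter
  -- and no heavier, against `hmin`.
  rcases Nat.lt_or_ge (S₁.map fun x => W x (σ x)).sum P₁ with h3 | h3
  · exact key h₁ (by omega) (by omega) h3
  · exact key h₂ (by omega) (by omega) (by omega)

/-- The walk from the table is simple, so rotating along it gives a permutation again and changes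
the weight by exactly its gain. A single new arc weighs at most `a ≤ B`. -/
theorem improves (h : IsWalkTable n K (fun x y => W x (σ y)) (fun x => W x (σ x)) R)
    {L a b : ℕ} (hL : L ≤ n) (ha : a < K) (hab : b < a) (haB : a ≤ B)
    (hmin : ∀ l < L, ∀ s, ∀ a < K, ∀ b < K, b < a → a ≤ B → R l s s a b = 0)
    {c : ℕ → Fin n} (hc : c L = c 0)
    (hfa : a = ∑ i ∈ Finset.range L, W (c i) (σ (c (i + 1))))
    (hgb : b = ∑ i ∈ Finset.range L, W (c i) (σ (c i))) {f : Fin n → Fin n}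
    (hf : ∀ i < L, f (c i) = σ (c (i + 1))) (hf' : ∀ x, (∀ i < L, c i ≠ x) → f x = σ x) :
    ∃ σ' : Equiv.Perm (Fin n), (∀ x, σ' x = f x) ∧ Improves W B σ σ' := by
  have hinj := h.trace_injective hL ha hab haB hmin hc hfa hgb
  obtain ⟨σ', hσ', hw⟩ := exists_rotate σ W c L hinj hc f hf hf'
  rw [← hfa, ← hgb] at hw
  refine ⟨σ', hσ', Or.inr ⟨?_, by omega, by omega, ?_⟩⟩
  · intro hstuck
    have hw := Wk.of_fun (A := fun _ _ => True) (p := fun x y => W x (σ y)) c (Nat.zero_le L)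
      (fun _ _ => trivial)
    rw [hc, ← Finset.range_eq_Ico, ← hfa] at hw
    have := hstuck _ _ _ hw (by simpa using hL) haB
    rw [Multiset.map_map] at this
    have hsum' : (Multiset.map ((fun x => W x (σ x)) ∘ c) (Finset.range L).val).sum = b := hgb.symm
    omega
  · intro x
    by_cases hx : ∃ i < L, c i = x
    · obtain ⟨i, hi, rfl⟩ := hx
      right
      rw [hσ', hf i hi]
      have := Finset.single_le_sum (f := fun i => W (c i) (σ (c (i + 1))))
        (fun _ _ => Nat.zero_le _) (Finset.mem_range.2 hi)
      omega
    · push Not at hx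
      left
      rw [hσ', hf' x hx]

end IsWalkTable

end WalkTable

/-! ### Invariants of loops and nested loops. -/

namespace RamStore

/-- `u` agrees with `s` except on the registers in `Lr` and the arrays in `La`. -/
def Frame (Lr La : List ℕ) (s u : RamStore) : Prop :=
  (∀ b, b ∉ Lr → u.reg b = s.reg b) ∧ ∀ a, a ∉ La → u.arr a = s.arr a

end RamStore

namespace Cmd

open RamStore

theorem eval_frame (c : Cmd) (s : RamStore) : Frame c.wReg c.wArr s (c.eval s) :=
  ⟨fun _ h => eval_reg h s, fun _ h => eval_arr h s⟩

/-- Each round also gets the frame condition, so untouched registers and arrays need not be part of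
the invariant. -/
theorem loop_inv {i r : ℕ} {P : Cmd} {s : RamStore} (I : ℕ → RamStore → Prop) (h0 : I 0 s)
    (hstep : ∀ j < s.reg r, ∀ u, Frame (loop i r P).wReg (loop i r P).wArr s u → I j u →
      I (j + 1) (P.eval (u.setReg i j))) : I (s.reg r) ((loop i r P).eval s) := by
  simp only [eval]
  have : ∀ k ≤ s.reg r, Frame (loop i r P).wReg (loop i r P).wArr s
      (iter (fun j s => P.eval (s.setReg i j)) k s) ∧
      I k (iter (fun j s => P.eval (s.setReg i j)) k s) := by
    intro k
    induction k with
    | zero => exact fun _ => ⟨⟨fun _ _ => rfl, fun _ _ => rfl⟩, h0⟩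
    | succ k ih =>
      intro hk
      obtain ⟨hf, hI⟩ := ih (by omega)
      refine ⟨⟨fun b hb => ?_, fun a ha => ?_⟩, hstep k (by omega) _ hf hI⟩
      · have hb' := hb
        simp only [wReg, List.mem_cons, not_or] at hb
        simp only [iter]
        rw [eval_reg hb.2, setReg_reg, if_neg hb.1, hf.1 b hb']
      · simp only [iter]
        rw [eval_arr (by simpa [wArr] using ha), setReg_arr, hf.2 a ha]
  exact (this _ le_rfl).2

/-- Nested loops. -/
def nest : List (ℕ × ℕ) → Cmd → Cmd
  | [], P => P
  | e :: T, P => loop e.1 e.2 (nest T P)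

/-- The variables of nested loops are different and not written by the body. -/
def nestOk : List (ℕ × ℕ) → Cmd → Bool
  | [], _ => true
  | e :: T, P => !(nest T P).wReg.contains e.1 && nestOk T P

theorem nest_wArr (L : List (ℕ × ℕ)) (P : Cmd) : (nest L P).wArr = P.wArr := by
  induction L with
  | nil => rfl
  | cons e T ih => exact ih

/-- The values `x` of the loop variables are below the bounds. -/
def Below (s : RamStore) : List ℕ → List (ℕ × ℕ) → Prop
  | [], [] => True
  | j :: x, e :: T => j < s.reg e.2 ∧ Below s x T
  | _, _ => False

theorem Below.congr {s u : RamStore} {x : List ℕ} {L : List (ℕ × ℕ)}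
    (h : ∀ e ∈ L, u.reg e.2 = s.reg e.2) (hx : Below s x L) : Below u x L := by
  induction L generalizing x with
  | nil => cases x <;> simp_all [Below]
  | cons e T ih =>
    cases x with
    | nil => simp [Below] at hx
    | cons j x =>
      refine ⟨?_, ih (fun e he => h e (List.mem_cons_of_mem _ he)) hx.2⟩
      rw [h e List.mem_cons_self]
      exact hx.1

/-- An invariant of the body of nested loops holds at the end, and so does every property that the
body establishes for the current values of the loop variables and that it never destroys. -/
theorem nest_spec {P : Cmd} (L : List (ℕ × ℕ)) (s : RamStore) (Inv : RamStore → Prop)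
    (D : List ℕ → RamStore → Prop) (hok : nestOk L P = true)
    (hbd : ∀ e ∈ L, e.2 ∉ (nest L P).wReg)
    (hI : Inv s)
    (hIs : ∀ u, ∀ e ∈ L, ∀ j, Inv u → Inv (u.setReg e.1 j))
    (hDs : ∀ u x, ∀ e ∈ L, ∀ j, D x u → D x (u.setReg e.1 j))
    (hstep : ∀ u, Frame (nest L P).wReg P.wArr s u → (∀ e ∈ L, u.reg e.1 < s.reg e.2) → Inv u →
      Inv (P.eval u) ∧ D (L.map fun e => u.reg e.1) (P.eval u) ∧ ∀ x, D x u → D x (P.eval u)) :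
    Inv ((nest L P).eval s) ∧
      ∀ x, Below s x L → D x ((nest L P).eval s) := by
  induction L generalizing s Inv D with
  | nil =>
    obtain ⟨h1, h2, -⟩ := hstep s ⟨fun _ _ => rfl, fun _ _ => rfl⟩ (by simp) hI
    refine ⟨h1, fun x hx => ?_⟩
    cases x with
    | nil => exact h2
    | cons j x => simp [Below] at hx
  | cons e T ih =>
    obtain ⟨i, r⟩ := e
    simp only [nestOk, Bool.and_eq_true, Bool.not_eq_true', List.contains_eq_mem,
      decide_eq_false_iff_not] at hok
    have hbT : ∀ e ∈ T, e.2 ∉ (nest T P).wReg := fun e he h =>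
      hbd e (List.mem_cons_of_mem _ he) (by simp [nest, wReg, h])
    have hbi : ∀ e ∈ T, e.2 ≠ i := fun e he h =>
      hbd e (List.mem_cons_of_mem _ he) (by simp [nest, wReg, h])
    have inner : ∀ (Inv' : RamStore → Prop) (D' : List ℕ → RamStore → Prop), ∀ j < s.reg r, ∀ u,
        Frame (nest ((i, r) :: T) P).wReg P.wArr s u → Inv' (u.setReg i j) →
        (∀ u, Inv' u → Inv u) →
        (∀ u, ∀ e ∈ T, ∀ j, Inv' u → Inv' (u.setReg e.1 j)) →
        (∀ u x, ∀ e ∈ T, ∀ j, D' x u → D' x (u.setReg e.1 j)) →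
        (∀ u, Frame (nest ((i, r) :: T) P).wReg P.wArr s u → u.reg i = j →
          (∀ e ∈ T, u.reg e.1 < s.reg e.2) → Inv' u →
          Inv' (P.eval u) ∧ D' (T.map fun e => u.reg e.1) (P.eval u) ∧
            ∀ x, D' x u → D' x (P.eval u)) →
        Inv' ((nest T P).eval (u.setReg i j)) ∧ ∀ x, Below s x T →
          D' x ((nest T P).eval (u.setReg i j)) := by
      intro Inv' D' j hj u hf hI' hII hIs' hDs' hstep'
      have hb : ∀ e ∈ T, (u.setReg i j).reg e.2 = s.reg e.2 := by
        intro e he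
        rw [setReg_reg, if_neg (hbi e he), hf.1 _ (hbd e (List.mem_cons_of_mem _ he))]
      obtain ⟨h1, h2⟩ := ih (u.setReg i j) Inv' D' hok.2 hbT hI' hIs' hDs' (by
        intro w hw hlt hIw
        refine hstep' w ⟨fun b hb' => ?_, fun a ha => ?_⟩ ?_ ?_ hIw
        · have hb'' := hb'
          simp only [nest, wReg, List.mem_cons, not_or] at hb'
          rw [hw.1 b hb'.2, setReg_reg, if_neg hb'.1, hf.1 b hb'']
        · rw [hw.2 a ha, setReg_arr, hf.2 a ha]
        · rw [hw.1 i hok.1]; simp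
        · intro e he
          rw [← hb e he]
          exact hlt e he)
      exact ⟨h1, fun x hx => h2 x (hx.congr hb)⟩
    have hmain := loop_inv (i := i) (r := r) (P := nest T P) (s := s)
      (fun k u => Inv u ∧ ∀ j < k, ∀ x, Below s x T → D (j :: x) u) ⟨hI, by simp⟩ (by
        intro j hj u hf hIu
        have hf' : Frame (nest ((i, r) :: T) P).wReg P.wArr s u :=
          ⟨hf.1, fun a ha => hf.2 a (by simpa [wArr, nest_wArr] using ha)⟩
        obtain ⟨h1, h2⟩ := inner Inv (fun x => D (j :: x)) j hj u hf'
          (hIs _ _ List.mem_cons_self _ hIu.1) (fun _ h => h)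
          (fun u e he => hIs u e (List.mem_cons_of_mem _ he))
          (fun u x e he => hDs u (j :: x) e (List.mem_cons_of_mem _ he)) (by
            intro w hw hwi hlt hIw
            obtain ⟨h3, h4, h5⟩ := hstep w hw (by
              intro e he
              rcases List.mem_cons.1 he with rfl | he
              · simpa [hwi] using hj
              · exact hlt e he) hIw
            refine ⟨h3, ?_, fun x => h5 (j :: x)⟩
            simpa [hwi] using h4)
        refine ⟨h1, fun j' hj' x hx => ?_⟩
        rcases Nat.lt_succ_iff_lt_or_eq.1 hj' with h | rfl
        -- For an earlier index `j'`, the property already established joins the invariant of the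
        -- inner loops, which shows that it persists.
        · exact (inner (fun u => Inv u ∧ D (j' :: x) u) (fun _ _ => True) j hj u hf'
            ⟨hIs _ _ List.mem_cons_self _ hIu.1,
              hDs _ _ _ List.mem_cons_self _ (hIu.2 j' h x hx)⟩
            (fun _ h => h.1)
            (fun u e he k h => ⟨hIs u e (List.mem_cons_of_mem _ he) k h.1,
              hDs u _ e (List.mem_cons_of_mem _ he) k h.2⟩)
            (fun _ _ _ _ _ _ => trivial) (by
              intro w hw hwi hlt hIw
              obtain ⟨h3, h4, h5⟩ := hstep w hw (by
                intro e he
                rcases List.mem_cons.1 he with rfl | he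
                · simpa [hwi] using hj
                · exact hlt e he) hIw.1
              exact ⟨⟨h3, h5 _ hIw.2⟩, trivial, fun _ _ => trivial⟩)).1.2
        · exact h2 x hx)
    refine ⟨hmain.1, fun x hx => ?_⟩
    cases x with
    | nil => simp [Below] at hx
    | cons j x => exact hmain.2 j hx.1 x hx.2

end Cmd

/-! ### Memory layout of the walk table. -/

/-- A bound on the sums of weights along closed walks. -/
def sumBound (n : ℕ) : ℕ := n * (2 * n + 1) + 1

/-- The position of a table entry. -/
def cell (n K l s v a b : ℕ) : ℕ :=
  l * (n * (n * (K * K))) + s * (n * (K * K)) + v * (K * K) + a * K + b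

theorem mul_add_inj {m x y x' y' : ℕ} (hy : y < m) (hy' : y' < m) (h : x * m + y = x' * m + y') :
    x = x' ∧ y = y' := by
  have h1 : (x * m + y) / m = x := by
    rw [Nat.mul_comm, Nat.mul_add_div (by omega), Nat.div_eq_of_lt hy, Nat.add_zero]
  have h2 : (x' * m + y') / m = x' := by
    rw [Nat.mul_comm, Nat.mul_add_div (by omega), Nat.div_eq_of_lt hy', Nat.add_zero]
  have h3 : x = x' := by rw [← h1, h, h2]
  subst h3
  exact ⟨rfl, by omega⟩

theorem mul_add_lt {m k x y : ℕ} (hy : y < m) (hx : x < k) : x * m + y < k * m := by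
  have := Nat.mul_le_mul_right m (show x + 1 ≤ k from hx)
  rw [Nat.succ_mul] at this
  omega

/-- In Horner form a position is a number with digits in mixed radix, so positions can be compared
digit by digit. -/
theorem cell_eq (n K l s v a b : ℕ) :
    cell n K l s v a b = (((l * n + s) * n + v) * K + a) * K + b := by
  unfold cell; ring

theorem cell_inj {n K l s v a b l' s' v' a' b' : ℕ} (hs : s < n) (hv : v < n) (ha : a < K)
    (hb : b < K) (hs' : s' < n) (hv' : v' < n) (ha' : a' < K) (hb' : b' < K) :
    cell n K l s v a b = cell n K l' s' v' a' b' ↔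
      l = l' ∧ s = s' ∧ v = v' ∧ a = a' ∧ b = b' := by
  constructor
  · intro h
    rw [cell_eq, cell_eq] at h
    obtain ⟨h₁, e₁⟩ := mul_add_inj hb hb' h
    obtain ⟨h₂, e₂⟩ := mul_add_inj ha ha' h₁
    obtain ⟨h₃, e₃⟩ := mul_add_inj hv hv' h₂
    obtain ⟨e₅, e₄⟩ := mul_add_inj hs hs' h₃
    exact ⟨e₅, e₄, e₃, e₂, e₁⟩
  · rintro ⟨rfl, rfl, rfl, rfl, rfl⟩
    rfl

theorem cell_lt {n K l s v a b : ℕ} (hl : l ≤ n) (hs : s < n) (hv : v < n) (ha : a < K)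
    (hb : b < K) : cell n K l s v a b < (n + 1) * (n * (n * (K * K))) := by
  rw [cell_eq]
  have := mul_add_lt hb (mul_add_lt ha (mul_add_lt hv (mul_add_lt hs (Nat.lt_succ_of_le hl))))
  convert this using 1
  simp only [Nat.succ_eq_add_one]
  ring

/-- The registers with the loop bounds and the index tables have their values. -/
structure Base (n : ℕ) (u : RamStore) : Prop where
  r1 : u.reg 1 = n
  r2 : u.reg 2 = n + 1
  r3 : u.reg 3 = sumBound n
  r4 : u.reg 4 = (n + 1) * (n * (n * (sumBound n * sumBound n)))
  t2 : ∀ x < n + 1, u.arr 2 x = x * n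
  t3 : ∀ x < sumBound n, u.arr 3 x = x * sumBound n
  t4 : ∀ x < n, u.arr 4 x = x * (sumBound n * sumBound n)
  t5 : ∀ x < n, u.arr 5 x = x * (n * (sumBound n * sumBound n))
  t6 : ∀ x < n + 1, u.arr 6 x = x * (n * (n * (sumBound n * sumBound n)))

namespace Base

variable {n : ℕ} {u w : RamStore}

theorem frame (h : Base n u) {Lr La : List ℕ} (hf : RamStore.Frame Lr La u w)
    (h1 : ∀ i ∈ [1, 2, 3, 4], i ∉ Lr) (h2 : ∀ i ∈ [2, 3, 4, 5, 6], i ∉ La) : Base n w := by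
  obtain ⟨a1, a2, a3, a4, b2, b3, b4, b5, b6⟩ := h
  constructor
  · rwa [hf.1 1 (h1 1 (by simp))]
  · rwa [hf.1 2 (h1 2 (by simp))]
  · rwa [hf.1 3 (h1 3 (by simp))]
  · rwa [hf.1 4 (h1 4 (by simp))]
  · rwa [hf.2 2 (h2 2 (by simp))]
  · rwa [hf.2 3 (h2 3 (by simp))]
  · rwa [hf.2 4 (h2 4 (by simp))]
  · rwa [hf.2 5 (h2 5 (by simp))]
  · rwa [hf.2 6 (h2 6 (by simp))]

theorem eval (h : Base n u) {c : Cmd} (h1 : ∀ i ∈ [1, 2, 3, 4], i ∉ c.wReg)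
    (h2 : ∀ i ∈ [2, 3, 4, 5, 6], i ∉ c.wArr) : Base n (c.eval u) :=
  h.frame (c.eval_frame u) h1 h2

theorem setReg (h : Base n u) {i : ℕ} (hi : 4 < i) (j : ℕ) : Base n (u.setReg i j) :=
  h.frame (Lr := [i]) (La := []) ⟨fun b hb => by simp at hb; simp [hb], fun _ _ => rfl⟩
    (by simp; omega) (by simp)

end Base

/-! ### The program

Registers `1`, …, `4` hold the loop bounds: the number `n` of vertices, `n + 1`, `sumBound n` and the
size of the walk table. Register `18` holds the budget of the local search, registers `20` and `21`
an arc, register `22` the threshold, and register `30` the value of the best assignment found so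
far plus one. Array `0` holds the input and array `1` the output. Arrays `2`, …, `6` hold multiples
of the strides of matrices and of the walk table, array `7` the sides of the vertices, array `8` the
weights, array `9` the current assignment, array `10` the next one, array `11` the walk table,
array `12` the minimum numbers of red arcs, array `13` the best assignment, and array `14` the
colours of the arcs. -/

namespace Prog

/-- The entry of a table. -/
def cellE (l s v a b : Exp) : Exp :=
  .add (.add (.add (.add (.get 6 l) (.get 5 s)) (.get 4 v)) (.get 3 a)) b

/-- The entry of an `n × n` matrix. -/
def matE (A : ℕ) (x y : Exp) : Exp := .get A (.add (.get 2 x) y)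

theorem cellE_eval {n : ℕ} {u : RamStore} (h : Base n u) {l s v a b : Exp} (hl : l.eval u ≤ n)
    (hs : s.eval u < n) (hv : v.eval u < n) (ha : a.eval u < sumBound n) :
    (cellE l s v a b).eval u
      = cell n (sumBound n) (l.eval u) (s.eval u) (v.eval u) (a.eval u) (b.eval u) := by
  simp only [cellE, Exp.eval, h.t6 _ (Nat.lt_succ_of_le hl), h.t5 _ hs, h.t4 _ hv, h.t3 _ ha, cell]

theorem matE_eval {n : ℕ} {u : RamStore} (h : Base n u) {A : ℕ} {x y : Exp} (hx : x.eval u < n) :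
    (matE A x y).eval u = u.arr A (x.eval u * n + y.eval u) := by
  simp only [matE, Exp.eval, h.t2 _ (Nat.lt_succ_of_lt hx)]

def clear : Cmd := .loop 24 4 (.put 11 (.var 24) (.num 0))

def start : Cmd :=
  .loop 8 1 (.put 11 (cellE (.num 0) (.var 8) (.var 8) (.num 0) (.num 0)) (.num 1))

/-- Registers 7 to 11 hold the length, start, end and two sums of a walk, register 6 the next
vertex. The tail is stored plus 1 to keep it apart from an empty entry. The two differences test
that the new sums stay in range. -/
def extend : Cmd :=
  .ite (.get 11 (cellE (.var 7) (.var 8) (.var 9) (.var 10) (.var 11)))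
    (.seq (.set 25 (.add (.var 10) (matE 8 (.var 9) (.get 9 (.var 6)))))
    (.seq (.set 26 (.add (.var 11) (matE 8 (.var 9) (.get 9 (.var 9)))))
    (.ite (.sub (.var 3) (.var 25)) (.ite (.sub (.var 3) (.var 26))
      (.put 11 (cellE (.add (.var 7) (.num 1)) (.var 8) (.var 6) (.var 25) (.var 26))
        (.add (.var 9) (.num 1))) .skip) .skip))) .skip

def fillVars : List (ℕ × ℕ) := [(8, 1), (9, 1), (10, 3), (11, 3), (6, 1)]

def fill : Cmd := .loop 7 1 (Cmd.nest fillVars extend)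

/-- Register 12 is both the length of the walk found and the flag that stops further searching. -/
def test : Cmd :=
  .ite (.var 12) .skip (.ite (.get 11 (cellE (.var 7) (.var 8) (.var 8) (.var 10) (.var 11)))
    (.ite (.sub (.var 10) (.var 11)) (.ite (.sub (.var 10) (.var 18)) .skip
      (.seq (.set 12 (.var 7)) (.seq (.set 13 (.var 8)) (.seq (.set 14 (.var 10))
        (.set 15 (.var 11)))))) .skip) .skip)

def searchVars : List (ℕ × ℕ) := [(8, 1), (10, 3), (11, 3)]

/-- The length is the outermost loop variable, so the first hit is a shortest improving walk. -/
def search : Cmd := .seq (.set 12 (.num 0)) (.loop 7 2 (Cmd.nest searchVars test))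

def copy : Cmd := .loop 5 1 (.put 10 (.var 5) (.get 9 (.var 5)))

/-- One arc of the walk, traversed backwards: its tail takes over the image of its head. The new
assignment goes to array 10, since the old one in array 9 is still being read. -/
def back : Cmd :=
  .seq (.set 17 (.sub (.get 11 (cellE (.var 12) (.var 13) (.var 16) (.var 14) (.var 15))) (.num 1)))
  (.seq (.put 10 (.var 17) (.get 9 (.var 16)))
  (.seq (.set 14 (.sub (.var 14) (matE 8 (.var 17) (.get 9 (.var 16)))))
  (.seq (.set 15 (.sub (.var 15) (matE 8 (.var 17) (.get 9 (.var 17)))))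
  (.seq (.set 12 (.sub (.var 12) (.num 1))) (.set 16 (.var 17))))))

def trace : Cmd := .seq (.set 16 (.var 13)) (.loop 24 1 (.ite (.var 12) back .skip))

def copyBack : Cmd := .loop 5 1 (.put 9 (.var 5) (.get 10 (.var 5)))

/-- One step of the local search. -/
def improve : Cmd :=
  .seq clear (.seq start (.seq fill (.seq search (.seq copy (.seq trace copyBack)))))

/-- The entry of the walk table in the store. -/
def tab (n : ℕ) (u : RamStore) (l s v a b : ℕ) : ℕ := u.arr 11 (cell n (sumBound n) l s v a b)

theorem clear_spec (u : RamStore) : ∀ i < u.reg 4, (clear.eval u).arr 11 i = 0 := by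
  refine Cmd.loop_inv (fun k u => ∀ i < k, u.arr 11 i = 0) (by simp) ?_
  intro j _ w _ hw i hi
  simp only [Cmd.eval, Exp.eval, RamStore.setArr_arr, if_true, RamStore.setReg_arr,
    RamStore.setReg_reg, Function.update_apply]
  split_ifs with h
  · rfl
  · exact hw i (by omega)

theorem sumBound_pos (n : ℕ) : 0 < sumBound n := Nat.succ_pos _

theorem start_spec {n : ℕ} {u : RamStore} (h : Base n u) (h0 : ∀ i < u.reg 4, u.arr 11 i = 0) :
    (∀ s < n, tab n (start.eval u) 0 s s 0 0 ≠ 0) ∧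
    ∀ l ≤ n, ∀ s < n, ∀ v < n, ∀ a < sumBound n, ∀ b < sumBound n,
      tab n (start.eval u) l s v a b ≠ 0 → l = 0 ∧ v = s ∧ a = 0 ∧ b = 0 := by
  have hK := sumBound_pos n
  have := Cmd.loop_inv (i := 8) (r := 1)
    (P := .put 11 (cellE (.num 0) (.var 8) (.var 8) (.num 0) (.num 0)) (.num 1)) (s := u)
    (fun k u => (∀ s < k, tab n u 0 s s 0 0 ≠ 0) ∧
    ∀ l ≤ n, ∀ s < n, ∀ v < n, ∀ a < sumBound n, ∀ b < sumBound n,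
      tab n u l s v a b ≠ 0 → l = 0 ∧ v = s ∧ a = 0 ∧ b = 0) ?_ ?_
  · rw [h.r1] at this
    exact this
  · refine ⟨by simp, fun l hl s hs v hv a ha b hb hne => absurd (h0 _ ?_) hne⟩
    rw [h.r4]
    exact cell_lt hl hs hv ha hb
  · rintro j hj w hf ⟨h1, h2⟩
    rw [h.r1] at hj
    have hb : Base n (w.setReg 8 j) := (h.frame hf (by decide) (by decide)).setReg (by omega) j
    have hcell := cellE_eval (l := .num 0) (s := .var 8) (v := .var 8) (a := .num 0) (b := .num 0)
      hb
      (by simp [Exp.eval]) (by simpa [Exp.eval] using hj) (by simpa [Exp.eval] using hj)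
      (by simpa [Exp.eval] using hK)
    simp only [Exp.eval, RamStore.setReg_reg, if_true] at hcell
    have key : ∀ l s v a b, tab n ((Cmd.put 11 (cellE (.num 0) (.var 8) (.var 8) (.num 0) (.num 0))
        (.num 1)).eval (w.setReg 8 j)) l s v a b
        = if cell n (sumBound n) l s v a b = cell n (sumBound n) 0 j j 0 0 then 1
          else tab n w l s v a b := by
      intro l s v a b
      simp only [tab, Cmd.eval, hcell, Exp.eval, RamStore.setArr_arr, if_true, RamStore.setReg_arr,
        Function.update_apply]
    refine ⟨fun s hs => ?_, fun l hl s hs v hv a ha b hb hne => ?_⟩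
    · rw [key]
      split_ifs with hc
      · exact one_ne_zero
      · exact h1 s (by
          have : s ≠ j := fun h => hc (by rw [h])
          omega)
    · rw [key] at hne
      split_ifs at hne with hc
      · rw [cell_inj hs hv ha hb hj hj hK hK] at hc
        exact ⟨hc.1, by omega, hc.2.2.2.1, hc.2.2.2.2⟩
      · exact h2 l hl s hs v hv a ha b hb hne

theorem extend_eval {n : ℕ} {w : RamStore} (h : Base n w) {l s v a b y : ℕ} (h7 : w.reg 7 = l)
    (h8 : w.reg 8 = s) (h9 : w.reg 9 = v) (h10 : w.reg 10 = a) (h11 : w.reg 11 = b)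
    (h6 : w.reg 6 = y) (hl : l < n) (hs : s < n) (hv : v < n) (hy : y < n) (ha : a < sumBound n) :
    (extend.eval w).arr 11
      = if tab n w l s v a b ≠ 0 ∧ a + w.arr 8 (v * n + w.arr 9 y) < sumBound n ∧
          b + w.arr 8 (v * n + w.arr 9 v) < sumBound n then
        Function.update (w.arr 11) (cell n (sumBound n) (l + 1) s y
          (a + w.arr 8 (v * n + w.arr 9 y)) (b + w.arr 8 (v * n + w.arr 9 v))) (v + 1)
        else w.arr 11 := by
  have hc : Exp.eval w (cellE (.var 7) (.var 8) (.var 9) (.var 10) (.var 11))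
      = cell n (sumBound n) l s v a b := by
    rw [cellE_eval h] <;> simp only [Exp.eval, h7, h8, h9, h10, h11] <;> omega
  have hm : Exp.eval w (matE 8 (.var 9) (.get 9 (.var 6))) = w.arr 8 (v * n + w.arr 9 y) := by
    rw [matE_eval h] <;> simp only [Exp.eval, h9, h6]; omega
  set p := w.arr 8 (v * n + w.arr 9 y) with hp
  set q := w.arr 8 (v * n + w.arr 9 v) with hq
  have hb1 : Base n (w.setReg 25 (a + p)) := h.setReg (by omega) _
  have hm' : Exp.eval (w.setReg 25 (a + p)) (matE 8 (.var 9) (.get 9 (.var 9))) = q := by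
    rw [matE_eval hb1] <;> simp [Exp.eval, h9, hq]; omega
  have hb2 : Base n ((w.setReg 25 (a + p)).setReg 26 (b + q)) := hb1.setReg (by omega) _
  by_cases h1 : tab n w l s v a b = 0
  · have h1' : w.arr 11 (cell n (sumBound n) l s v a b) = 0 := h1
    simp [extend, Cmd.eval, Exp.eval, hc, h1, h1']
  have h1' : w.arr 11 (cell n (sumBound n) l s v a b) ≠ 0 := h1
  by_cases h2 : a + p < sumBound n
  swap
  · have h2' : sumBound n - (a + p) = 0 := by omega
    simp [extend, Cmd.eval, Exp.eval, hc, h1', h10, hm, h11, hm', h.r3, h2, h2']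
  have h2' : sumBound n - (a + p) ≠ 0 := by omega
  by_cases h3 : b + q < sumBound n
  swap
  · have h3' : sumBound n - (b + q) = 0 := by omega
    simp [extend, Cmd.eval, Exp.eval, hc, h1', h10, hm, h11, hm', h.r3, h3, h3']
  have h3' : sumBound n - (b + q) ≠ 0 := by omega
  have hc' : Exp.eval ((w.setReg 25 (a + p)).setReg 26 (b + q))
      (cellE (.add (.var 7) (.num 1)) (.var 8) (.var 6) (.var 25) (.var 26))
      = cell n (sumBound n) (l + 1) s y (a + p) (b + q) := by
    rw [cellE_eval hb2] <;> simp [Exp.eval, h7, h8, h6] <;> omega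
  simp [extend, Cmd.eval, Exp.eval, hc, h1', h10, hm, h11, hm', h.r3, h2', h3', hc', h1, h2, h3, h9]

end Prog

/-! ### Correctness of filling and searching the walk table. -/

namespace Prog

open RamStore

/-- The round reads only level `j` and writes only level `j + 1`, so the order of the updates is
irrelevant. A later write to the same entry is as good as the earlier one. -/
theorem fill_step {n : ℕ} {u : RamStore} (h : Base n u) {j : ℕ}
    (hj : j < n) (h7 : u.reg 7 = j)
    (h0 : ∀ s < n, ∀ v < n, ∀ a < sumBound n, ∀ b < sumBound n, tab n u (j + 1) s v a b = 0) :
    ((∀ l ≤ n, l ≠ j + 1 → ∀ s < n, ∀ v < n, ∀ a < sumBound n, ∀ b < sumBound n,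
      tab n ((Cmd.nest fillVars extend).eval u) l s v a b = tab n u l s v a b) ∧
    ∀ s < n, ∀ y < n, ∀ a < sumBound n, ∀ b < sumBound n,
      tab n ((Cmd.nest fillVars extend).eval u) (j + 1) s y a b ≠ 0 → ∃ x < n,
        tab n ((Cmd.nest fillVars extend).eval u) (j + 1) s y a b = x + 1 ∧
        u.arr 8 (x * n + u.arr 9 y) ≤ a ∧ u.arr 8 (x * n + u.arr 9 x) ≤ b ∧
        tab n u j s x (a - u.arr 8 (x * n + u.arr 9 y)) (b - u.arr 8 (x * n + u.arr 9 x)) ≠ 0) ∧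
    ∀ s < n, ∀ v < n, ∀ a < sumBound n, ∀ b < sumBound n, ∀ y < n, tab n u j s v a b ≠ 0 →
      a + u.arr 8 (v * n + u.arr 9 y) < sumBound n → b + u.arr 8 (v * n + u.arr 9 v) < sumBound n →
      tab n ((Cmd.nest fillVars extend).eval u) (j + 1) s y
        (a + u.arr 8 (v * n + u.arr 9 y)) (b + u.arr 8 (v * n + u.arr 9 v)) ≠ 0 := by
  have main := Cmd.nest_spec (P := extend) fillVars u
    (fun w => (∀ l ≤ n, l ≠ j + 1 → ∀ s < n, ∀ v < n, ∀ a < sumBound n, ∀ b < sumBound n,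
        tab n w l s v a b = tab n u l s v a b) ∧
      ∀ s < n, ∀ y < n, ∀ a < sumBound n, ∀ b < sumBound n,
        tab n w (j + 1) s y a b ≠ 0 → ∃ x < n,
        tab n w (j + 1) s y a b = x + 1 ∧
        u.arr 8 (x * n + u.arr 9 y) ≤ a ∧ u.arr 8 (x * n + u.arr 9 x) ≤ b ∧
        tab n u j s x (a - u.arr 8 (x * n + u.arr 9 y)) (b - u.arr 8 (x * n + u.arr 9 x)) ≠ 0)
    (fun x w => ∀ s v a b y, x = [s, v, a, b, y] → s < n → v < n → a < sumBound n → b < sumBound n →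
      y < n → tab n u j s v a b ≠ 0 →
      a + u.arr 8 (v * n + u.arr 9 y) < sumBound n → b + u.arr 8 (v * n + u.arr 9 v) < sumBound n →
      tab n w (j + 1) s y
        (a + u.arr 8 (v * n + u.arr 9 y)) (b + u.arr 8 (v * n + u.arr 9 v)) ≠ 0)
    (by decide) (by decide) ?_ (fun _ _ _ _ h => h) (fun _ _ _ _ _ h => h) ?_
  · refine ⟨main.1, fun s hs v hv a ha b hb y hy => ?_⟩
    exact main.2 [s, v, a, b, y] (by
      simp only [Cmd.Below, fillVars, h.r1, h.r3]
      exact ⟨hs, hv, ha, hb, hy, trivial⟩) s v a b y rfl hs hv ha hb hy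
  · refine ⟨fun _ _ _ _ _ _ _ _ _ _ _ => rfl, fun s hs y hy a ha b hb hne => ?_⟩
    exact absurd (h0 s hs y hy a ha b hb) hne
  · intro w hf hlt ⟨hI1, hI2⟩
    have hb : Base n w := h.frame hf (by decide) (by decide)
    have hlt' := hlt
    simp only [fillVars, List.forall_mem_cons, h.r1, h.r3] at hlt
    obtain ⟨hs, hv, ha, hbb, hy, -⟩ := hlt
    have e7 : w.reg 7 = j := by rw [hf.1 7 (by decide), h7]
    have e8 : w.arr 8 = u.arr 8 := hf.2 8 (by decide)
    have e9 : w.arr 9 = u.arr 9 := hf.2 9 (by decide)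
    have hev := extend_eval hb e7 rfl rfl rfl rfl rfl hj hs hv hy ha
    rw [e8, e9, show tab n w j (w.reg 8) (w.reg 9) (w.reg 10) (w.reg 11)
      = tab n u j (w.reg 8) (w.reg 9) (w.reg 10) (w.reg 11) from
      hI1 j hj.le (by omega) _ hs _ hv _ ha _ hbb] at hev
    set s₀ := w.reg 8
    set v₀ := w.reg 9
    set a₀ := w.reg 10
    set b₀ := w.reg 11
    set y₀ := w.reg 6
    set p₀ := u.arr 8 (v₀ * n + u.arr 9 y₀)
    set q₀ := u.arr 8 (v₀ * n + u.arr 9 v₀)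
    by_cases hc : tab n u j s₀ v₀ a₀ b₀ ≠ 0 ∧ a₀ + p₀ < sumBound n ∧ b₀ + q₀ < sumBound n
    · rw [if_pos hc] at hev
      have key : ∀ l s v a b, s < n → v < n → a < sumBound n → b < sumBound n →
          tab n (extend.eval w) l s v a b
          = if l = j + 1 ∧ s = s₀ ∧ v = y₀ ∧ a = a₀ + p₀ ∧ b = b₀ + q₀ then v₀ + 1
            else tab n w l s v a b := by
        intro l s v a b h1 h2 h3 h4
        simp only [tab, hev, Function.update_apply, cell_inj h1 h2 h3 h4 hs hy hc.2.1 hc.2.2]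
      refine ⟨⟨fun l hl hlj s hs' v hv' a ha' b hb' => ?_, fun s hs' y hy' a ha' b hb' hne => ?_⟩,
        ?_, ?_⟩
      · rw [key l s v a b hs' hv' ha' hb', if_neg (fun h => hlj h.1)]
        exact hI1 l hl hlj s hs' v hv' a ha' b hb'
      · rw [key (j + 1) s y a b hs' hy' ha' hb'] at hne ⊢
        split_ifs at hne ⊢ with hcond
        · obtain ⟨-, rfl, rfl, rfl, rfl⟩ := hcond
          refine ⟨v₀, hv, rfl, Nat.le_add_left _ _, Nat.le_add_left _ _, ?_⟩
          rw [Nat.add_sub_cancel, Nat.add_sub_cancel]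
          exact hc.1
        · exact hI2 s hs' y hy' a ha' b hb' hne
      · rintro s v a b y hx - - - - - - - -
        simp only [fillVars, List.map_cons, List.map_nil, List.cons.injEq, and_true] at hx
        obtain ⟨rfl, rfl, rfl, rfl, rfl⟩ := hx
        rw [key _ _ _ _ _ hs hy hc.2.1 hc.2.2, if_pos ⟨rfl, rfl, rfl, rfl, rfl⟩]
        exact Nat.succ_ne_zero _
      · intro x hD s v a b y hx h1 h2 h3 h4 h5 h6 h7 h8
        rw [key _ _ _ _ _ h1 h5 h7 h8]
        split_ifs
        · exact Nat.succ_ne_zero _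
        · exact hD s v a b y hx h1 h2 h3 h4 h5 h6 h7 h8
    · rw [if_neg hc] at hev
      have key : ∀ l s v a b, tab n (extend.eval w) l s v a b = tab n w l s v a b := by
        intro l s v a b
        simp only [tab, hev]
      refine ⟨?_, ?_, ?_⟩
      · simp only [key]
        exact ⟨hI1, hI2⟩
      · rintro s v a b y hx h1 h2 h3 h4 h5 h6 h7 h8
        simp only [fillVars, List.map_cons, List.map_nil, List.cons.injEq, and_true] at hx
        obtain ⟨rfl, rfl, rfl, rfl, rfl⟩ := hx
        exact absurd ⟨h6, h7, h8⟩ hc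
      · intro x hD
        simpa only [key] using hD

theorem fill_spec {n : ℕ} {u : RamStore} (h : Base n u) {W : Fin n → Fin n → ℕ}
    {σ : Equiv.Perm (Fin n)} (hW : ∀ x y : Fin n, u.arr 8 (x * n + y) = W x y)
    (hσ : ∀ x : Fin n, u.arr 9 x = σ x)
    (h1 : ∀ s < n, tab n u 0 s s 0 0 ≠ 0)
    (h2 : ∀ l ≤ n, ∀ s < n, ∀ v < n, ∀ a < sumBound n, ∀ b < sumBound n,
      tab n u l s v a b ≠ 0 → l = 0 ∧ v = s ∧ a = 0 ∧ b = 0) :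
    IsWalkTable n (sumBound n) (fun x y => W x (σ y)) (fun x => W x (σ x))
      (fun l s v a b => tab n (fill.eval u) l s v a b) := by
  -- After `k` rounds the levels up to `k` are complete and the later ones still empty.
  have main := Cmd.loop_inv (i := 7) (r := 1) (P := Cmd.nest fillVars extend) (s := u)
    (fun k w => (∀ s < n, ∀ v < n, ∀ a < sumBound n, ∀ b < sumBound n,
        tab n w 0 s v a b = tab n u 0 s v a b) ∧
      (∀ l ≤ n, k < l → ∀ s < n, ∀ v < n, ∀ a < sumBound n, ∀ b < sumBound n,
        tab n w l s v a b = 0) ∧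
      (∀ l < k, ∀ s < n, ∀ y < n, ∀ a < sumBound n, ∀ b < sumBound n,
        tab n w (l + 1) s y a b ≠ 0 → ∃ x < n, tab n w (l + 1) s y a b = x + 1 ∧
        u.arr 8 (x * n + u.arr 9 y) ≤ a ∧ u.arr 8 (x * n + u.arr 9 x) ≤ b ∧
        tab n w l s x (a - u.arr 8 (x * n + u.arr 9 y)) (b - u.arr 8 (x * n + u.arr 9 x)) ≠ 0) ∧
      (∀ l < k, ∀ s < n, ∀ v < n, ∀ a < sumBound n, ∀ b < sumBound n, ∀ y < n, tab n w l s v a b ≠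
        0 →
      a + u.arr 8 (v * n + u.arr 9 y) < sumBound n → b + u.arr 8 (v * n + u.arr 9 v) < sumBound n →
      tab n w (l + 1) s y
        (a + u.arr 8 (v * n + u.arr 9 y)) (b + u.arr 8 (v * n + u.arr 9 v)) ≠ 0)) ?_ ?_
  · rw [h.r1] at main
    obtain ⟨m1, m2, m3, m4⟩ := main
    have e : ∀ x y : Fin n, u.arr 8 (x * n + u.arr 9 y) = W x (σ y) := fun x y => by
      rw [hσ]; exact hW x (σ y)
    -- entries with out-of-range sums are never used
    refine ⟨fun s v a b ha hb hne => ?_, fun l hl s y a b ha hb hne => ?_, fun s => ?_,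
      fun l hl s v y a b hne ha hb => ?_⟩
    · have := m1 s s.2 v v.2 a ha b hb
      obtain ⟨-, h3, h4, h5⟩ := h2 0 (Nat.zero_le _) s s.2 v v.2 a ha b hb (by
        rw [← this]; exact hne)
      exact ⟨Fin.ext h3, h4, h5⟩
    · obtain ⟨x, hx, h3, h4, h5, h6⟩ := m3 l hl s s.2 y y.2 a ha b hb hne
      have e1 := e ⟨x, hx⟩ y
      have e2 := e ⟨x, hx⟩ ⟨x, hx⟩
      simp only at e1 e2
      rw [e1] at h4 h6
      rw [e2] at h5 h6
      exact ⟨⟨x, hx⟩, h3, h4, h5, h6⟩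
    · have := m1 s s.2 s s.2 0 (sumBound_pos n) 0 (sumBound_pos n)
      change tab n (fill.eval u) 0 s s 0 0 = _ at this
      rw [this]
      exact h1 s s.2
    · have := m4 l hl s s.2 v v.2 a (by omega) b (by omega) y y.2 hne
      rw [e, e] at this
      exact this ha hb
  · refine ⟨fun _ _ _ _ _ _ _ _ => rfl, ?_, by simp, by simp⟩
    intro l hl hl0 s hs v hv a ha b hb
    by_contra hne
    have := (h2 l hl s hs v hv a ha b hb hne).1
    omega
  · rintro j hj w hf ⟨i1, i2, i3, i4⟩
    rw [h.r1] at hj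
    have hbw : Base n (w.setReg 7 j) := (h.frame hf (by decide) (by decide)).setReg (by omega) j
    have e8 : (w.setReg 7 j).arr 8 = u.arr 8 := hf.2 8 (by decide)
    have e9 : (w.setReg 7 j).arr 9 = u.arr 9 := hf.2 9 (by decide)
    obtain ⟨⟨g1, g2⟩, g3⟩ := fill_step hbw hj (by simp)
      (i2 (j + 1) hj (by omega))
    rw [e8, e9] at g2 g3
    have et : ∀ l s v a b, tab n (w.setReg 7 j) l s v a b = tab n w l s v a b := fun _ _ _ _ _ =>
      rfl
    simp only [et] at g1 g2 g3
    refine ⟨fun s hs v hv a ha b hb => ?_, fun l hl hjl s hs v hv a ha b hb => ?_,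
      fun l hl s hs y hy a ha b hb hne => ?_, fun l hl s hs v hv a ha b hb y hy hne h5 h6 => ?_⟩
    · rw [g1 0 (Nat.zero_le _) (by omega) s hs v hv a ha b hb, i1 s hs v hv a ha b hb]
    · rw [g1 l hl (by omega) s hs v hv a ha b hb, i2 l hl (by omega) s hs v hv a ha b hb]
    · rcases Nat.lt_succ_iff_lt_or_eq.1 hl with hl | rfl
      · rw [g1 (l + 1) (by omega) (by omega) s hs y hy a ha b hb] at hne ⊢
        obtain ⟨x, hx, h3, h4, h5, h6⟩ := i3 l hl s hs y hy a ha b hb hne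
        refine ⟨x, hx, h3, h4, h5, ?_⟩
        rwa [g1 l (by omega) (by omega) s hs x hx _ (by omega) _ (by omega)]
      · obtain ⟨x, hx, h3, h4, h5, h6⟩ := g2 s hs y hy a ha b hb hne
        refine ⟨x, hx, h3, h4, h5, ?_⟩
        rwa [g1 l (by omega) (by omega) s hs x hx _ (by omega) _ (by omega)]
    · rcases Nat.lt_succ_iff_lt_or_eq.1 hl with hl | rfl
      · rw [g1 l (by omega) (by omega) s hs v hv a ha b hb] at hne
        rw [g1 (l + 1) (by omega) (by omega) s hs y hy _ h5 _ h6]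
        exact i4 l hl s hs v hv a ha b hb y hy hne h5 h6
      · rw [g1 l (by omega) (by omega) s hs v hv a ha b hb] at hne
        exact g3 s hs v hv a ha b hb y hy hne h5 h6

/-- The registers describe a gainful closed walk in the table. -/
def Hit (n B : ℕ) (u : RamStore) (l s a b : ℕ) : Prop :=
  tab n u l s s a b ≠ 0 ∧ b < a ∧ a ≤ B

instance (n B : ℕ) (u : RamStore) (l s a b : ℕ) : Decidable (Hit n B u l s a b) :=
  inferInstanceAs (Decidable (_ ∧ _))

theorem test_eval {n : ℕ} {w : RamStore} (h : Base n w) (h7 : w.reg 7 ≤ n) (h8 : w.reg 8 < n)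
    (h10 : w.reg 10 < sumBound n) :
    test.eval w = if w.reg 12 = 0 ∧ Hit n (w.reg 18) w (w.reg 7) (w.reg 8) (w.reg 10) (w.reg 11)
      then
      (((w.setReg 12 (w.reg 7)).setReg 13 (w.reg 8)).setReg 14 (w.reg 10)).setReg 15 (w.reg 11)
      else w := by
  have hc : Exp.eval w (cellE (.var 7) (.var 8) (.var 8) (.var 10) (.var 11))
      = cell n (sumBound n) (w.reg 7) (w.reg 8) (w.reg 8) (w.reg 10) (w.reg 11) := by
    rw [cellE_eval h] <;> simp only [Exp.eval] <;> omega
  by_cases h1 : w.reg 12 = 0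
  swap
  · simp [test, Cmd.eval, Exp.eval, h1]
  by_cases h2 : tab n w (w.reg 7) (w.reg 8) (w.reg 8) (w.reg 10) (w.reg 11) = 0
  · have h2' := h2
    simp only [tab] at h2'
    simp [test, Cmd.eval, Exp.eval, h1, hc, h2', Hit, h2]
  have h2' := h2
  simp only [tab] at h2'
  by_cases h3 : w.reg 11 < w.reg 10
  swap
  · have h3' : w.reg 10 - w.reg 11 = 0 := by omega
    simp [test, Cmd.eval, Exp.eval, h1, hc, h2', h3', Hit, h3]
  have h3' : w.reg 10 - w.reg 11 ≠ 0 := by omega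
  by_cases h4 : w.reg 10 ≤ w.reg 18
  · have h4' : w.reg 10 - w.reg 18 = 0 := by omega
    simp [test, Cmd.eval, Exp.eval, h1, hc, h2', h3', h4', Hit, h3, h4, h2]
  · have h4' : w.reg 10 - w.reg 18 ≠ 0 := by omega
    simp [test, Cmd.eval, Exp.eval, h1, hc, h2', h3', h4', Hit, h4]

theorem search_spec {n : ℕ} {u : RamStore} (h : Base n u)
    (h0 : ∀ s < n, ∀ a < sumBound n, ∀ b < sumBound n, b < a → tab n u 0 s s a b = 0) :
    ((search.eval u).reg 12 = 0 ∧ ∀ l ≤ n, ∀ s < n, ∀ a < sumBound n, ∀ b < sumBound n,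
      ¬ Hit n (u.reg 18) u l s a b) ∨
    (0 < (search.eval u).reg 12 ∧ (search.eval u).reg 12 ≤ n ∧ (search.eval u).reg 13 < n ∧
      (search.eval u).reg 14 < sumBound n ∧ (search.eval u).reg 15 < sumBound n ∧
      Hit n (u.reg 18) u ((search.eval u).reg 12) ((search.eval u).reg 13)
        ((search.eval u).reg 14) ((search.eval u).reg 15) ∧
      ∀ l < (search.eval u).reg 12, ∀ s < n, ∀ a < sumBound n, ∀ b < sumBound n,
      ¬ Hit n (u.reg 18) u l s a b) := by
  set B := u.reg 18 with hB
  -- No walk of length 0 gains, so the value 0 of register 12 unambiguously means that nothing has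
  -- been found.
  have hnohit : ∀ s < n, ∀ a < sumBound n, ∀ b < sumBound n, ¬ Hit n B u 0 s a b :=
    fun s hs a ha b hb hh => hh.1 (h0 s hs a ha b hb hh.2.1)
  set u₁ := u.setReg 12 0 with hu₁
  have hb₁ : Base n u₁ := h.setReg (by omega) 0
  have hhit : ∀ w : RamStore, w.arr 11 = u.arr 11 → ∀ l s a b,
      Hit n B w l s a b ↔ Hit n B u l s a b := by
    intro w hw l s a b
    simp only [Hit, tab, hw]
  set Found : RamStore → Prop := fun w => 0 < w.reg 12 ∧ w.reg 12 ≤ n ∧ w.reg 13 < n ∧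
      w.reg 14 < sumBound n ∧ w.reg 15 < sumBound n ∧
      Hit n B u (w.reg 12) (w.reg 13) (w.reg 14) (w.reg 15) ∧
      ∀ l < w.reg 12, ∀ s < n, ∀ a < sumBound n, ∀ b < sumBound n, ¬ Hit n B u l s a b with hF
  have main := Cmd.loop_inv (i := 7) (r := 2) (P := Cmd.nest searchVars test) (s := u₁)
    (fun k w => (w.reg 12 = 0 ∧ ∀ l < k, ∀ s < n, ∀ a < sumBound n, ∀ b < sumBound n,
      ¬ Hit n B u l s a b) ∨ Found w) (Or.inl ⟨by simp [hu₁], by simp⟩) ?_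
  · rw [hb₁.r2] at main
    rcases main with ⟨h1, h2⟩ | h1
    · exact Or.inl ⟨h1, fun l hl => h2 l (by omega)⟩
    · exact Or.inr h1
  intro j hj w hf hI
  rw [hb₁.r2] at hj
  have hbw : Base n (w.setReg 7 j) := (hb₁.frame hf (by decide) (by decide)).setReg (by omega) j
  have e11 : (w.setReg 7 j).arr 11 = u.arr 11 := hf.2 11 (by decide)
  have e18 : (w.setReg 7 j).reg 18 = B := by
    simp [hf.1 18 (by decide), hu₁, hB]
  have inner := Cmd.nest_spec (P := test) searchVars (w.setReg 7 j)
    (fun w => (w.reg 12 = 0 ∧ ∀ l < j, ∀ s < n, ∀ a < sumBound n, ∀ b < sumBound n,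
      ¬ Hit n B u l s a b) ∨ Found w)
    (fun x w => (∀ s a b, x = [s, a, b] → Hit n B u j s a b → w.reg 12 ≠ 0))
    (by decide) (by decide) (by simpa [hF] using hI)
    (by
      intro u e he k h
      have h12 : e.1 ≠ 12 ∧ e.1 ≠ 13 ∧ e.1 ≠ 14 ∧ e.1 ≠ 15 := by
        revert he e; decide
      simpa [hF, h12.1.symm, h12.2.1.symm, h12.2.2.1.symm, h12.2.2.2.symm] using h)
    (by
      intro u x e he k h
      have h12 : e.1 ≠ 12 := by
        revert he e; decide
      simpa [h12.symm] using h) ?_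
  · rcases inner.1 with ⟨h1, h2⟩ | h1
    · refine Or.inl ⟨h1, fun l hl s hs a ha b hb => ?_⟩
      rcases Nat.lt_succ_iff_lt_or_eq.1 hl with hl | rfl
      · exact h2 l hl s hs a ha b hb
      · intro hh
        exact inner.2 [s, a, b] (by
          simp only [Cmd.Below, searchVars, hbw.r1, hbw.r3]
          exact ⟨hs, ha, hb, trivial⟩) s a b rfl hh h1
    · exact Or.inr h1
  · intro v hfv hlt hIv
    have hbv : Base n v := hbw.frame hfv (by decide) (by decide)
    simp only [searchVars, List.forall_mem_cons, hbw.r1, hbw.r3] at hlt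
    obtain ⟨hs, ha, hbb, -⟩ := hlt
    have e7 : v.reg 7 = j := by rw [hfv.1 7 (by decide)]; simp
    have e18' : v.reg 18 = B := by rw [hfv.1 18 (by decide), e18]
    have e11' : v.arr 11 = u.arr 11 := by rw [hfv.2 11 (by decide), e11]
    have hev := test_eval hbv (by omega) hs ha
    simp only [e18', hhit v e11', e7] at hev
    by_cases hc : v.reg 12 = 0 ∧ Hit n B u j (v.reg 8) (v.reg 10) (v.reg 11)
    · rw [if_pos hc] at hev
      have hj0 : 0 < j := by
        rcases Nat.eq_zero_or_pos j with rfl | h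
        · exact absurd hc.2 (hnohit _ hs _ ha _ hbb)
        · exact h
      rw [hev]
      refine ⟨Or.inr ?_, ?_, ?_⟩
      · rcases hIv with ⟨-, h2⟩ | h1
        · simp only [hF, setReg_reg]
          simp only [if_true, Nat.reduceEqDiff, if_false]
          exact ⟨hj0, by omega, hs, ha, hbb, hc.2, h2⟩
        · have := h1.1; omega
      · intros; simp; omega
      · intros; simp; omega
    · rw [if_neg hc] at hev
      rw [hev]
      refine ⟨hIv, ?_, fun _ h => h⟩
      intro s a b hx hh h12
      simp only [searchVars, List.map_cons, List.map_nil, List.cons.injEq, and_true] at hx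
      obtain ⟨rfl, rfl, rfl⟩ := hx
      exact hc ⟨h12, hh⟩

end Prog

/-! ### Reading off the walk, and one complete step of the search. -/

namespace Prog

open RamStore

theorem copy_spec {u : RamStore} : ∀ x < u.reg 1, (copy.eval u).arr 10 x = u.arr 9 x := by
  refine Cmd.loop_inv (fun k w => ∀ x < k, w.arr 10 x = u.arr 9 x) (by simp) ?_
  intro j hj w hf hI x hx
  have e9 : w.arr 9 = u.arr 9 := hf.2 9 (by decide)
  simp only [Cmd.eval, Exp.eval, setArr_arr, if_true, setReg_arr, setReg_reg, Function.update_apply,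
    e9]
  split_ifs with h
  · rw [h]
  · exact hI x (by omega)

theorem copyBack_spec {u : RamStore} : ∀ x < u.reg 1, (copyBack.eval u).arr 9 x = u.arr 10 x := by
  refine Cmd.loop_inv (fun k w => ∀ x < k, w.arr 9 x = u.arr 10 x) (by simp) ?_
  intro j hj w hf hI x hx
  have e9 : w.arr 10 = u.arr 10 := hf.2 10 (by decide)
  simp only [Cmd.eval, Exp.eval, setArr_arr, if_true, setReg_arr, setReg_reg, Function.update_apply,
    e9]
  split_ifs with h
  · rw [h]
  · exact hI x (by omega)

theorem back_eval {n : ℕ} {w : RamStore} (h : Base n w) {i s a b x y : ℕ} (h12 : w.reg 12 = i + 1)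
    (h13 : w.reg 13 = s) (h16 : w.reg 16 = y) (h14 : w.reg 14 = a) (h15 : w.reg 15 = b)
    (hi : i < n) (hs : s < n) (hy : y < n) (ha : a < sumBound n) (hx : x < n)
    (ht : tab n w (i + 1) s y a b = x + 1) :
    (back.eval w).reg 12 = i ∧ (back.eval w).reg 16 = x ∧
      (back.eval w).reg 14 = a - w.arr 8 (x * n + w.arr 9 y) ∧
      (back.eval w).reg 15 = b - w.arr 8 (x * n + w.arr 9 x) ∧
      (back.eval w).arr 10 = Function.update (w.arr 10) x (w.arr 9 y) := by
  have hc : Exp.eval w (cellE (.var 12) (.var 13) (.var 16) (.var 14) (.var 15))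
      = cell n (sumBound n) (i + 1) s y a b := by
    rw [cellE_eval h] <;> simp only [Exp.eval, h12, h13, h14, h15, h16] <;> omega
  simp only [tab] at ht
  have hb1 : Base n ((w.setReg 17 x).setArr 10 x (w.arr 9 y)) :=
    (h.setReg (i := 17) (by omega) x).frame (Lr := []) (La := [10])
      ⟨fun _ _ => rfl, fun a ha => by simp at ha; simp [ha]⟩ (by decide) (by decide)
  have hm : Exp.eval ((w.setReg 17 x).setArr 10 x (w.arr 9 y)) (matE 8 (.var 17) (.get 9 (.var 16)))
      = w.arr 8 (x * n + w.arr 9 y) := by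
    rw [matE_eval hb1] <;> simp [Exp.eval, h16]; omega
  have hb2 := hb1.setReg (i := 14) (by omega) (a - w.arr 8 (x * n + w.arr 9 y))
  have hm' : Exp.eval (((w.setReg 17 x).setArr 10 x (w.arr 9 y)).setReg 14
      (a - w.arr 8 (x * n + w.arr 9 y))) (matE 8 (.var 17) (.get 9 (.var 17)))
      = w.arr 8 (x * n + w.arr 9 x) := by
    rw [matE_eval hb2] <;> simp [Exp.eval]; omega
  simp [back, Cmd.eval, Exp.eval, hc, ht, h16, hm, h14, hm', h15, h12]

/-- As the vertices of the walk are distinct, no entry is overwritten by a later one. This is where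
`hinj` enters. -/
theorem trace_spec {n : ℕ} {u : RamStore} (h : Base n u) {W : Fin n → Fin n → ℕ}
    {σ : Equiv.Perm (Fin n)} (hW : ∀ x y : Fin n, u.arr 8 (x * n + y) = W x y)
    (hσ : ∀ x : Fin n, u.arr 9 x = σ x) (hν : ∀ x : Fin n, u.arr 10 x = σ x) {L : ℕ}
    (hL : L ≤ n) (hL' : u.reg 12 = L) {c : ℕ → Fin n} {f g : ℕ → ℕ} (hs : u.reg 13 = c 0)
    (hcL : c L = c 0) (hf : u.reg 14 = f L) (hg : u.reg 15 = g L) (hfK : f L < sumBound n)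
    (hstep : ∀ i < L, tab n u (i + 1) (c 0) (c (i + 1)) (f (i + 1)) (g (i + 1)) = c i + 1 ∧
      f (i + 1) = f i + W (c i) (σ (c (i + 1))) ∧ g (i + 1) = g i + W (c i) (σ (c i)))
    (hinj : ∀ i < L, ∀ j < L, c i = c j → i = j) :
    (∀ i < L, (trace.eval u).arr 10 (c i) = σ (c (i + 1))) ∧
      ∀ x : Fin n, (∀ i < L, c i ≠ x) → (trace.eval u).arr 10 x = σ x := by
  have e : ∀ x y : Fin n, u.arr 8 (x * n + u.arr 9 y) = W x (σ y) := fun x y => by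
    rw [hσ]; exact hW x (σ y)
  set u₁ := u.setReg 16 (c 0) with hu₁
  have hb₁ : Base n u₁ := h.setReg (by omega) _
  have htr : trace.eval u = (Cmd.loop 24 1 (.ite (.var 12) back .skip)).eval u₁ := by
    simp only [trace, Cmd.eval, Exp.eval, hs, hu₁]
  -- After `k` rounds the trace is at position `L - k`. The subtraction is truncated, in accordance
  -- with the rounds being idle once the start is reached.
  have main := Cmd.loop_inv (i := 24) (r := 1) (P := .ite (.var 12) back .skip) (s := u₁)
    (fun k w => w.reg 12 = L - k ∧ w.reg 16 = c (L - k) ∧ w.reg 14 = f (L - k) ∧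
      w.reg 15 = g (L - k) ∧ f (L - k) < sumBound n ∧
      (∀ i < L, L - k ≤ i → w.arr 10 (c i) = σ (c (i + 1))) ∧
      ∀ x : Fin n, (∀ i < L, L - k ≤ i → c i ≠ x) → w.arr 10 x = σ x) ?_ ?_
  · rw [hb₁.r1, ← htr] at main
    obtain ⟨-, -, -, -, -, m1, m2⟩ := main
    exact ⟨fun i hi => m1 i hi (by omega), fun x hx => m2 x fun i hi _ => hx i hi⟩
  · simp only [Nat.sub_zero, hu₁, setReg_reg, setReg_arr]
    refine ⟨by simpa using hL', by simp [hcL], by simpa using hf, by simpa using hg, hfK, ?_, ?_⟩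
    · intro i h1 h2; omega
    · intro x _; exact hν x
  · rintro j hj w hfr ⟨i1, i2, i3, i4, i5, i6, i7⟩
    rw [hb₁.r1] at hj
    rcases Nat.eq_zero_or_pos (L - j) with h0 | h0
    · have h0' : L - (j + 1) = L - j := by omega
      have hev : (Cmd.ite (.var 12) back .skip).eval (w.setReg 24 j) = w.setReg 24 j := by
        simp [Cmd.eval, Exp.eval, i1, h0]
      rw [hev, h0']
      simp only [setReg_reg, setReg_arr, Nat.reduceEqDiff, if_false]
      exact ⟨i1, i2, i3, i4, i5, i6, i7⟩
    · obtain ⟨i, hi⟩ : ∃ i, L - j = i + 1 := ⟨L - j - 1, by omega⟩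
      have hi' : L - (j + 1) = i := by omega
      rw [hi] at i1 i2 i3 i4 i5 i6 i7
      have hbw : Base n (w.setReg 24 j) := (hb₁.frame hfr (by decide) (by decide)).setReg (by
        omega) j
      have hev : (Cmd.ite (.var 12) back .skip).eval (w.setReg 24 j)
          = back.eval (w.setReg 24 j) := by
        simp [Cmd.eval, Exp.eval, i1]
      obtain ⟨t1, t2, t3⟩ := hstep i (by omega)
      have e8 : w.arr 8 = u.arr 8 := hfr.2 8 (by decide)
      have e9 : w.arr 9 = u.arr 9 := hfr.2 9 (by decide)
      have e11 : w.arr 11 = u.arr 11 := hfr.2 11 (by decide)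
      have e13 : w.reg 13 = c 0 := by rw [hfr.1 13 (by decide)]; simp [hu₁, hs]
      obtain ⟨b1, b2, b3, b4, b5⟩ := back_eval (w := w.setReg 24 j) hbw (i := i) (s := c 0)
        (a := f (i + 1)) (b := g (i + 1)) (x := c i) (y := c (i + 1)) (by simpa using i1)
        (by simpa using e13) (by simpa using i2) (by simpa using i3) (by simpa using i4) (by omega)
        (c 0).2 (c (i + 1)).2 i5 (c i).2 (by simp only [tab, setReg_arr, e11]; exact t1)
      simp only [setReg_arr, e8, e9, e] at b3 b4 b5
      rw [hσ] at b5
      rw [hev, hi']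
      refine ⟨b1, b2, by omega, by omega, by omega, fun k hk hik => ?_, fun x hx => ?_⟩
      · rw [b5, Function.update_apply]
        split_ifs with hkc
        · have := hinj k hk i (by omega) (Fin.ext hkc)
          rw [this]
        · refine i6 k hk ?_
          have : k ≠ i := fun h => hkc (by rw [h])
          omega
      · rw [b5, Function.update_apply, if_neg (fun h => hx i (by omega) le_rfl (Fin.ext h.symm))]
        exact i7 x fun k hk hik => hx k hk (by omega)

/-- All weights are at most 2n + 1, so `sumBound` exceeds every sum along at most n arcs and the
table misses nothing. An empty search therefore certifies that `σ` is stuck. -/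
theorem improve_spec {n : ℕ} {u : RamStore} (h : Base n u) {W : Fin n → Fin n → ℕ}
    {σ : Equiv.Perm (Fin n)} (hW : ∀ x y : Fin n, u.arr 8 (x * n + y) = W x y)
    (hσ : ∀ x : Fin n, u.arr 9 x = σ x) (hw : ∀ x y, W x y ≤ 2 * n + 1) :
    ∃ σ', Improves W (u.reg 18) σ σ' ∧ ∀ x : Fin n, (improve.eval u).arr 9 x = σ' x := by
  have hK : n * (2 * n + 1) < sumBound n := Nat.lt_succ_self _
  set u₁ := clear.eval u with hu₁
  set u₂ := start.eval u₁ with hu₂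
  set u₃ := fill.eval u₂ with hu₃
  set u₄ := search.eval u₃ with hu₄
  set u₅ := copy.eval u₄ with hu₅
  set u₆ := trace.eval u₅ with hu₆
  have hb₁ : Base n u₁ := h.eval (by decide) (by decide)
  have hb₂ : Base n u₂ := hb₁.eval (by decide) (by decide)
  have hb₃ : Base n u₃ := hb₂.eval (by decide) (by decide)
  have hb₄ : Base n u₄ := hb₃.eval (by decide) (by decide)
  have hb₅ : Base n u₅ := hb₄.eval (by decide) (by decide)
  have hb₆ : Base n u₆ := hb₅.eval (by decide) (by decide)
  have c1 : ∀ i < u₁.reg 4, u₁.arr 11 i = 0 := by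
    rw [hb₁.r4, ← h.r4]; exact clear_spec u
  obtain ⟨s1, s2⟩ := start_spec hb₁ c1
  have hfr : Frame (Cmd.seq clear (.seq start (.seq fill search))).wReg
      (Cmd.seq clear (.seq start (.seq fill search))).wArr u u₄ :=
    Cmd.eval_frame (Cmd.seq clear (.seq start (.seq fill search))) u
  have e8 : u₂.arr 8 = u.arr 8 := by
    rw [hu₂, Cmd.eval_arr (by decide), hu₁, Cmd.eval_arr (by decide)]
  have e9 : u₂.arr 9 = u.arr 9 := by
    rw [hu₂, Cmd.eval_arr (by decide), hu₁, Cmd.eval_arr (by decide)]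
  have T := fill_spec hb₂ (W := W) (σ := σ) (by rwa [e8]) (by rwa [e9]) s1 s2
  change IsWalkTable n _ _ _ (fun l s v a b => tab n u₃ l s v a b) at T
  have e18 : u₃.reg 18 = u.reg 18 := by
    rw [hu₃, Cmd.eval_reg (by decide), hu₂, Cmd.eval_reg (by decide), hu₁,
      Cmd.eval_reg (by decide)]
  have h0 : ∀ s < n, ∀ a < sumBound n, ∀ b < sumBound n, b < a → tab n u₃ 0 s s a b = 0 := by
    intro s hs a ha b hb hba
    by_contra hne
    have := (T.eq_of_zero ⟨s, hs⟩ ⟨s, hs⟩ a b ha hb hne).2.1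
    omega
  have hS := search_spec hb₃ h0
  rw [e18] at hS
  have hcopy : ∀ x : Fin n, u₅.arr 10 x = σ x := by
    intro x
    have := copy_spec (u := u₄) x (by rw [hb₄.r1]; exact x.2)
    rw [hu₅, this, hfr.2 9 (by decide), hσ]
  have hfr5 : ∀ a, a ∉ copy.wArr ++ search.wArr → u₅.arr a = u₃.arr a := by
    intro a ha
    simp only [List.mem_append, not_or] at ha
    rw [hu₅, Cmd.eval_arr ha.1, hu₄, Cmd.eval_arr ha.2]
  have e8' : u₅.arr 8 = u.arr 8 := by
    rw [hfr5 8 (by decide), hu₃, Cmd.eval_arr (by decide), e8]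
  have e9' : u₅.arr 9 = u.arr 9 := by
    rw [hfr5 9 (by decide), hu₃, Cmd.eval_arr (by decide), e9]
  have e11 : u₅.arr 11 = u₃.arr 11 := hfr5 11 (by decide)
  have er : ∀ r ∈ [12, 13, 14, 15], u₅.reg r = u₄.reg r := by
    intro r hr
    rw [hu₅, Cmd.eval_reg (by revert hr r; decide)]
  have hfin : ∀ x : Fin n, (improve.eval u).arr 9 x = u₆.arr 10 x := fun x =>
    copyBack_spec (u := u₆) x (by rw [hb₆.r1]; exact x.2)
  rcases hS with ⟨z1, z2⟩ | ⟨z1, z2, z3, z4, z5, z6, z7⟩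
  · change u₄.reg 12 = 0 at z1
    refine ⟨σ, Or.inl ⟨T.stuck hw hK ?_, rfl⟩, fun x => ?_⟩
    · intro l hl s a ha b hb hba haB
      by_contra hne
      exact z2 l hl s s.2 a ha b hb ⟨hne, hba, haB⟩
    · rw [hfin]
      -- With register 12 zero, the trace does nothing and the copy of `σ` is returned.
      have := Cmd.loop_inv (i := 24) (r := 1) (P := .ite (.var 12) back .skip)
        (s := u₅.setReg 16 (u₅.reg 13)) (fun k w => w.reg 12 = 0 ∧ w.arr 10 = u₅.arr 10)
        ⟨by simp [er 12 (by simp), z1], rfl⟩ (by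
          rintro j hj w hfr ⟨i1, i2⟩
          simp [Cmd.eval, Exp.eval, i1, i2])
      rw [← hcopy x, ← this.2]
      rfl
  · change 0 < u₄.reg 12 at z1
    change u₄.reg 12 ≤ n at z2
    change u₄.reg 13 < n at z3
    change u₄.reg 14 < _ at z4
    change u₄.reg 15 < _ at z5
    change Hit n _ _ (u₄.reg 12) (u₄.reg 13) (u₄.reg 14) (u₄.reg 15) at z6
    obtain ⟨y1, y2, y3⟩ := z6
    obtain ⟨c, f, g, t1, t2, t3, t4, t5, t6, t7⟩ := T.exists_trace z2 (s := ⟨_, z3⟩)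
      (y := ⟨_, z3⟩) z4 z5 y1
    have hc0 : (c 0 : ℕ) = u₄.reg 13 := by rw [t2]
    have hsf := IsWalkTable.sum_eq (r := fun i => W (c i) (σ (c (i + 1)))) t5
      (fun i hi => (t7 i hi).2.1)
    have hsg := IsWalkTable.sum_eq (r := fun i => W (c i) (σ (c i))) t6
      (fun i hi => (t7 i hi).2.2)
    rw [t3] at hsf
    rw [t4] at hsg
    have hmin : ∀ l < u₄.reg 12, ∀ s : Fin n, ∀ a < sumBound n, ∀ b < sumBound n, b < a →
        a ≤ u.reg 18 → tab n u₃ l s s a b = 0 := by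
      intro l hl s a ha b hb hba haB
      by_contra hne
      exact z7 l hl s s.2 a ha b hb ⟨hne, hba, haB⟩
    have hinj := T.trace_injective z2 z4 y2 y3 hmin (t1.trans t2.symm) hsf hsg
    obtain ⟨r1, r2⟩ := trace_spec hb₅ (W := W) (σ := σ) (by rwa [e8']) (by rwa [e9']) hcopy z2
      (er 12 (by simp)) (c := c) (f := f) (g := g) (by rw [er 13 (by simp), hc0])
      (t1.trans t2.symm) (by rw [er 14 (by simp), t3]) (by rw [er 15 (by simp), t4])
      (by rw [t3]; exact z4) (by
        intro i hi
        simp only [tab, e11]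
        rw [t2]
        exact t7 i hi) hinj
    have hlt : ∀ x : Fin n, u₆.arr 10 x < n := by
      intro x
      by_cases hx : ∃ i < u₄.reg 12, c i = x
      · obtain ⟨i, hi, rfl⟩ := hx
        rw [hu₆, r1 i hi]
        exact (σ _).2
      · push Not at hx
        rw [hu₆, r2 x hx]
        exact (σ _).2
    obtain ⟨σ', hσ', himp⟩ := T.improves z2 z4 y2 y3 hmin (t1.trans t2.symm) hsf hsg
      (f := fun x => ⟨u₆.arr 10 x, hlt x⟩) (fun i hi => Fin.ext (r1 i hi))
      (fun x hx => Fin.ext (r2 x hx))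
    refine ⟨σ', himp, fun x => ?_⟩
    rw [hfin, hσ']

end Prog

/-! ### Recording the best feasible assignment. -/

namespace Prog

open RamStore

/-- Entry `(x, y)` of a matrix that starts at cell `off` of array `A` becomes the value that `c`
leaves in register `31`. -/
def fillMat (off A : ℕ) (c : Cmd) : Cmd :=
  Cmd.nest [(5, 1), (6, 1)]
    (.seq c (.put A (.add (.num off) (.add (.get 2 (.var 5)) (.var 6))) (.var 31)))

theorem fillMat_spec {n : ℕ} {u : RamStore} (h : Base n u) {off A : ℕ} {c : Cmd} {F : ℕ → ℕ → ℕ}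
    (hr : ∀ r ∈ c.wReg, r ∈ [29, 31]) (ha : c.wArr = []) (hA : ∀ i ∈ [2, 3, 4, 5, 6], i ∉ [A])
    (hc : ∀ v, Frame [5, 6, 29, 31] [A] u v → v.reg 5 < n → v.reg 6 < n →
      (c.eval v).reg 31 = F (v.reg 5) (v.reg 6)) :
    ∀ x < n, ∀ y < n, ((fillMat off A c).eval u).arr A (off + (x * n + y)) = F x y := by
  have hr5 : ∀ r ∉ [29, 31], r ∉ c.wReg := fun r hr' h => hr' (hr r h)
  have main := Cmd.nest_spec
    (P := .seq c (.put A (.add (.num off) (.add (.get 2 (.var 5)) (.var 6))) (.var 31)))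
    [(5, 1), (6, 1)] u (fun _ => True)
    (fun x w => ∀ a b, x = [a, b] → a < n → b < n → w.arr A (off + (a * n + b)) = F a b)
    (by simp [Cmd.nestOk, Cmd.nest, Cmd.wReg, hr5 5 (by decide), hr5 6 (by decide)])
    (by simp [Cmd.nest, Cmd.wReg, hr5 1 (by decide)]) trivial (fun _ _ _ _ _ => trivial)
    (fun _ _ _ _ _ h => h) ?_
  · intro x hx y hy
    refine main.2 [x, y] ?_ x y rfl hx hy
    simp only [Cmd.Below, h.r1]
    exact ⟨hx, hy, trivial⟩
  · intro v hfv hlt _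
    simp only [List.forall_mem_cons, h.r1] at hlt
    obtain ⟨h5, h6, -⟩ := hlt
    have hfv' : Frame [5, 6, 29, 31] [A] u v := by
      refine ⟨fun b hb => hfv.1 b ?_, fun a ha' => hfv.2 a (by simpa [Cmd.wArr, ha] using ha')⟩
      simp only [List.mem_cons, not_or] at hb
      simp only [Cmd.nest, Cmd.wReg, List.mem_cons, List.append_nil, not_or]
      exact ⟨hb.1, hb.2.1, hr5 b (by simp only [List.mem_cons, not_or]; exact hb.2.2)⟩
    have hbv : Base n v := h.frame hfv' (by decide) hA
    have e2 : (c.eval v).arr 2 (v.reg 5) = v.reg 5 * n := by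
      rw [Cmd.eval_arr (by simp [ha])]
      exact hbv.t2 _ (by omega)
    have e5 : (c.eval v).reg 5 = v.reg 5 := Cmd.eval_reg (hr5 5 (by decide)) v
    have e6 : (c.eval v).reg 6 = v.reg 6 := Cmd.eval_reg (hr5 6 (by decide)) v
    have eA : (c.eval v).arr A = v.arr A := Cmd.eval_arr (by simp [ha]) v
    simp only [Cmd.eval, Exp.eval, setArr_arr, if_true, e5, e6, e2, hc v hfv' h5 h6, eA,
      Function.update_apply]
    refine ⟨trivial, fun a b hab _ _ => ?_, fun x hx a b hab ha' hb => ?_⟩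
    · simp only [List.map_cons, List.map_nil, List.cons.injEq, and_true] at hab
      obtain ⟨rfl, rfl⟩ := hab
      simp
    · split_ifs with heq
      · obtain ⟨rfl, rfl⟩ := mul_add_inj hb h6 (Nat.add_left_cancel heq)
        rfl
      · exact hx a b hab ha' hb

/-- Register 27 counts the red arcs; register 28 is reset to 0 when an arc is missing. -/
def tally : Cmd :=
  .seq (.set 29 (matE 14 (.var 5) (.get 9 (.var 5))))
    (.ite (.var 29) (.ite (.sub (.var 29) (.num 1)) (.set 27 (.add (.var 27) (.num 1))) .skip)
      (.set 28 (.num 0)))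

/-- Cells 1 and 2 of the input are the sign and the absolute value of `k`. Register 30 holds the
value plus 1, so that 0 means that nothing has been stored. -/
def keep : Cmd :=
  .ite (.var 28) (.ite (.get 0 (.num 1)) .skip (.ite (.sub (.var 27) (.get 0 (.num 2))) .skip
    (.ite (.sub (.add (.var 27) (.num 1)) (.var 30)) (.seq (.set 30 (.add (.var 27) (.num 1)))
      (.loop 5 1 (.put 13 (.var 5) (.get 9 (.var 5))))) .skip))) .skip

/-- Count the red arcs of the current assignment, and store it if it is the best one so far. -/
def record : Cmd :=
  .seq (.seq (.set 27 (.num 0)) (.seq (.set 28 (.num 1)) (.loop 5 1 tally))) keep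

/-- The store holds the colours `col`. -/
structure Inst {n : ℕ} (col : Fin n → Fin n → ℕ) (u : RamStore) : Prop where
  base : Base n u
  col : ∀ x y : Fin n, u.arr 14 (x * n + y) = col x y

theorem Inst.frame {n : ℕ} {col : Fin n → Fin n → ℕ} {u w : RamStore} (h : Inst col u)
    {Lr La : List ℕ} (hf : Frame Lr La u w) (h1 : ∀ i ∈ [1, 2, 3, 4], i ∉ Lr)
    (h2 : ∀ i ∈ [2, 3, 4, 5, 6, 14], i ∉ La) : Inst col w := by
  refine ⟨h.base.frame hf h1 fun i hi => h2 i ?_, fun x y => ?_⟩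
  · simp only [List.mem_cons] at hi ⊢; tauto
  · rw [hf.2 14 (h2 14 (by simp))]; exact h.col x y

theorem Inst.eval {n : ℕ} {col : Fin n → Fin n → ℕ} {u : RamStore} (h : Inst col u) {c : Cmd}
    (h1 : ∀ i ∈ [1, 2, 3, 4], i ∉ c.wReg) (h2 : ∀ i ∈ [2, 3, 4, 5, 6, 14], i ∉ c.wArr) :
    Inst col (c.eval u) :=
  h.frame (c.eval_frame u) h1 h2

theorem Inst.setReg {n : ℕ} {col : Fin n → Fin n → ℕ} {u : RamStore} (h : Inst col u) {i : ℕ}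
    (hi : 4 < i) (j : ℕ) : Inst col (u.setReg i j) :=
  ⟨h.base.setReg hi j, h.col⟩

/-- At most `r ≤ k` red arcs are allowed. -/
def Fits (u : RamStore) (r : ℕ) : Prop := u.arr 0 1 = 0 ∧ r ≤ u.arr 0 2

/-- The stored assignment, if there is one, is feasible, and its value is stored. -/
def Best {n : ℕ} (col : Fin n → Fin n → ℕ) (u : RamStore) : Prop :=
  u.reg 30 = 0 ∨ ∃ σ, Valid col σ ∧ Fits u (numTwo col σ) ∧ u.reg 30 = numTwo col σ + 1 ∧
    ∀ x : Fin n, u.arr 13 x = σ x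

theorem Best.congr {n : ℕ} {col : Fin n → Fin n → ℕ} {u w : RamStore} (h : Best col u)
    (h30 : w.reg 30 = u.reg 30) (h13 : w.arr 13 = u.arr 13) (h0 : w.arr 0 = u.arr 0) :
    Best col w := by
  unfold Best Fits at *
  rwa [h30, h13, h0]

theorem tally_spec {n : ℕ} {col : Fin n → Fin n → ℕ} (hcol : ∀ x y, col x y ≤ 2) {u : RamStore}
    (h : Inst col u) {σ : Equiv.Perm (Fin n)} (hσ : ∀ x : Fin n, u.arr 9 x = σ x)
    (h27 : u.reg 27 = 0) (h28 : u.reg 28 = 1) :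
    ((Cmd.loop 5 1 tally).eval u).reg 27 = numTwo col σ ∧
      (((Cmd.loop 5 1 tally).eval u).reg 28 ≠ 0 ↔ Valid col σ) := by
  set F : ℕ → ℕ := fun x => u.arr 14 (x * n + u.arr 9 x) with hF
  have hFx : ∀ x : Fin n, F x = col x (σ x) := fun x => by
    simp only [hF]; rw [hσ, h.col]
  have main := Cmd.loop_inv (i := 5) (r := 1) (P := tally) (s := u)
    (fun k w => w.reg 27 = ∑ x ∈ Finset.range k, (if F x = 2 then 1 else 0) ∧
      (w.reg 28 ≠ 0 ↔ ∀ x < k, F x ≠ 0)) (by simp [h27, h28]) ?_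
  · rw [h.base.r1] at main
    refine ⟨?_, main.2.trans ?_⟩
    · rw [main.1, numTwo, Finset.card_filter,
        ← Fin.sum_univ_eq_sum_range (fun x => if F x = 2 then 1 else 0)]
      simp only [hFx]
    · exact ⟨fun hv x => by rw [← hFx]; exact hv x x.2, fun hv x hx => by
        have := hv ⟨x, hx⟩
        rwa [← hFx] at this⟩
  · rintro j hj w hf ⟨i1, i2⟩
    rw [h.base.r1] at hj
    have hbw : Base n (w.setReg 5 j) :=
      ((h.frame hf (by decide) (by decide)).setReg (by omega) j).base
    have e : Exp.eval (w.setReg 5 j) (matE 14 (.var 5) (.get 9 (.var 5))) = F j := by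
      rw [matE_eval hbw (by simpa [Exp.eval] using hj)]
      simp [Exp.eval, hF, hf.2 9 (by decide), hf.2 14 (by decide)]
    have h2 : F j ≤ 2 := by rw [show F j = F (⟨j, hj⟩ : Fin n) from rfl, hFx]; exact hcol _ _
    have hall : (∀ x < j + 1, F x ≠ 0) ↔ (∀ x < j, F x ≠ 0) ∧ F j ≠ 0 := by
      simp only [Nat.lt_succ_iff_lt_or_eq, or_imp, forall_and, forall_eq]
    rw [Finset.sum_range_succ, hall]
    have : F j = 0 ∨ F j = 1 ∨ F j = 2 := by omega
    rcases this with h0 | h0 | h0 <;> simp [tally, Cmd.eval, Exp.eval, e, h0, i1, ← i2]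

theorem keep_spec {n : ℕ} {col : Fin n → Fin n → ℕ} {u : RamStore} (h : Inst col u)
    {σ : Equiv.Perm (Fin n)} (hσ : ∀ x : Fin n, u.arr 9 x = σ x) (hb : Best col u)
    (h27 : u.reg 27 = numTwo col σ) (h28 : u.reg 28 ≠ 0 ↔ Valid col σ) :
    Best col (keep.eval u) ∧ u.reg 30 ≤ (keep.eval u).reg 30 ∧
      (Valid col σ → Fits u (numTwo col σ) → numTwo col σ + 1 ≤ (keep.eval u).reg 30) := by
  by_cases hv : Valid col σ
  swap
  · have h0 : u.reg 28 = 0 := by by_contra h0; exact hv (h28.1 h0)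
    simp [keep, Cmd.eval, Exp.eval, h0, hb, hv]
  have h28' := h28.2 hv
  by_cases h1 : u.arr 0 1 = 0
  swap
  · simp [keep, Cmd.eval, Exp.eval, h28', h1, hb, Fits]
  by_cases h2 : numTwo col σ ≤ u.arr 0 2
  swap
  · have h2' : numTwo col σ - u.arr 0 2 ≠ 0 := by omega
    simp [keep, Cmd.eval, Exp.eval, h28', h1, hb, Fits, h27, h2', h2]
  have h2' : numTwo col σ - u.arr 0 2 = 0 := by omega
  by_cases h3 : numTwo col σ + 1 ≤ u.reg 30
  · have h3' : numTwo col σ + 1 - u.reg 30 = 0 := by omega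
    simp [keep, Cmd.eval, Exp.eval, h28', h1, hb, Fits, h27, h2', h3', h3]
  · have h3' : numTwo col σ + 1 - u.reg 30 ≠ 0 := by omega
    set v := u.setReg 30 (numTwo col σ + 1) with hv'
    have hev : keep.eval u = (Cmd.loop 5 1 (.put 13 (.var 5) (.get 9 (.var 5)))).eval v := by
      simp only [keep, Cmd.eval, Exp.eval, h28', h1, h27, h2', h3', ne_eq, not_true_eq_false,
        not_false_eq_true, if_true, if_false, hv']
    have e30 : (keep.eval u).reg 30 = numTwo col σ + 1 := by
      rw [hev, Cmd.eval_reg (by decide)]; simp [hv']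
    have hc : ∀ x < v.reg 1, (keep.eval u).arr 13 x = u.arr 9 x := by
      rw [hev]
      refine Cmd.loop_inv (fun k w => ∀ x < k, w.arr 13 x = u.arr 9 x) (by simp) ?_
      intro j hj w hf hI x hx
      have e9 : w.arr 9 = u.arr 9 := hf.2 9 (by decide)
      simp only [Cmd.eval, Exp.eval, setArr_arr, if_true, setReg_arr, setReg_reg,
        Function.update_apply, e9]
      split_ifs with h
      · rw [h]
      · exact hI x (by omega)
    have hr1 : v.reg 1 = n := by simpa [hv'] using h.base.r1
    rw [hr1] at hc
    have e0 : (keep.eval u).arr 0 = u.arr 0 := Cmd.eval_arr (by decide) u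
    refine ⟨Or.inr ⟨σ, hv, ⟨by rwa [e0], by rwa [e0]⟩, e30, fun x => ?_⟩, by omega, by
      intros; omega⟩
    rw [hc x x.2, hσ]

theorem record_spec {n : ℕ} {col : Fin n → Fin n → ℕ} (hcol : ∀ x y, col x y ≤ 2) {u : RamStore}
    (h : Inst col u) {σ : Equiv.Perm (Fin n)} (hσ : ∀ x : Fin n, u.arr 9 x = σ x)
    (hb : Best col u) :
    Best col (record.eval u) ∧ u.reg 30 ≤ (record.eval u).reg 30 ∧
      (Valid col σ → Fits u (numTwo col σ) → numTwo col σ + 1 ≤ (record.eval u).reg 30) ∧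
      (record.eval u).reg 27 = numTwo col σ ∧ ((record.eval u).reg 28 ≠ 0 ↔ Valid col σ) := by
  set u₀ := (u.setReg 27 0).setReg 28 1 with hu₀
  set u₁ := (Cmd.loop 5 1 tally).eval u₀ with hu₁
  have hev : record.eval u = keep.eval u₁ := by
    simp only [record, Cmd.eval, Exp.eval, hu₁, hu₀]
  have hi₀ : Inst col u₀ := (h.setReg (i := 27) (by omega) 0).setReg (by omega) 1
  obtain ⟨t1, t2⟩ := tally_spec hcol hi₀ (σ := σ) hσ (by simp [hu₀]) (by simp [hu₀])
  have hi₁ : Inst col u₁ := hi₀.eval (by decide) (by decide)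
  have e0 : u₁.arr 0 = u.arr 0 := by rw [hu₁, Cmd.eval_arr (by decide)]; rfl
  have e30 : u₁.reg 30 = u.reg 30 := by rw [hu₁, Cmd.eval_reg (by decide)]; simp [hu₀]
  have hb₁ : Best col u₁ := hb.congr e30 (by rw [hu₁, Cmd.eval_arr (by decide)]; rfl) e0
  obtain ⟨k1, k2, k3⟩ := keep_spec hi₁ (σ := σ)
    (by rw [hu₁, Cmd.eval_arr (by decide)]; exact hσ) hb₁ t1 t2
  rw [hev]
  refine ⟨k1, by rwa [e30] at k2, fun hv hf => k3 hv ?_, ?_, ?_⟩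
  · rwa [Fits, e0]
  · rw [Cmd.eval_reg (by decide)]; exact t1
  · rw [Cmd.eval_reg (by decide)]; exact t2

/-- The local search, with all intermediate assignments recorded. -/
def phase : Cmd := .loop 23 3 (.seq improve record)

/-- The sequence `f` makes all intermediate assignments available to the analysis. The initial one
is not recorded here, and since weights are below `sumBound n`, that many rounds exhaust the search.
-/
theorem phase_spec {n : ℕ} {col : Fin n → Fin n → ℕ} (hcol : ∀ x y, col x y ≤ 2) {u : RamStore}
    (h : Inst col u) {W : Fin n → Fin n → ℕ} (hW : ∀ x y : Fin n, u.arr 8 (x * n + y) = W x y)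
    (hw : ∀ x y, W x y ≤ 2 * n + 1) {σ : Equiv.Perm (Fin n)} (hσ : ∀ x : Fin n, u.arr 9 x = σ x)
    (hb : Best col u) :
    ∃ f : ℕ → Equiv.Perm (Fin n), f 0 = σ ∧
      (∀ i < sumBound n, Improves W (u.reg 18) (f i) (f (i + 1))) ∧
      (∀ i < sumBound n, Valid col (f (i + 1)) → Fits u (numTwo col (f (i + 1))) →
        numTwo col (f (i + 1)) + 1 ≤ (phase.eval u).reg 30) ∧
      (∀ x : Fin n, (phase.eval u).arr 9 x = f (sumBound n) x) ∧
      Best col (phase.eval u) ∧ u.reg 30 ≤ (phase.eval u).reg 30 ∧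
      (phase.eval u).reg 27 = numTwo col (f (sumBound n)) ∧
      ((phase.eval u).reg 28 ≠ 0 ↔ Valid col (f (sumBound n))) := by
  have main := Cmd.loop_inv (i := 23) (r := 3) (P := .seq improve record) (s := u)
    (fun k w => ∃ f : ℕ → Equiv.Perm (Fin n), f 0 = σ ∧
      (∀ i < k, Improves W (u.reg 18) (f i) (f (i + 1))) ∧
      (∀ i < k, Valid col (f (i + 1)) → Fits u (numTwo col (f (i + 1))) →
        numTwo col (f (i + 1)) + 1 ≤ w.reg 30) ∧
      (∀ x : Fin n, w.arr 9 x = f k x) ∧ Best col w ∧ u.reg 30 ≤ w.reg 30 ∧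
      (0 < k → w.reg 27 = numTwo col (f k) ∧ (w.reg 28 ≠ 0 ↔ Valid col (f k))))
    ⟨fun _ => σ, rfl, by simp, by simp, hσ, hb, le_rfl, by simp⟩ ?_
  · rw [h.base.r3] at main
    obtain ⟨f, f1, f2, f3, f4, f5, f6, f7⟩ := main
    exact ⟨f, f1, f2, f3, f4, f5, f6, f7 (sumBound_pos n)⟩
  · rintro j hj w hf ⟨f, f1, f2, f3, f4, f5, f6, -⟩
    set v := w.setReg 23 j with hv
    have hiv : Inst col v := (h.frame hf (by decide) (by decide)).setReg (by omega) j
    have e8 : v.arr 8 = u.arr 8 := hf.2 8 (by decide)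
    have e0 : v.arr 0 = u.arr 0 := hf.2 0 (by decide)
    have e18 : v.reg 18 = u.reg 18 := by simp [hv, hf.1 18 (by decide)]
    obtain ⟨σ', s1, s2⟩ := improve_spec hiv.base (W := W) (σ := f j) (by rwa [e8]) f4 hw
    rw [e18] at s1
    set v' := improve.eval v with hv'
    have hiv' : Inst col v' := hiv.eval (by decide) (by decide)
    have e0' : v'.arr 0 = u.arr 0 := by rw [hv', Cmd.eval_arr (by decide), e0]
    have e30 : v'.reg 30 = w.reg 30 := by rw [hv', Cmd.eval_reg (by decide)]; simp [hv]
    have hb' : Best col v' := f5.congr e30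
      (by rw [hv', Cmd.eval_arr (by decide)]; rfl) (by rw [hv', Cmd.eval_arr (by decide)]; rfl)
    obtain ⟨r1, r2, r3, r4, r5⟩ := record_spec hcol hiv' s2 hb'
    change ∃ f : ℕ → Equiv.Perm (Fin n), f 0 = σ ∧ _ ∧ _ ∧ _ ∧ _ ∧ _ ∧ _
    simp only [Cmd.eval, ← hv']
    -- The sequence is extended by the assignment that the last improvement produced.
    refine ⟨fun i => if i ≤ j then f i else σ', by simp [f1], fun i hi => ?_, fun i hi => ?_, ?_,
      r1,
      by omega, fun _ => by simpa using ⟨r4, r5⟩⟩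
    · rcases Nat.lt_succ_iff_lt_or_eq.1 hi with hi | rfl
      · simp only [hi.le, if_true, Nat.succ_le_of_lt hi]; exact f2 i hi
      · simpa using s1
    · rcases Nat.lt_succ_iff_lt_or_eq.1 hi with hi | rfl
      · simp only [if_true, Nat.succ_le_of_lt hi]
        intro hv hf
        have := f3 i hi hv hf
        omega
      · simp only [Nat.not_succ_le_self, if_false]
        intro hv hf
        exact r3 hv (by rwa [Fits, e0'])
    · intro x
      rw [Cmd.eval_arr (by decide), s2]
      simp

end Prog

/-! ### Minimum numbers of red arcs, and the search for each threshold. -/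

namespace Prog

open RamStore

def assignId : Cmd := .loop 5 1 (.put 9 (.var 5) (.var 5))

/-- An expression that vanishes if and only if `e` and `f` have the same value. -/
def neE (e f : Exp) : Exp := .add (.sub e f) (.sub f e)

theorem neE_eval (e f : Exp) (u : RamStore) : (neE e f).eval u ≠ 0 ↔ e.eval u ≠ f.eval u := by
  simp only [neE, Exp.eval]; omega

def minRedEntry : Cmd :=
  .seq (.set 29 (matE 14 (.var 5) (.var 6)))
    (.seq (.ite (.var 29) (.ite (.sub (.var 29) (.num 1)) (.set 31 (.var 1)) (.set 31 (.var 2)))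
      (.set 31 (.num 0)))
    (.ite (neE (.var 5) (.var 20)) .skip (.ite (neE (.var 6) (.var 21)) (.set 31 (.num 0)) .skip)))

def redEntry : Cmd :=
  .seq (.set 29 (matE 14 (.var 5) (.var 6)))
    (.seq (.set 31 (.add (.add (.var 22) (.var 22)) (.num 1)))
    (.ite (.var 29) (.ite (.sub (matE 12 (.var 5) (.var 6)) (.var 22)) .skip
      (.set 31 (.sub (.var 29) (.num 1)))) .skip))

/-- Minimize the number of red arcs, over the assignments that map `reg 20` to `reg 21`. -/
def minRed : Cmd := .seq (fillMat 0 8 minRedEntry) (.seq (.set 18 (.var 3)) phase)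

/-- Raise the number of red arcs, by steps of size at most `2 * reg 22`. -/
def raiseRed : Cmd := .seq (fillMat 0 8 redEntry) (.seq (.set 18 (.add (.var 22) (.var 22))) phase)

/-- The value n + 1 marks arcs that lie on no valid assignment. It is replaced only if the
assignment found is valid and does contain the arc. -/
def storeMin : Cmd :=
  .seq (.put 12 (.add (.get 2 (.var 20)) (.var 21)) (.var 2))
    (.ite (.var 28) (.ite (neE (.get 9 (.var 20)) (.var 21)) .skip
      (.put 12 (.add (.get 2 (.var 20)) (.var 21)) (.var 27))) .skip)

def minReds : Cmd := Cmd.nest [(20, 1), (21, 1)] (.seq minRed storeMin)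

/-- Setting register 20 to n, which is no vertex, removes the arc constraint, so each search starts
at an assignment with fewest red arcs overall. -/
def raiseReds : Cmd := .loop 22 2 (.seq (.set 20 (.var 1)) (.seq minRed raiseRed))

def solve : Cmd := .seq assignId (.seq minReds raiseReds)

variable {n : ℕ} {col : Fin n → Fin n → ℕ} {u : RamStore}

theorem assignId_spec (h : Base n u) (x : Fin n) : (assignId.eval u).arr 9 x = x := by
  have := Cmd.loop_inv (i := 5) (r := 1) (P := .put 9 (.var 5) (.var 5)) (s := u)
    (fun k w => ∀ x < k, w.arr 9 x = x) (by simp) ?_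
  · rw [h.r1] at this
    exact this x x.2
  · intro j hj w hf hI x hx
    simp only [Cmd.eval, Exp.eval, setArr_arr, if_true, setReg_arr, setReg_reg,
      Function.update_apply]
    split_ifs with h
    · rw [h]
    · exact hI x (by omega)

theorem fill_minRedEntry (h : Inst col u) (x y : Fin n) :
    ((fillMat 0 8 minRedEntry).eval u).arr 8 (x * n + y)
      = minRedWeight n col (fun x y => (x : ℕ) = u.reg 20 → (y : ℕ) = u.reg 21) x y := by
  have := fillMat_spec h.base (off := 0) (A := 8) (c := minRedEntry)
    (F := fun x y => if x = u.reg 20 → y = u.reg 21 then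
      (if u.arr 14 (x * n + y) = 0 then 0 else if u.arr 14 (x * n + y) = 1 then n + 1 else n) else
        0)
    (by decide) rfl (by decide) ?_ x x.2 y y.2
  · rw [Nat.zero_add] at this
    rw [this]
    simp only [minRedWeight, h.col]
  · intro v hf h5 h6
    have hb : Base n v := h.base.frame hf (by decide) (by decide)
    have e14 : v.arr 14 = u.arr 14 := hf.2 14 (by decide)
    have e20 : v.reg 20 = u.reg 20 := hf.1 20 (by decide)
    have e21 : v.reg 21 = u.reg 21 := hf.1 21 (by decide)
    have e : Exp.eval v (matE 14 (.var 5) (.var 6)) = u.arr 14 (v.reg 5 * n + v.reg 6) := by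
      rw [matE_eval hb (by simpa [Exp.eval] using h5), e14]
      rfl
    simp only [minRedEntry, Cmd.eval.eq_4, Cmd.eval.eq_2, e]
    generalize u.arr 14 (v.reg 5 * n + v.reg 6) = C
    set d := if C = 0 then 0 else if C = 1 then n + 1 else n with hd
    have e1 : (Cmd.ite (.var 29) (.ite (.sub (.var 29) (.num 1)) (.set 31 (.var 1))
        (.set 31 (.var 2))) (.set 31 (.num 0))).eval (v.setReg 29 C)
        = (v.setReg 29 C).setReg 31 d := by
      have hC : C = 0 ∨ C = 1 ∨ 2 ≤ C := by omega
      rcases hC with rfl | rfl | hC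
      · simp [Cmd.eval, Exp.eval, hd]
      · simp [Cmd.eval, Exp.eval, hd, hb.r2]
      · have h0 : C ≠ 0 := by omega
        have h1 : C ≠ 1 := by omega
        have h2 : C - 1 ≠ 0 := by omega
        simp [Cmd.eval, Exp.eval, hd, hb.r1, h0, h1, h2]
    rw [e1]
    simp only [Cmd.eval, neE_eval, Exp.eval, setReg_reg, Nat.reduceEqDiff, if_false, e20, e21]
    by_cases ha : v.reg 5 = u.reg 20
    · by_cases hb' : v.reg 6 = u.reg 21
      · simp [ha, hb']
      · simp [ha, hb']
    · simp [ha]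

theorem fill_redEntry (h : Inst col u) (x y : Fin n) :
    ((fillMat 0 8 redEntry).eval u).arr 8 (x * n + y)
      = redWeight col (fun x y : Fin n => u.arr 12 (x * n + y)) (u.reg 22) x y := by
  have := fillMat_spec h.base (off := 0) (A := 8) (c := redEntry)
    (F := fun x y => if u.arr 14 (x * n + y) = 0 then 2 * u.reg 22 + 1 else
      if u.arr 12 (x * n + y) ≤ u.reg 22 then u.arr 14 (x * n + y) - 1 else 2 * u.reg 22 + 1)
    (by decide) rfl (by decide) ?_ x x.2 y y.2
  · rw [Nat.zero_add] at this
    rw [this]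
    simp only [redWeight, h.col]
  · intro v hf h5 h6
    have hb : Base n v := h.base.frame hf (by decide) (by decide)
    have e22 : v.reg 22 = u.reg 22 := hf.1 22 (by decide)
    have e : Exp.eval v (matE 14 (.var 5) (.var 6)) = u.arr 14 (v.reg 5 * n + v.reg 6) := by
      rw [matE_eval hb (by simpa [Exp.eval] using h5), hf.2 14 (by decide)]
      rfl
    have hb1 := (hb.setReg (i := 29) (by omega) (u.arr 14 (v.reg 5 * n + v.reg 6))).setReg (i := 31)
      (by omega) (u.reg 22 + u.reg 22 + 1)
    have e' : Exp.eval ((v.setReg 29 (u.arr 14 (v.reg 5 * n + v.reg 6))).setReg 31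
        (u.reg 22 + u.reg 22 + 1)) (matE 12 (.var 5) (.var 6))
        = u.arr 12 (v.reg 5 * n + v.reg 6) := by
      rw [matE_eval hb1 (by simpa [Exp.eval] using h5)]
      simp [Exp.eval, hf.2 12 (by decide)]
    simp only [redEntry, Cmd.eval, e, Exp.eval, setReg_reg, Nat.reduceEqDiff, if_false, e22,
      if_true,
      e']
    generalize u.arr 14 (v.reg 5 * n + v.reg 6) = C
    generalize u.arr 12 (v.reg 5 * n + v.reg 6) = D
    by_cases h0 : C = 0
    · simp [h0]; omega
    · by_cases h1 : D ≤ u.reg 22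
      · have h2 : D - u.reg 22 = 0 := by omega
        simp [h0, h1, h2]
      · have h2 : D - u.reg 22 ≠ 0 := by omega
        simp [h0, h1, h2]; omega

theorem weight_lt_sumBound {W : Fin n → Fin n → ℕ} (hw : ∀ x y, W x y ≤ 2 * n + 1)
    (σ : Equiv.Perm (Fin n)) : weight W σ < sumBound n := by
  have := Finset.sum_le_card_nsmul Finset.univ (fun x => W x (σ x)) _ (fun x _ => hw x (σ x))
  simp only [Finset.card_univ, Fintype.card_fin, smul_eq_mul] at this
  exact Nat.lt_succ_of_le this

/-- The budget `sumBound n` exceeds all weights, so the final, stuck assignment has maximum weight.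
By `minRedWeight_max` it has fewest red arcs among the valid ones through the prescribed arc, if
there are any. -/
theorem minRed_spec (hcol : ∀ x y, col x y ≤ 2) (h : Inst col u)
    (hσ : ∃ σ : Equiv.Perm (Fin n), ∀ x : Fin n, u.arr 9 x = σ x) (hb : Best col u) :
    Best col (minRed.eval u) ∧ u.reg 30 ≤ (minRed.eval u).reg 30 ∧ ∃ σ : Equiv.Perm (Fin n),
      (∀ x : Fin n, (minRed.eval u).arr 9 x = σ x) ∧
      (minRed.eval u).reg 27 = numTwo col σ ∧ ((minRed.eval u).reg 28 ≠ 0 ↔ Valid col σ) ∧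
      (Valid col σ → Fits u (numTwo col σ) → numTwo col σ + 1 ≤ (minRed.eval u).reg 30) ∧
      ∀ ρ : Equiv.Perm (Fin n), Valid col ρ →
        (∀ x : Fin n, (x : ℕ) = u.reg 20 → (ρ x : ℕ) = u.reg 21) →
        Valid col σ ∧ (∀ x : Fin n, (x : ℕ) = u.reg 20 → (σ x : ℕ) = u.reg 21) ∧
          numTwo col σ ≤ numTwo col ρ := by
  obtain ⟨σ, hσ⟩ := hσ
  set u₁ := (fillMat 0 8 minRedEntry).eval u with hu₁
  set u₂ := u₁.setReg 18 (u₁.reg 3) with hu₂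
  have hi₁ : Inst col u₁ := h.eval (by decide) (by decide)
  have hi₂ : Inst col u₂ := hi₁.setReg (by omega) _
  have hev : minRed.eval u = phase.eval u₂ := rfl
  set W := minRedWeight n col (fun x y => (x : ℕ) = u.reg 20 → (y : ℕ) = u.reg 21) with hWd
  have hw : ∀ x y, W x y ≤ 2 * n + 1 := by
    intro x y
    simp only [hWd, minRedWeight]
    split_ifs <;> omega
  have e30 : u₂.reg 30 = u.reg 30 := by
    simp only [hu₂, setReg_reg, Nat.reduceEqDiff, if_false]
    exact Cmd.eval_reg (by decide) u
  have e0 : u₂.arr 0 = u.arr 0 := Cmd.eval_arr (by decide) u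
  obtain ⟨f, f1, f2, f3, f4, f5, f6, f7, f8⟩ := phase_spec hcol hi₂ (W := W)
    (fun x y => fill_minRedEntry h x y) hw (σ := σ)
    (by
      intro x
      rw [show u₂.arr 9 = u.arr 9 from Cmd.eval_arr (by decide) u, hσ])
    (hb.congr e30 (Cmd.eval_arr (by decide) u) e0)
  have e18 : u₂.reg 18 = sumBound n := by simp [hu₂, hi₁.base.r3]
  rw [hev]
  rw [e18] at f2
  rw [e30] at f6
  refine ⟨f5, f6, f (sumBound n), f4, f7, f8, ?_, ?_⟩
  -- The final assignment is the one recorded in the last round, which exists because `sumBound n`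
  -- is positive.
  · have hK := sumBound_pos n
    have := f3 (sumBound n - 1) (by omega)
    rw [Nat.sub_add_cancel hK] at this
    intro hv hf
    exact this hv (by rwa [Fits, e0])
  · intro ρ hρ hok
    have hst := Improves.stuck_of_iterate f2 (weight_lt_sumBound hw)
    have hle := hst.weight_le ρ (weight_lt_sumBound hw ρ).le
    have hc : Fintype.card (Fin n) = n := Fintype.card_fin n
    exact minRedWeight_max hcol (ok := fun x y => (x : ℕ) = u.reg 20 → (y : ℕ) = u.reg 21)
      (by rw [hc]; exact hle) hρ hok

/-- Besides the table, this gives that the assignments attaining its entries have been recorded when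
they are feasible. They serve the case in which the optimum has an arc with a large minimum. -/
theorem minReds_spec (hcol : ∀ x y, col x y ≤ 2) (h : Inst col u)
    (hσ : ∃ σ : Equiv.Perm (Fin n), ∀ x : Fin n, u.arr 9 x = σ x) (hb : Best col u) :
    Best col (minReds.eval u) ∧
      (∃ σ : Equiv.Perm (Fin n), ∀ x : Fin n, (minReds.eval u).arr 9 x = σ x) ∧
      IsMinRed col (fun x y : Fin n => (minReds.eval u).arr 12 (x * n + y)) ∧
      ∀ x y : Fin n, (minReds.eval u).arr 12 (x * n + y) ≤ n →
        Fits u ((minReds.eval u).arr 12 (x * n + y)) →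
        (minReds.eval u).arr 12 (x * n + y) + 1 ≤ (minReds.eval u).reg 30 := by
  set G : Fin n → Fin n → ℕ → RamStore → Prop := fun x y g w =>
    ((∀ ρ, Valid col ρ → ρ x = y → g ≤ numTwo col ρ) ∧
    (g ≤ n → ∃ ρ, Valid col ρ ∧ ρ x = y ∧ numTwo col ρ = g)) ∧
    (g ≤ n → Fits u g → g + 1 ≤ w.reg 30) with hG
  have main := Cmd.nest_spec (P := .seq minRed storeMin) [(20, 1), (21, 1)] u
    (fun w => Best col w ∧ ∃ σ : Equiv.Perm (Fin n), ∀ x : Fin n, w.arr 9 x = σ x)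
    (fun l w => ∀ x y : Fin n, l = [(x : ℕ), (y : ℕ)] → G x y (w.arr 12 (x * n + y)) w)
    (by decide) (by decide) ⟨hb, hσ⟩ ?_ ?_ ?_
  · have hD : ∀ x y : Fin n, G x y ((minReds.eval u).arr 12 (x * n + y)) (minReds.eval u) := by
      intro x y
      refine main.2 [x, y] ?_ x y rfl
      simp only [Cmd.Below, h.base.r1]
      exact ⟨x.2, y.2, trivial⟩
    refine ⟨main.1.1, main.1.2, fun x y => ⟨(hD x y).1.1, fun hg => ?_⟩, fun x y => (hD x y).2⟩
    rw [Fintype.card_fin] at hg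
    exact (hD x y).1.2 hg
  · rintro w e he j ⟨h1, h2⟩
    have : e.1 ≠ 30 := by revert he e; decide
    exact ⟨h1.congr (by simp [this.symm]) rfl rfl, h2⟩
  · intro w l e he j hD x y hl
    have : e.1 ≠ 30 := by revert he e; decide
    simpa [hG, this.symm] using hD x y hl
  · rintro w hf hlt ⟨h1, h2⟩
    simp only [List.forall_mem_cons, h.base.r1] at hlt
    obtain ⟨h20, h21, -⟩ := hlt
    have hiw : Inst col w := h.frame hf (by decide) (by decide)
    have e0 : w.arr 0 = u.arr 0 := hf.2 0 (by decide)
    obtain ⟨m1, m2, σ, m3, m4, m5, m6, m7⟩ := minRed_spec hcol hiw h2 h1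
    set v := minRed.eval w with hv
    have hiv : Inst col v := hiw.eval (by decide) (by decide)
    have v20 : v.reg 20 = w.reg 20 := Cmd.eval_reg (by decide) w
    have v21 : v.reg 21 = w.reg 21 := Cmd.eval_reg (by decide) w
    have v12 : v.arr 12 = w.arr 12 := Cmd.eval_arr (by decide) w
    have v9 : v.arr 9 (w.reg 20) = σ ⟨w.reg 20, h20⟩ := m3 ⟨w.reg 20, h20⟩
    have s9 : (storeMin.eval v).arr 9 = v.arr 9 := Cmd.eval_arr (by decide) v
    have s30 : (storeMin.eval v).reg 30 = v.reg 30 := Cmd.eval_reg (by decide) v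
    have v2 : v.arr 2 (w.reg 20) = w.reg 20 * n := hiv.base.t2 _ (by omega)
    obtain ⟨g, hg, hgG⟩ : ∃ g, (storeMin.eval v).arr 12
        = Function.update (w.arr 12) (w.reg 20 * n + w.reg 21) g ∧
        G ⟨w.reg 20, h20⟩ ⟨w.reg 21, h21⟩ g v := by
      by_cases hcase : Valid col σ ∧ (σ ⟨w.reg 20, h20⟩ : ℕ) = w.reg 21
      · refine ⟨numTwo col σ, ?_, ⟨fun ρ hρ hρx => ?_, fun _ => ⟨σ, hcase.1, Fin.ext hcase.2, rfl⟩⟩,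
          fun _ hf => m6 hcase.1 (by rwa [Fits, e0])⟩
        · have h28 : v.reg 28 ≠ 0 := m5.2 hcase.1
          have hz : (neE (.get 9 (.var 20)) (.var 21)).eval (v.setArr 12 (w.reg 20 * n + w.reg 21)
              (n + 1)) = 0 := by
            by_contra hz
            refine (neE_eval _ _ _).1 hz ?_
            simp [Exp.eval, v20, v21, v9, hcase.2]
          simp [storeMin, Cmd.eval, Exp.eval, v20, v21, v2, v12, hiv.base.r2, h28, hz, m4]
        · refine (m7 ρ hρ ?_).2.2
          rintro x hx
          rw [show x = ⟨w.reg 20, h20⟩ from Fin.ext hx, hρx]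
      · refine ⟨n + 1, ?_, ⟨fun ρ hρ hρx => ?_, fun h => by omega⟩, fun h => by omega⟩
        · by_cases h28 : v.reg 28 = 0
          · simp [storeMin, Cmd.eval, Exp.eval, v20, v21, v2, v12, hiv.base.r2, h28]
          · have hz : (neE (.get 9 (.var 20)) (.var 21)).eval (v.setArr 12
                (w.reg 20 * n + w.reg 21) (n + 1)) ≠ 0 := by
              refine (neE_eval _ _ _).2 ?_
              simp only [Exp.eval, setArr_arr, Nat.reduceEqDiff, if_false, setArr_reg, v20, v21, v9]
              exact fun h => hcase ⟨m5.1 h28, h⟩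
            simp [storeMin, Cmd.eval, Exp.eval, v20, v21, v2, v12, hiv.base.r2, h28, hz]
        · obtain ⟨p1, p2, -⟩ := m7 ρ hρ (by
            rintro x hx
            rw [show x = ⟨w.reg 20, h20⟩ from Fin.ext hx, hρx])
          exact absurd ⟨p1, p2 ⟨w.reg 20, h20⟩ rfl⟩ hcase
    have hev : (Cmd.seq minRed storeMin).eval w = storeMin.eval v := rfl
    rw [hev]
    refine ⟨⟨m1.congr s30 (Cmd.eval_arr (by decide) v) (Cmd.eval_arr (by decide) v), σ, fun x => by
      rw [s9, m3]⟩, fun x y hl => ?_, fun l hD x y hl => ?_⟩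
    · simp only [List.map_cons, List.map_nil, List.cons.injEq, and_true] at hl
      rw [hg, show x = ⟨w.reg 20, h20⟩ from Fin.ext hl.1.symm,
        show y = ⟨w.reg 21, h21⟩ from Fin.ext hl.2.symm]
      simpa [hG, s30] using hgG
    · rw [hg, Function.update_apply]
      split_ifs with heq
      · obtain ⟨hx, hy⟩ := mul_add_inj y.2 h21 heq
        rw [show x = ⟨w.reg 20, h20⟩ from Fin.ext hx, show y = ⟨w.reg 21, h21⟩ from Fin.ext hy]
        simpa [hG, s30] using hgG
      · obtain ⟨d1, d2⟩ := hD x y hl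
        exact ⟨d1, fun p q => by have := d2 p q; omega⟩

/-- The number `t + 2` means a recorded value of at least `t + 1`. Feasibility of the recorded
assignment follows from that of the reference `σ`, which has more than `3 * t` red arcs. -/
theorem raiseReds_spec (hcol : ∀ x y, col x y ≤ 2) (h : Inst col u)
    (hσ : ∃ σ : Equiv.Perm (Fin n), ∀ x : Fin n, u.arr 9 x = σ x) (hb : Best col u)
    (hg : IsMinRed col (fun x y : Fin n => u.arr 12 (x * n + y))) :
    Best col (raiseReds.eval u) ∧ u.reg 30 ≤ (raiseReds.eval u).reg 30 ∧
      ∀ t ≤ n, ∀ σ : Equiv.Perm (Fin n), Valid col σ → Fits u (numTwo col σ) →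
        1 ≤ (raiseReds.eval u).reg 30 ∧ ((∀ x : Fin n, u.arr 12 (x * n + σ x) ≤ t) →
          3 * t < numTwo col σ → t + 2 ≤ (raiseReds.eval u).reg 30) := by
  have main := Cmd.loop_inv (i := 22) (r := 2) (P := .seq (.set 20 (.var 1)) (.seq minRed raiseRed))
    (s := u) (fun k w => Best col w ∧ u.reg 30 ≤ w.reg 30 ∧
      (∃ σ : Equiv.Perm (Fin n), ∀ x : Fin n, w.arr 9 x = σ x) ∧
      ∀ t < k, ∀ σ : Equiv.Perm (Fin n), Valid col σ → Fits u (numTwo col σ) →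
        1 ≤ w.reg 30 ∧ ((∀ x : Fin n, u.arr 12 (x * n + σ x) ≤ t) →
          3 * t < numTwo col σ → t + 2 ≤ w.reg 30)) ⟨hb, le_rfl, hσ, by simp⟩ ?_
  · rw [h.base.r2] at main
    exact ⟨main.1, main.2.1, fun t ht => main.2.2.2 t (by omega)⟩
  · rintro j hj w hf ⟨i1, i2, i3, i4⟩
    rw [h.base.r2] at hj
    set w₁ := (w.setReg 22 j).setReg 20 n with hw₁
    have hiw : Inst col w := h.frame hf (by decide) (by decide)
    have hi₁ : Inst col w₁ := (hiw.setReg (i := 22) (by omega) j).setReg (by omega) n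
    have e0 : w₁.arr 0 = u.arr 0 := hf.2 0 (by decide)
    obtain ⟨m1, m2, σ, m3, m4, m5, m6, m7⟩ := minRed_spec hcol hi₁ i3
      (i1.congr (by simp [hw₁]) rfl rfl)
    set v := minRed.eval w₁ with hv
    have hiv : Inst col v := hi₁.eval (by decide) (by decide)
    set v₁ := (fillMat 0 8 redEntry).eval v with hv₁
    set v₂ := v₁.setReg 18 (v₁.reg 22 + v₁.reg 22) with hv₂
    have hi₁' : Inst col v₁ := hiv.eval (by decide) (by decide)
    have hi₂ : Inst col v₂ := hi₁'.setReg (by omega) _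
    have v22 : v.reg 22 = j := by
      rw [hv, Cmd.eval_reg (by decide)]; simp [hw₁]
    have v₁22 : v₁.reg 22 = j := by
      rw [hv₁, Cmd.eval_reg (by decide), v22]
    have v12 : v.arr 12 = u.arr 12 := by
      rw [hv, Cmd.eval_arr (by decide)]; exact hf.2 12 (by decide)
    have hev : (Cmd.seq (.set 20 (.var 1)) (.seq minRed raiseRed)).eval (w.setReg 22 j)
        = phase.eval v₂ := by
      simp only [Cmd.eval, Exp.eval, raiseRed, setReg_reg, Nat.reduceEqDiff, if_false, hiw.base.r1]
      rfl
    set W := redWeight col (fun x y : Fin n => u.arr 12 (x * n + y)) j with hWd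
    have hw : ∀ x y, W x y ≤ 2 * n + 1 := by
      intro x y
      simp only [hWd, redWeight]
      have := hcol x y
      have := x.pos
      split_ifs <;> omega
    have v30 : v₂.reg 30 = v.reg 30 := by
      simp only [hv₂, setReg_reg, Nat.reduceEqDiff, if_false]
      exact Cmd.eval_reg (by decide) v
    have v0 : v₂.arr 0 = u.arr 0 := by
      rw [← e0]
      exact (Cmd.eval_arr (by decide) v).trans (Cmd.eval_arr (by decide) w₁)
    have v18 : v₂.reg 18 = 2 * j := by simp [hv₂, v₁22]; omega
    obtain ⟨f, f1, f2, f3, f4, f5, f6, f7, f8⟩ := phase_spec hcol hi₂ (W := W)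
      (fun x y => by
        have := fill_redEntry hiv x y
        rw [v22, v12] at this
        exact this) hw (σ := σ)
      (by
        intro x
        rw [show v₂.arr 9 = v.arr 9 from Cmd.eval_arr (by decide) v, m3])
      (m1.congr v30 (Cmd.eval_arr (by decide) v) (Cmd.eval_arr (by decide) v))
    have hw30 : w₁.reg 30 = w.reg 30 := by simp [hw₁]
    rw [hev]
    refine ⟨f5, by omega, ⟨_, f4⟩, fun t ht ρ hρ hρf => ?_⟩
    rcases Nat.lt_succ_iff_lt_or_eq.1 ht with ht | rfl
    · obtain ⟨a1, a2⟩ := i4 t ht ρ hρ hρf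
      exact ⟨by omega, fun p q => by have := a2 p q; omega⟩
    -- No vertex equals n, so the arc constraint is vacuous.
    · obtain ⟨o1, -, o2⟩ := m7 ρ hρ (by
        intro x hx
        have := x.2
        simp [hw₁] at hx
        omega)
      have hO := m6 o1 ⟨by rw [e0]; exact hρf.1, by rw [e0]; exact o2.trans hρf.2⟩
      refine ⟨by omega, fun hρg hρt => ?_⟩
      -- If even the minimum exceeds `t`, it has already been recorded.
      by_cases hOt : t < numTwo col σ
      · omega
      · rw [v18] at f2
        obtain ⟨i, hi, b1, b2, b3⟩ := exists_numTwo_between hcol hg (by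
          rw [Fintype.card_fin]; omega) f2 (weight_lt_sumBound hw) (by rw [f1]; exact o1)
          (by rw [f1]; omega) hρ hρg (by omega)
        have := f3 i hi b1 ⟨by rw [v0]; exact hρf.1, by
          rw [v0]
          have := hρf.2
          omega⟩
        omega

/-- With `t = (r - 1) / 3` for r > 0 red arcs one has 3t < r ≤ 3(t + 1), so it is enough that a
value of at least t + 1 has been recorded. -/
theorem solve_spec (hcol : ∀ x y, col x y ≤ 2) (h : Inst col u) (h30 : u.reg 30 = 0) :
    Best col (solve.eval u) ∧ ∀ σ : Equiv.Perm (Fin n), Valid col σ → Fits u (numTwo col σ) →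
      1 ≤ (solve.eval u).reg 30 ∧ numTwo col σ ≤ 3 * ((solve.eval u).reg 30 - 1) := by
  set u₁ := assignId.eval u with hu₁
  set u₂ := minReds.eval u₁ with hu₂
  have hi₁ : Inst col u₁ := h.eval (by decide) (by decide)
  have hi₂ : Inst col u₂ := hi₁.eval (by decide) (by decide)
  have hb : Best col u₁ := Or.inl (by rw [hu₁, Cmd.eval_reg (by decide), h30])
  have e0 : u₁.arr 0 = u.arr 0 := Cmd.eval_arr (by decide) u
  have e0' : u₂.arr 0 = u.arr 0 := (Cmd.eval_arr (by decide) u₁).trans e0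
  obtain ⟨m1, m2, m3, m4⟩ := minReds_spec hcol hi₁ ⟨1, fun x => assignId_spec h.base x⟩ hb
  obtain ⟨r1, r2, r3⟩ := raiseReds_spec hcol hi₂ m2 m1 m3
  change Best col (raiseReds.eval u₂) ∧ ∀ σ : Equiv.Perm (Fin n), _ → _ →
    1 ≤ (raiseReds.eval u₂).reg 30 ∧ _ ≤ 3 * ((raiseReds.eval u₂).reg 30 - 1)
  refine ⟨r1, fun σ hσ hf => ?_⟩
  have hn := numTwo_le col σ
  rw [Fintype.card_fin] at hn
  obtain ⟨a1, a2⟩ := r3 ((numTwo col σ - 1) / 3) (by omega) σ hσ (by rwa [Fits, e0'])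
  refine ⟨a1, ?_⟩
  by_cases h0 : numTwo col σ = 0
  · omega
  -- Either all arcs of `σ` are allowed for this threshold and the local search succeeds, or the
  -- minimum for some arc of `σ` exceeds the threshold and has itself been recorded.
  by_cases hall : ∀ x : Fin n, u₂.arr 12 (x * n + σ x) ≤ (numTwo col σ - 1) / 3
  · have := a2 hall (by omega)
    omega
  · push Not at hall
    obtain ⟨x, hx⟩ := hall
    have hle := (m3 x (σ x)).1 σ hσ rfl
    have := m4 x (σ x) (hle.trans hn) ⟨by rw [e0]; exact hf.1, by rw [e0]; exact hle.trans hf.2⟩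
    change u₂.arr 12 (x * n + σ x) + 1 ≤ u₂.reg 30 at this
    omega

end Prog

/-! ### Loop bounds and index tables without multiplication. -/

namespace Prog

open RamStore

/-- The loop bounds `n`, `n + 1` and `sumBound n`. -/
def bounds : Cmd :=
  .seq (.set 1 (.get 0 (.num 0))) (.seq (.set 29 (.sub (.var 0) (.num 3)))
    (.seq (.set 2 (.add (.var 1) (.num 1)))
      (.set 3 (.add (.add (.add (.var 29) (.var 29)) (.var 1)) (.num 1)))))

/-- Multiples of register `d`, up to the bound in register `r`. -/
def multiples (A r d : ℕ) : Cmd :=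
  .seq (.set 31 (.num 0)) (.loop 5 r (.seq (.put A (.var 5) (.var 31))
    (.set 31 (.add (.var 31) (.var d)))))

/-- Tabulating the multiples of a stride leaves bound times stride in register 31. This is the next
stride, and at the end the size of the walk table. -/
def tables : Cmd :=
  .seq (multiples 2 2 1) (.seq (multiples 3 3 3) (.seq (.set 32 (.var 31))
    (.seq (multiples 4 1 32) (.seq (.set 33 (.var 31)) (.seq (multiples 5 1 33)
      (.seq (.set 34 (.var 31)) (multiples 6 2 34)))))))

/-- The machine cannot multiply, but the input length n² + 3 yields n², and `sumBound n` equals 2n²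
+ n + 1. -/
theorem bounds_spec {n : ℕ} {u : RamStore} (h0 : u.reg 0 = n * n + 3) (h1 : u.arr 0 0 = n) :
    (bounds.eval u).reg 1 = n ∧ (bounds.eval u).reg 2 = n + 1 ∧
      (bounds.eval u).reg 3 = sumBound n := by
  simp only [bounds, Cmd.eval, Exp.eval, setReg_reg, h0, h1, Nat.reduceEqDiff, if_false,
    if_true, sumBound, Nat.add_sub_cancel, true_and]
  ring

theorem multiples_spec {A r d : ℕ} {u : RamStore} (hr : r ≠ 31) (hd : d ∉ [5, 31]) :
    ((multiples A r d).eval u).reg 31 = u.reg r * u.reg d ∧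
      ∀ x < u.reg r, ((multiples A r d).eval u).arr A x = x * u.reg d := by
  simp only [List.mem_cons, not_or] at hd
  have main := Cmd.loop_inv (i := 5) (r := r) (P := .seq (.put A (.var 5) (.var 31))
    (.set 31 (.add (.var 31) (.var d)))) (s := u.setReg 31 0)
    (fun k w => w.reg 31 = k * u.reg d ∧ ∀ x < k, w.arr A x = x * u.reg d) (by simp) ?_
  · simp only [setReg_reg, hr, if_false] at main
    exact main
  · rintro j hj w hf ⟨i1, i2⟩
    have ed : w.reg d = u.reg d := by
      rw [hf.1 d (by simp [Cmd.wReg, hd])]; simp [hd]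
    simp only [Cmd.eval, Exp.eval, setReg_reg, setReg_arr, setArr_reg, setArr_arr, Nat.reduceEqDiff,
      if_false, if_true, i1, hd, ed, Function.update_apply, Nat.succ_mul, true_and]
    intro x hx
    split_ifs with h
    · rw [h]
    · exact i2 x (by omega)

/-- The last loop bound. -/
def tableSize : Cmd := .set 4 (.var 31)

theorem tables_spec {n : ℕ} {u : RamStore} (h1 : u.reg 1 = n) (h2 : u.reg 2 = n + 1)
    (h3 : u.reg 3 = sumBound n) : Base n (tableSize.eval (tables.eval u)) := by
  set u₁ := (multiples 2 2 1).eval u with hu₁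
  set u₂ := (multiples 3 3 3).eval u₁ with hu₂
  set u₃ := (Cmd.set 32 (.var 31)).eval u₂ with hu₃
  set u₄ := (multiples 4 1 32).eval u₃ with hu₄
  set u₅ := (Cmd.set 33 (.var 31)).eval u₄ with hu₅
  set u₆ := (multiples 5 1 33).eval u₅ with hu₆
  set u₇ := (Cmd.set 34 (.var 31)).eval u₆ with hu₇
  set u₈ := (multiples 6 2 34).eval u₇ with hu₈
  have hev : tables.eval u = u₈ := rfl
  have a1 : ∀ r ∈ [1, 2, 3], u₁.reg r = u.reg r := fun r hr =>
    Cmd.eval_reg (by revert hr r; decide) u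
  have a2 : ∀ r ∈ [1, 2, 3], u₂.reg r = u.reg r := fun r hr =>
    (Cmd.eval_reg (by revert hr r; decide) u₁).trans (a1 r hr)
  have a3 : ∀ r ∈ [1, 2, 3], u₃.reg r = u.reg r := fun r hr =>
    (Cmd.eval_reg (by revert hr r; decide) u₂).trans (a2 r hr)
  have a4 : ∀ r ∈ [1, 2, 3], u₄.reg r = u.reg r := fun r hr =>
    (Cmd.eval_reg (by revert hr r; decide) u₃).trans (a3 r hr)
  have a5 : ∀ r ∈ [1, 2, 3], u₅.reg r = u.reg r := fun r hr =>
    (Cmd.eval_reg (by revert hr r; decide) u₄).trans (a4 r hr)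
  have a6 : ∀ r ∈ [1, 2, 3], u₆.reg r = u.reg r := fun r hr =>
    (Cmd.eval_reg (by revert hr r; decide) u₅).trans (a5 r hr)
  have a7 : ∀ r ∈ [1, 2, 3], u₇.reg r = u.reg r := fun r hr =>
    (Cmd.eval_reg (by revert hr r; decide) u₆).trans (a6 r hr)
  have a8 : ∀ r ∈ [1, 2, 3], u₈.reg r = u.reg r := fun r hr =>
    (Cmd.eval_reg (by revert hr r; decide) u₇).trans (a7 r hr)
  obtain ⟨-, m2⟩ := multiples_spec (A := 2) (r := 2) (d := 1) (u := u) (by decide) (by decide)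
  obtain ⟨p3, m3⟩ := multiples_spec (A := 3) (r := 3) (d := 3) (u := u₁) (by decide) (by decide)
  obtain ⟨p4, m4⟩ := multiples_spec (A := 4) (r := 1) (d := 32) (u := u₃) (by decide) (by decide)
  obtain ⟨p5, m5⟩ := multiples_spec (A := 5) (r := 1) (d := 33) (u := u₅) (by decide) (by decide)
  obtain ⟨p6, m6⟩ := multiples_spec (A := 6) (r := 2) (d := 34) (u := u₇) (by decide) (by decide)
  rw [← hu₁] at m2
  rw [← hu₂, a1 3 (by simp), h3] at p3 m3
  rw [← hu₄, a3 1 (by simp), h1] at p4 m4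
  rw [← hu₆, a5 1 (by simp), h1] at p5 m5
  rw [← hu₈, a7 2 (by simp), h2] at p6 m6
  have e32 : u₃.reg 32 = u₂.reg 31 := by simp [hu₃, Cmd.eval, Exp.eval]
  have e33 : u₅.reg 33 = u₄.reg 31 := by simp [hu₅, Cmd.eval, Exp.eval]
  have e34 : u₇.reg 34 = u₆.reg 31 := by simp [hu₇, Cmd.eval, Exp.eval]
  rw [e32, p3] at p4 m4
  rw [e33, p4] at p5 m5
  rw [e34, p5] at p6 m6
  rw [h1, h2] at m2
  have b5 : u₈.arr 5 = u₆.arr 5 :=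
    (Cmd.eval_arr (by decide) u₇).trans (Cmd.eval_arr (by decide) u₆)
  have b4 : u₈.arr 4 = u₄.arr 4 :=
    (Cmd.eval_arr (by decide) u₇).trans <| (Cmd.eval_arr (by decide) u₆).trans <|
    (Cmd.eval_arr (by decide) u₅).trans (Cmd.eval_arr (by decide) u₄)
  have b3 : u₈.arr 3 = u₂.arr 3 :=
    (Cmd.eval_arr (by decide) u₇).trans <| (Cmd.eval_arr (by decide) u₆).trans <|
    (Cmd.eval_arr (by decide) u₅).trans <| (Cmd.eval_arr (by decide) u₄).trans <|
    (Cmd.eval_arr (by decide) u₃).trans (Cmd.eval_arr (by decide) u₂)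
  have b2 : u₈.arr 2 = u₁.arr 2 :=
    (Cmd.eval_arr (by decide) u₇).trans <| (Cmd.eval_arr (by decide) u₆).trans <|
    (Cmd.eval_arr (by decide) u₅).trans <| (Cmd.eval_arr (by decide) u₄).trans <|
    (Cmd.eval_arr (by decide) u₃).trans <| (Cmd.eval_arr (by decide) u₂).trans
    (Cmd.eval_arr (by decide) u₁)
  rw [hev]
  constructor
  · simp [tableSize, Cmd.eval, a8, h1]
  · simp [tableSize, Cmd.eval, a8, h2]
  · simp [tableSize, Cmd.eval, a8, h3]
  · simp [tableSize, Cmd.eval, Exp.eval, p6]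
  · change ∀ x < n + 1, u₈.arr 2 x = _; rw [b2]; exact m2
  · change ∀ x < sumBound n, u₈.arr 3 x = _; rw [b3]; exact m3
  · change ∀ x < n, u₈.arr 4 x = _; rw [b4]; exact m4
  · change ∀ x < n, u₈.arr 5 x = _; rw [b5]; exact m5
  · exact m6

end Prog

/-! ### Computing the two sides. -/

/-- A partial `2`-colouring `a` with colours `1` and `2` that is, on every connected component,
consistent with the proper `2`-colouring `χ`. -/
structure Sided {n : ℕ} (G : SimpleGraph (Fin n)) (χ : Fin n → Fin 2) (a : ℕ → ℕ) : Prop where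
  le : ∀ x : Fin n, a x ≤ 2
  iff : ∀ x y : Fin n, G.Reachable x y → a x ≠ 0 → a y ≠ 0 → (a x = a y ↔ χ x = χ y)

/-- With a vertex, its neighbours are coloured. -/
def NeighborClosed {n : ℕ} (G : SimpleGraph (Fin n)) (a : ℕ → ℕ) : Prop :=
  ∀ x y : Fin n, G.Adj x y → a x ≠ 0 → a y ≠ 0

section

variable {n : ℕ} {G : SimpleGraph (Fin n)} {χ : Fin n → Fin 2} {a : ℕ → ℕ}

/-- `3 - a x` is the colour opposite to that of `x`. Within a component, sameness of colour is
determined by `χ`, so it is the only consistent choice for `y`. -/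
theorem Sided.update_adj (hχ : ∀ x y, G.Adj x y → χ x ≠ χ y) (h : Sided G χ a) {x y : Fin n}
    (hxy : G.Adj x y) (hx : a x ≠ 0) :
    Sided G χ (Function.update a y (3 - a x)) := by
  have hx2 := h.le x
  have key : ∀ z : Fin n, G.Reachable z y → a z ≠ 0 → (a z = 3 - a x ↔ χ z = χ y) := by
    intro z hz hz0
    have h1 := h.iff z x (hz.trans hxy.symm.reachable) hz0 hx
    have h2 := hχ x y hxy
    have h3 := h.le z
    have h4 : a z = 3 - a x ↔ ¬ a z = a x := by omega
    rw [h4, h1]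
    generalize χ z = p at *
    generalize χ x = q at *
    generalize χ y = r at *
    omega
  constructor
  · intro z
    rw [Function.update_apply]
    split_ifs
    · omega
    · exact h.le z
  · intro z w hzw hz hw
    rw [Function.update_apply] at hz hw
    rw [Function.update_apply, Function.update_apply]
    by_cases hz' : (z : ℕ) = y <;> by_cases hw' : (w : ℕ) = y
    · simp [Fin.ext hz', Fin.ext hw']
    · have := key w (Fin.ext hz' ▸ hzw.symm) (by simpa [hw'] using hw)
      simp only [hz', hw', if_true, if_false]
      rw [eq_comm, this, Fin.ext hz', eq_comm]
    · have := key z (Fin.ext hw' ▸ hzw) (by simpa [hz'] using hz)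
      simp only [hz', hw', if_true, if_false]
      rw [this, Fin.ext hw']
    · simp only [hz', hw', if_false] at hz hw ⊢
      exact h.iff z w hzw hz hw

theorem NeighborClosed.reachable (hc : NeighborClosed G a) {x y : Fin n} (hxy : G.Reachable x y)
    (hx : a x ≠ 0) : a y ≠ 0 := by
  obtain ⟨p⟩ := hxy
  induction p with
  | nil => exact hx
  | cons h _ ih => exact ih (hc _ _ h hx)

/-- The coloured set is a union of components, so the component of an uncoloured seed contains no
coloured vertex with which its colour could conflict. -/
theorem Sided.update_seed (h : Sided G χ a) (hc : NeighborClosed G a) {s : Fin n} (hs : a s = 0) :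
    Sided G χ (Function.update a s 1) := by
  constructor
  · intro z
    rw [Function.update_apply]
    split_ifs
    · omega
    · exact h.le z
  · intro z w hzw hz hw
    rw [Function.update_apply] at hz hw
    rw [Function.update_apply, Function.update_apply]
    by_cases hz' : (z : ℕ) = s <;> by_cases hw' : (w : ℕ) = s
    · simp [Fin.ext hz', Fin.ext hw']
    · exact absurd hs (hc.reachable (Fin.ext hz' ▸ hzw.symm) (by simpa [hw'] using hw))
    · exact absurd hs (hc.reachable (Fin.ext hw' ▸ hzw) (by simpa [hz'] using hz))
    · simp only [hz', hw', if_false] at hz hw ⊢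
      exact h.iff z w hzw hz hw

end

namespace Prog

open RamStore

def inE (x y : Exp) : Exp := .get 0 (.add (.num 3) (.add (.get 2 x) y))

theorem inE_eval {n : ℕ} {u : RamStore} (h : Base n u) {x y : Exp} (hx : x.eval u < n) :
    (inE x y).eval u = u.arr 0 (3 + (x.eval u * n + y.eval u)) := by
  simp only [inE, Exp.eval, h.t2 _ (Nat.lt_succ_of_lt hx)]

def spread : Cmd :=
  .ite (inE (.var 5) (.var 6)) (.ite (.get 7 (.var 5)) (.ite (.get 7 (.var 6)) .skip
    (.put 7 (.var 6) (.sub (.num 3) (.get 7 (.var 5))))) .skip) .skip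

def sweep : Cmd := Cmd.nest [(5, 1), (6, 1)] spread

def sides : Cmd :=
  .loop 20 1 (.seq (.ite (.get 7 (.var 20)) .skip (.put 7 (.var 20) (.num 1)))
    (.loop 21 1 sweep))

variable {n : ℕ} {G : SimpleGraph (Fin n)} {χ : Fin n → Fin 2} {u : RamStore}

theorem sweep_spec (hχ : ∀ x y, G.Adj x y → χ x ≠ χ y) (h : Base n u)
    (hG : ∀ x y : Fin n, u.arr 0 (3 + (x * n + y)) ≠ 0 ↔ G.Adj x y) (hs : Sided G χ (u.arr 7)) :
    Sided G χ ((sweep.eval u).arr 7) ∧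
      (∀ x : Fin n, u.arr 7 x ≠ 0 → (sweep.eval u).arr 7 x ≠ 0) ∧
      (∀ x y : Fin n, G.Adj x y → u.arr 7 x ≠ 0 → (sweep.eval u).arr 7 y ≠ 0) ∧
      (NeighborClosed G (u.arr 7) → ∀ x : Fin n, (sweep.eval u).arr 7 x ≠ 0 → u.arr 7 x ≠ 0) := by
  have main := Cmd.nest_spec (P := spread) [(5, 1), (6, 1)] u
    (fun w => Sided G χ (w.arr 7) ∧ (∀ x : Fin n, u.arr 7 x ≠ 0 → w.arr 7 x ≠ 0) ∧
      (NeighborClosed G (u.arr 7) → ∀ x : Fin n, w.arr 7 x ≠ 0 → u.arr 7 x ≠ 0))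
    (fun l w => ∀ x y : Fin n, l = [(x : ℕ), (y : ℕ)] → G.Adj x y → u.arr 7 x ≠ 0 → w.arr 7 y ≠ 0)
    (by decide) (by decide) ⟨hs, fun _ h => h, fun _ _ h => h⟩ (fun _ _ _ _ h => h)
    (fun _ _ _ _ _ h => h) ?_
  · refine ⟨main.1.1, main.1.2.1, fun x y => main.2 [x, y] ?_ x y rfl, main.1.2.2⟩
    simp only [Cmd.Below, h.r1]
    exact ⟨x.2, y.2, trivial⟩
  · rintro w hf hlt ⟨i1, i2, i3⟩
    simp only [List.forall_mem_cons, h.r1] at hlt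
    obtain ⟨h5, h6, -⟩ := hlt
    have hbw : Base n w := h.frame hf (by decide) (by decide)
    obtain ⟨x, hx⟩ : ∃ x : Fin n, w.reg 5 = x := ⟨⟨_, h5⟩, rfl⟩
    obtain ⟨y, hy⟩ : ∃ y : Fin n, w.reg 6 = y := ⟨⟨_, h6⟩, rfl⟩
    have e : Exp.eval w (inE (.var 5) (.var 6)) ≠ 0 ↔ G.Adj x y := by
      rw [inE_eval hbw (by simpa [Exp.eval] using h5), hf.2 0 (by decide), ← hG]
      simp [Exp.eval, hx, hy]
    have hl : ∀ x' y' : Fin n, [((5, 1) : ℕ × ℕ), (6, 1)].map (fun e => w.reg e.1)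
        = [(x' : ℕ), (y' : ℕ)] → x' = x ∧ y' = y := by
      intro x' y' hl
      simp only [List.map_cons, List.map_nil, List.cons.injEq, and_true, hx, hy] at hl
      exact ⟨Fin.ext hl.1.symm, Fin.ext hl.2.symm⟩
    by_cases hadj : G.Adj x y
    swap
    · have hev : spread.eval w = w := by
        have : Exp.eval w (inE (.var 5) (.var 6)) = 0 := by
          by_contra h; exact hadj (e.1 h)
        simp [spread, Cmd.eval, this]
      rw [hev]
      refine ⟨⟨i1, i2, i3⟩, fun x' y' hl' ha => ?_, fun _ h => h⟩
      obtain ⟨rfl, rfl⟩ := hl x' y' hl'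
      exact absurd ha hadj
    have he := e.2 hadj
    by_cases hx0 : w.arr 7 x = 0
    · have hev : spread.eval w = w := by
        simp [spread, Cmd.eval, Exp.eval, hx, hx0]
      rw [hev]
      refine ⟨⟨i1, i2, i3⟩, fun x' y' hl' _ ha => ?_, fun _ h => h⟩
      obtain ⟨rfl, rfl⟩ := hl x' y' hl'
      exact absurd hx0 (i2 _ ha)
    by_cases hy0 : w.arr 7 y = 0
    swap
    · have hev : spread.eval w = w := by
        simp [spread, Cmd.eval, Exp.eval, hx, hx0, hy, hy0]
      rw [hev]
      refine ⟨⟨i1, i2, i3⟩, fun x' y' hl' _ ha => ?_, fun _ h => h⟩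
      obtain ⟨rfl, rfl⟩ := hl x' y' hl'
      exact hy0
    have hev : (spread.eval w).arr 7 = Function.update (w.arr 7) y (3 - w.arr 7 x) := by
      simp [spread, Cmd.eval, Exp.eval, hx, hx0, hy, hy0, he]
    have hne : 3 - w.arr 7 x ≠ 0 := by have := i1.le x; omega
    have mono : ∀ z : Fin n, w.arr 7 z ≠ 0 → (spread.eval w).arr 7 z ≠ 0 := by
      intro z hz
      rw [hev, Function.update_apply]
      split_ifs
      · exact hne
      · exact hz
    refine ⟨⟨hev ▸ i1.update_adj hχ hadj hx0, fun z hz => mono z (i2 z hz), fun hc z hz => ?_⟩,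
      fun x' y' hl' _ _ => ?_, fun _ hD x' y' hl' ha h0 => mono y' (hD x' y' hl' ha h0)⟩
    · rw [hev, Function.update_apply] at hz
      split_ifs at hz with hzy
      · rw [hzy]
        exact hc x y hadj (i3 hc x hx0)
      · exact i3 hc z hz
    · obtain ⟨rfl, rfl⟩ := hl x' y' hl'
      rw [hev, Function.update_self]
      exact hne

/-- A sweep over a set that is not yet closed under neighbours colours a new vertex, and a closed
set does not change. Hence `n` sweeps suffice. -/
theorem sweeps_spec (hχ : ∀ x y, G.Adj x y → χ x ≠ χ y) (h : Base n u)
    (hG : ∀ x y : Fin n, u.arr 0 (3 + (x * n + y)) ≠ 0 ↔ G.Adj x y) (hs : Sided G χ (u.arr 7)) :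
    Sided G χ (((Cmd.loop 21 1 sweep).eval u).arr 7) ∧
      (∀ x : Fin n, u.arr 7 x ≠ 0 → ((Cmd.loop 21 1 sweep).eval u).arr 7 x ≠ 0) ∧
      NeighborClosed G (((Cmd.loop 21 1 sweep).eval u).arr 7) := by
  set S : RamStore → Finset (Fin n) := fun w => Finset.univ.filter fun x => w.arr 7 x ≠ 0 with hS
  have main := Cmd.loop_inv (i := 21) (r := 1) (P := sweep) (s := u)
    (fun k w => Sided G χ (w.arr 7) ∧ (∀ x : Fin n, u.arr 7 x ≠ 0 → w.arr 7 x ≠ 0) ∧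
      (NeighborClosed G (w.arr 7) ∨ k ≤ (S w).card)) ⟨hs, fun _ h => h, Or.inr (Nat.zero_le _)⟩ ?_
  · refine ⟨main.1, main.2.1, main.2.2.elim id fun hle x y _ _ => ?_⟩
    rw [h.r1] at hle
    have : S ((Cmd.loop 21 1 sweep).eval u) = Finset.univ :=
      Finset.eq_univ_of_card _ (le_antisymm (Finset.card_le_univ _) (by simpa using hle))
    have hy := Finset.mem_univ y
    rw [← this] at hy
    simpa [hS] using hy
  · rintro j hj w hf ⟨i1, i2, i3⟩
    have hbw : Base n (w.setReg 21 j) := (h.frame hf (by decide) (by decide)).setReg (by omega) j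
    have e0 : w.arr 0 = u.arr 0 := hf.2 0 (by decide)
    obtain ⟨s1, s2, s3, s4⟩ := sweep_spec (u := w.setReg 21 j) hχ hbw
      (by simpa only [setReg_arr, e0] using hG) i1
    simp only [setReg_arr] at s2 s3 s4
    refine ⟨s1, fun x hx => s2 x (i2 x hx), ?_⟩
    by_cases hc : NeighborClosed G (w.arr 7)
    · exact Or.inl fun x y hxy hx => s2 y (hc x y hxy (s4 hc x hx))
    · right
      have hle := i3.resolve_left hc
      have hlt : S w ⊂ S (sweep.eval (w.setReg 21 j)) := by
        refine Finset.ssubset_iff_subset_ne.2 ⟨fun x hx => ?_, fun heq => hc fun x y hxy hx => ?_⟩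
        · simp only [hS, Finset.mem_filter, Finset.mem_univ, true_and] at hx ⊢
          exact s2 x hx
        · have hy : y ∈ S (sweep.eval (w.setReg 21 j)) := by
            simpa [hS] using s3 x y hxy hx
          rw [← heq] at hy
          simpa [hS] using hy
      have := Finset.card_lt_card hlt
      omega

theorem sides_spec (hχ : ∀ x y, G.Adj x y → χ x ≠ χ y) (h : Base n u)
    (hG : ∀ x y : Fin n, u.arr 0 (3 + (x * n + y)) ≠ 0 ↔ G.Adj x y)
    (h0 : ∀ x : Fin n, u.arr 7 x = 0) :
    (∀ x : Fin n, (sides.eval u).arr 7 x = 1 ∨ (sides.eval u).arr 7 x = 2) ∧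
      ∀ x y : Fin n, G.Adj x y → (sides.eval u).arr 7 x ≠ (sides.eval u).arr 7 y := by
  have main := Cmd.loop_inv (i := 20) (r := 1)
    (P := .seq (.ite (.get 7 (.var 20)) .skip (.put 7 (.var 20) (.num 1))) (.loop 21 1 sweep))
    (s := u) (fun k w => Sided G χ (w.arr 7) ∧ NeighborClosed G (w.arr 7) ∧
      ∀ x : Fin n, (x : ℕ) < k → w.arr 7 x ≠ 0) ?_ ?_
  · change Sided G χ ((sides.eval u).arr 7) ∧ _ ∧ ∀ x : Fin n, _ → (sides.eval u).arr 7 x ≠ 0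
      at main
    obtain ⟨m1, -, m3⟩ := main
    have hne : ∀ x : Fin n, (sides.eval u).arr 7 x ≠ 0 := fun x => m3 x (by rw [h.r1]; exact x.2)
    refine ⟨fun x => ?_, fun x y hxy heq => ?_⟩
    · have := m1.le x
      have := hne x
      omega
    · exact hχ x y hxy ((m1.iff x y hxy.reachable (hne x) (hne y)).1 heq)
  · exact ⟨⟨fun x => by simp [h0], fun x y _ hx => absurd (h0 x) hx⟩,
      fun x y _ hx => absurd (h0 x) hx, by simp⟩
  · rintro j hj w hf ⟨i1, i2, i3⟩
    rw [h.r1] at hj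
    set v := (Cmd.ite (.get 7 (.var 20)) .skip (.put 7 (.var 20) (.num 1))).eval (w.setReg 20 j)
      with hv
    have hbw : Base n (w.setReg 20 j) := (h.frame hf (by decide) (by decide)).setReg (by omega) j
    have hbv : Base n v := hbw.eval (by decide) (by decide)
    have e0 : v.arr 0 = u.arr 0 := (Cmd.eval_arr (by decide) _).trans (hf.2 0 (by decide))
    obtain ⟨v1, v2, v3⟩ : Sided G χ (v.arr 7) ∧ (∀ x : Fin n, w.arr 7 x ≠ 0 → v.arr 7 x ≠ 0) ∧
        v.arr 7 j ≠ 0 := by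
      by_cases hj0 : w.arr 7 j = 0
      · have hev : v.arr 7 = Function.update (w.arr 7) (⟨j, hj⟩ : Fin n) 1 := by
          simp [hv, Cmd.eval, Exp.eval, hj0]
        rw [hev]
        refine ⟨i1.update_seed i2 hj0, fun x hx => ?_, by simp⟩
        rw [Function.update_apply]
        split_ifs
        · simp
        · exact hx
      · have hev : v = w.setReg 20 j := by simp [hv, Cmd.eval, Exp.eval, hj0]
        rw [hev]
        exact ⟨i1, fun _ h => h, hj0⟩
    obtain ⟨s1, s2, s3⟩ := sweeps_spec hχ hbv (by rwa [e0]) v1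
    refine ⟨s1, s3, fun x hx => s2 x ?_⟩
    rcases Nat.lt_succ_iff_lt_or_eq.1 hx with hx | hx
    · exact v2 x (i3 x hx)
    · rw [hx]; exact v3

end Prog

/-! ### Perfect matchings as permutations. -/

section Bipartition

variable {n : ℕ} {G : SimpleGraph (Fin n)} {side : Fin n → ℕ} {c : Fin n → Fin n → ℕ}

/-- The colours of the arcs of the auxiliary digraph: arcs out of side `1` have the colours of the
edges, arcs into side `1` are blue. -/
def arcColor (side : Fin n → ℕ) (c : Fin n → Fin n → ℕ) (x y : Fin n) : ℕ :=
  if side x = 1 then c x y else if side y = 1 then 1 else 0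

theorem arcColor_le (hc : ∀ x y, c x y ≤ 2) (x y : Fin n) : arcColor side c x y ≤ 2 := by
  unfold arcColor
  have := hc x y
  split_ifs <;> omega

/-- A valid permutation exchanges the sides, since no arc joins two vertices of the same side.
Equality of their sizes need not be assumed. -/
theorem Valid.side_eq_one_iff (hcG : ∀ x y, c x y ≠ 0 ↔ G.Adj x y)
    (hside : ∀ x y, G.Adj x y → side x ≠ side y) {σ : Equiv.Perm (Fin n)}
    (h : Valid (arcColor side c) σ) (x : Fin n) : side (σ x) = 1 ↔ side x ≠ 1 := by
  have hx := h x
  unfold arcColor at hx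
  split_ifs at hx with h1 h2
  · have := hside _ _ ((hcG _ _).1 hx)
    simp only [h1, ne_eq, not_true_eq_false, iff_false]
    exact fun h => this (h1.trans h.symm)
  · simp [h1, h2]
  · exact absurd rfl hx

theorem Valid.adj (hcG : ∀ x y, c x y ≠ 0 ↔ G.Adj x y) {σ : Equiv.Perm (Fin n)}
    (h : Valid (arcColor side c) σ) {x : Fin n} (hx : side x = 1) : G.Adj x (σ x) := by
  have := h x
  rw [arcColor, if_pos hx] at this
  exact (hcG _ _).1 this

/-- The set of edges `{x, σ x}` for `x` on side `1`. -/
def matchingOf (hcG : ∀ x y, c x y ≠ 0 ↔ G.Adj x y) (σ : Equiv.Perm (Fin n))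
    (h : Valid (arcColor side c) σ) : G.Subgraph where
  verts := Set.univ
  Adj x y := (side x = 1 ∧ σ x = y) ∨ (side y = 1 ∧ σ y = x)
  adj_sub := by
    rintro x y (⟨hx, rfl⟩ | ⟨hy, rfl⟩)
    · exact h.adj hcG hx
    · exact (h.adj hcG hy).symm
  edge_vert _ := Set.mem_univ _
  symm := ⟨fun _ _ h => h.symm⟩

theorem matchingOf_isPerfectMatching (hcG : ∀ x y, c x y ≠ 0 ↔ G.Adj x y)
    (hside : ∀ x y, G.Adj x y → side x ≠ side y) {σ : Equiv.Perm (Fin n)}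
    (h : Valid (arcColor side c) σ) : (matchingOf hcG σ h).IsPerfectMatching := by
  rw [SimpleGraph.Subgraph.isPerfectMatching_iff]
  intro v
  have hσ := h.side_eq_one_iff hcG hside
  by_cases hv : side v = 1
  · refine ⟨σ v, Or.inl ⟨hv, rfl⟩, ?_⟩
    rintro w (⟨-, hw⟩ | ⟨hw, hwv⟩)
    · exact hw.symm
    · exact absurd hw ((hσ w).1 (by rwa [hwv]))
  · refine ⟨σ⁻¹ v, Or.inr ⟨?_, by simp⟩, ?_⟩
    · by_contra hw
      have := (hσ _).2 hw
      rw [show σ (σ⁻¹ v) = v by simp] at this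
      exact hv this
    · rintro w (⟨hw, -⟩ | ⟨-, hw⟩)
      · exact absurd hw hv
      · rw [← hw]; simp

/-- Every perfect matching arises from an assignment. -/
theorem exists_matchingOf_eq (hcG : ∀ x y, c x y ≠ 0 ↔ G.Adj x y)
    (hside : ∀ x y, G.Adj x y → side x ≠ side y) (h12 : ∀ x, side x = 1 ∨ side x = 2)
    {M : G.Subgraph} (hM : M.IsPerfectMatching) :
    ∃ (σ : Equiv.Perm (Fin n)) (h : Valid (arcColor side c) σ), matchingOf hcG σ h = M := by
  rw [SimpleGraph.Subgraph.isPerfectMatching_iff] at hM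
  choose p hp huniq using hM
  -- The map to the partner is an involution, and it serves as the assignment.
  have hpp : Function.Involutive p := fun x => (huniq (p x) x (hp x).symm).symm
  have hside' : ∀ x, side x ≠ 1 → side (p x) = 1 := by
    intro x hx
    have h1 := hside _ _ (hp x).adj_sub
    have h2 := h12 x
    have h3 := h12 (p x)
    omega
  have hvalid : Valid (arcColor side c) hpp.toPerm := by
    intro x
    change arcColor side c x (p x) ≠ 0
    unfold arcColor
    by_cases h1 : side x = 1
    · rw [if_pos h1]
      exact (hcG _ _).2 (hp x).adj_sub
    · rw [if_neg h1, if_pos (hside' x h1)]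
      exact Nat.one_ne_zero
  refine ⟨hpp.toPerm, hvalid, ?_⟩
  ext x y
  · exact ⟨fun _ => M.edge_vert (hp x), fun _ => Set.mem_univ _⟩
  · change (side x = 1 ∧ p x = y) ∨ (side y = 1 ∧ p y = x) ↔ _
    constructor
    · rintro (⟨-, rfl⟩ | ⟨-, rfl⟩)
      · exact hp x
      · exact (hp y).symm
    · intro hxy
      have hy := huniq x y hxy
      have hx := huniq y x hxy.symm
      by_cases h1 : side x = 1
      · exact Or.inl ⟨h1, hy.symm⟩
      · exact Or.inr ⟨by rw [hy]; exact hside' x h1, hx.symm⟩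

end Bipartition

/-! ### Red edges, approximation, and the encoding of instances. -/

namespace EMInstance

variable (I : EMInstance)

theorem colorMatrix_ne_zero_iff (x y : Fin I.n) : I.colorMatrix x y ≠ 0 ↔ I.G.Adj x y := by
  unfold colorMatrix
  split_ifs with h
  · simp only [h, iff_true]
    split <;> simp
  · simp [h]

theorem colorMatrix_le (x y : Fin I.n) : I.colorMatrix x y ≤ 2 := by
  unfold colorMatrix
  split_ifs with h
  · split <;> simp
  · simp

theorem colorMatrix_eq_two_iff {x y : Fin I.n} (h : I.G.Adj x y) :
    I.colorMatrix x y = 2 ↔ I.color ⟨s(x, y), h⟩ = EdgeColor.red := by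
  unfold colorMatrix
  rw [dif_pos h]
  cases I.color ⟨s(x, y), h⟩ <;> simp

/-- Arcs into side 1 are never red, so each red edge is counted exactly once, at its end point on
side 1. -/
theorem numRed_matchingOf {side : Fin I.n → ℕ}
    (hside : ∀ x y, I.G.Adj x y → side x ≠ side y) {σ : Equiv.Perm (Fin I.n)}
    (h : Valid (arcColor side I.colorMatrix) σ) :
    I.numRed (matchingOf I.colorMatrix_ne_zero_iff σ h)
      = numTwo (arcColor side I.colorMatrix) σ := by
  have hσ := h.side_eq_one_iff I.colorMatrix_ne_zero_iff hside
  have key : ∀ x, arcColor side I.colorMatrix x (σ x) = 2 ↔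
      side x = 1 ∧ I.colorMatrix x (σ x) = 2 := by
    intro x
    unfold arcColor
    split_ifs with h1 h2 <;> simp [h1]
  rw [numRed, numTwo, ← Set.ncard_coe_finset]
  symm
  refine Set.ncard_congr (fun x hx => ⟨s(x, σ x), h.adj I.colorMatrix_ne_zero_iff
    ((key x).1 (by simpa using hx)).1⟩) ?_ ?_ ?_
  · intro x hx
    obtain ⟨h1, h2⟩ := (key x).1 (by simpa using hx)
    exact ⟨Or.inl ⟨h1, rfl⟩, (I.colorMatrix_eq_two_iff _).1 h2⟩
  · intro x y hx hy hxy
    obtain ⟨h1, -⟩ := (key x).1 (by simpa using hx)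
    obtain ⟨h2, -⟩ := (key y).1 (by simpa using hy)
    have hval : s(x, σ x) = s(y, σ y) := congrArg Subtype.val hxy
    rcases Sym2.eq_iff.1 hval with ⟨hxy, -⟩ | ⟨hxy, -⟩
    · exact hxy
    · exact absurd h2 ((hσ y).1 (by rw [← hxy]; exact h1))
  · rintro ⟨e, he⟩ ⟨h1, h2⟩
    induction e using Sym2.ind with
    | _ x y =>
      have hcol : ∀ x y (hxy : I.G.Adj x y), s(x, y) ∈ I.G.edgeSet →
          I.color ⟨s(x, y), hxy⟩ = EdgeColor.red → side x = 1 → σ x = y →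
          ∃ z, ∃ hz : z ∈ (Finset.univ.filter fun x =>
            arcColor side I.colorMatrix x (σ x) = 2 : Finset (Fin I.n)), s(z, σ z) = s(x, y) := by
        rintro x y hxy - hr hx rfl
        exact ⟨x, by simpa using (key x).2 ⟨hx, (I.colorMatrix_eq_two_iff hxy).2 hr⟩, rfl⟩
      rcases h1 with ⟨hx, hxy⟩ | ⟨hy, hxy⟩
      · obtain ⟨z, hz, hze⟩ := hcol x y he he h2 hx hxy
        exact ⟨z, by simpa using hz, Subtype.ext hze⟩
      · have he' : I.G.Adj y x := he.symm
        have h2' : I.color ⟨s(y, x), he'⟩ = EdgeColor.red := by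
          rw [← h2]; congr 2; exact Sym2.eq_swap
        obtain ⟨z, hz, hze⟩ := hcol y x he' he' h2' hy hxy
        exact ⟨z, by simpa using hz, Subtype.ext (hze.trans Sym2.eq_swap)⟩

/-- A perfect matching with at most `k` red edges, with at least a third of the red edges of any
other one, is a `3`-approximation. -/
theorem isApproxSolution_of_forall {M : I.G.Subgraph} (hM : I.IsFeasible M)
    (h : ∀ M', I.IsFeasible M' → I.numRed M' ≤ 3 * I.numRed M) :
    I.IsApproxSolution 3 (some M) := by
  set S := {r : ℕ | ∃ M : I.G.Subgraph, I.IsFeasible M ∧ I.numRed M = r} with hS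
  have hne : S.Nonempty := ⟨_, M, hM, rfl⟩
  have hbdd : BddAbove S := by
    refine ⟨3 * I.numRed M, ?_⟩
    rintro r ⟨M', hM', rfl⟩
    exact h M' hM'
  refine ⟨hM.1, sSup S, ⟨Nat.sSup_mem hne hbdd, fun _ hr => le_csSup hbdd hr⟩, ?_,
    le_csSup hbdd ⟨M, hM, rfl⟩⟩
  obtain ⟨M', hM', hr⟩ := Nat.sSup_mem hne hbdd
  rw [← hr, div_le_iff₀ (by norm_num)]
  have := h M' hM'
  have : (I.numRed M' : ℚ) ≤ 3 * I.numRed M := by exact_mod_cast this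
  linarith

theorem le_k_iff {r : ℕ} :
    (r : ℤ) ≤ I.k ↔ (if I.k < 0 then 1 else 0) = 0 ∧ r ≤ I.k.natAbs := by
  split_ifs with h
  · simp; omega
  · simp; omega

theorem length_encode : I.encode.length = I.n * I.n + 3 := by
  simp [encode, matrixList]

theorem encode_one : I.encode.getD 1 0 = if I.k < 0 then 1 else 0 := rfl

theorem encode_two : I.encode.getD 2 0 = I.k.natAbs := rfl

end EMInstance

theorem matrixList_getElem {n : ℕ} (A : Fin n → Fin n → ℕ) (x y : Fin n)
    (h : (x * n + y : ℕ) < (matrixList A).length) : (matrixList A)[(x * n + y : ℕ)] = A x y := by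
  have hn : 0 < n := x.pos
  simp only [matrixList, List.getElem_ofFn]
  congr 1
  · ext
    simp only [Fin.coe_divNat]
    rw [Nat.mul_comm, Nat.mul_add_div hn, Nat.div_eq_of_lt y.2, Nat.add_zero]
  · ext
    simp only [Fin.coe_modNat]
    rw [Nat.mul_comm, Nat.mul_add_mod, Nat.mod_eq_of_lt y.2]

theorem EMInstance.encode_matrix (I : EMInstance) (x y : Fin I.n) :
    I.encode.getD (3 + (x * I.n + y)) 0 = I.colorMatrix x y := by
  have hlt : (x * I.n + y : ℕ) < (matrixList I.colorMatrix).length := by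
    simpa [matrixList] using mul_add_lt y.2 x.2
  rw [EMInstance.encode, show 3 + (x * I.n + y : ℕ) = (x * I.n + y) + 1 + 1 + 1 by omega]
  simp only [List.getD_cons_succ]
  rw [List.getD_eq_getElem _ _ hlt, matrixList_getElem]

theorem output_eq {n : ℕ} {s : RamStore} {A : Fin n → Fin n → ℕ} (h0 : s.reg 0 = 1 + n * n)
    (h1 : s.arr 1 0 = 1) (hA : ∀ x y : Fin n, s.arr 1 (1 + (x * n + y)) = A x y) :
    s.output = 1 :: matrixList A := by
  refine List.ext_getElem (by simp [RamStore.output, h0, matrixList]; omega) fun i hi hi' => ?_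
  simp only [RamStore.output, List.getElem_map, List.getElem_range]
  cases i with
  | zero => simpa using h1
  | succ i =>
    have hin : i < n * n := by simpa [matrixList] using hi'
    have hn : 0 < n := Nat.pos_of_ne_zero (by rintro rfl; simp at hin)
    obtain ⟨x, y, rfl⟩ : ∃ x y : Fin n, i = x * n + y :=
      ⟨⟨i / n, Nat.div_lt_of_lt_mul hin⟩, ⟨i % n, Nat.mod_lt _ hn⟩, (Nat.div_add_mod' i n).symm⟩
    rw [List.getElem_cons_succ, matrixList_getElem, Nat.add_comm, hA]

theorem length_le_bitLength (l : List ℕ) : l.length ≤ bitLength l := by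
  induction l with
  | nil => simp
  | cons a l ih =>
    simp only [bitLength, List.map_cons, List.sum_cons, List.length_cons] at ih ⊢
    omega

/-! ### The complete program, its correctness and its running time. -/

namespace Prog

open RamStore

def arcEntry : Cmd :=
  .ite (neE (.get 7 (.var 5)) (.num 1))
    (.ite (neE (.get 7 (.var 6)) (.num 1)) (.set 31 (.num 0)) (.set 31 (.num 1)))
    (.set 31 (inE (.var 5) (.var 6)))

def outEntry : Cmd :=
  .ite (neE (.get 7 (.var 5)) (.num 1))
    (.ite (neE (.get 7 (.var 6)) (.num 1)) (.set 31 (.num 0))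
      (.ite (neE (.get 13 (.var 6)) (.var 5)) (.set 31 (.num 0)) (.set 31 (.num 1))))
    (.ite (neE (.get 13 (.var 5)) (.var 6)) (.set 31 (.num 0)) (.set 31 (.num 1)))

def answer : Cmd :=
  .ite (.var 30)
    (.seq (fillMat 1 1 outEntry) (.seq (.put 1 (.num 0) (.num 1))
      (.set 0 (.add (.num 1) (.get 2 (.var 1))))))
    (.seq (.put 1 (.num 0) (.num 0)) (.set 0 (.num 1)))

def main : Cmd := .seq sides (.seq (fillMat 0 14 arcEntry) (.seq solve answer))

theorem neE_eq_zero (e f : Exp) (u : RamStore) : (neE e f).eval u = 0 ↔ e.eval u = f.eval u := by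
  simp only [neE, Exp.eval]; omega

theorem arcEntry_spec {n : ℕ} {u : RamStore} (h : Base n u) {c : Fin n → Fin n → ℕ}
    (hc : ∀ x y : Fin n, u.arr 0 (3 + (x * n + y)) = c x y) :
    Inst (arcColor (fun x : Fin n => u.arr 7 x) c) ((fillMat 0 14 arcEntry).eval u) := by
  refine ⟨h.eval (by decide) (by decide), fun x y => ?_⟩
  have := fillMat_spec h (off := 0) (A := 14) (c := arcEntry)
    (F := fun x y => if u.arr 7 x = 1 then u.arr 0 (3 + (x * n + y)) else
      if u.arr 7 y = 1 then 1 else 0) (by decide) rfl (by decide) ?_ x x.2 y y.2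
  · rw [Nat.zero_add] at this
    rw [this]
    simp only [arcColor, hc]
  · intro v hf h5 h6
    have hb : Base n v := h.frame hf (by decide) (by decide)
    have e : Exp.eval v (inE (.var 5) (.var 6)) = u.arr 0 (3 + (v.reg 5 * n + v.reg 6)) := by
      rw [inE_eval hb (by simpa [Exp.eval] using h5), hf.2 0 (by decide)]
      rfl
    have e7 : v.arr 7 = u.arr 7 := hf.2 7 (by decide)
    simp only [arcEntry, Cmd.eval, ne_eq, neE_eq_zero, e]
    simp only [Exp.eval, e7]
    split_ifs <;> simp_all

theorem outEntry_spec {n : ℕ} {u : RamStore} (h : Base n u) (x y : Fin n) :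
    ((fillMat 1 1 outEntry).eval u).arr 1 (1 + (x * n + y))
      = if u.arr 7 x = 1 then (if u.arr 13 x = y then 1 else 0) else
        if u.arr 7 y = 1 then (if u.arr 13 y = x then 1 else 0) else 0 := by
  refine fillMat_spec h (off := 1) (A := 1) (c := outEntry)
    (F := fun x y => if u.arr 7 x = 1 then (if u.arr 13 x = y then 1 else 0) else
        if u.arr 7 y = 1 then (if u.arr 13 y = x then 1 else 0) else 0)
    (by decide) rfl (by decide) ?_ x x.2 y y.2
  intro v hf h5 h6
  have e7 : v.arr 7 = u.arr 7 := hf.2 7 (by decide)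
  have e13 : v.arr 13 = u.arr 13 := hf.2 13 (by decide)
  simp only [outEntry, Cmd.eval, ne_eq, neE_eq_zero]
  simp only [Exp.eval, e7, e13]
  split_ifs <;> simp_all

/-- Matchings and permutations are translated into each other through the computed sides. Every
feasible matching comes from a valid assignment, so an empty record proves infeasibility, and
otherwise the bound of `solve_spec` holds against all feasible matchings. -/
theorem main_spec (I : EMInstance) (hG : I.G.IsBipartite) {u : RamStore} (h : Base I.n u)
    (hin : ∀ i, u.arr 0 i = I.encode.getD i 0) (h7 : ∀ x : Fin I.n, u.arr 7 x = 0)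
    (h30 : u.reg 30 = 0) :
    ∃ out : Option I.G.Subgraph,
      (main.eval u).output = I.encodeAnswer out ∧ I.IsApproxSolution 3 out := by
  classical
  obtain ⟨χ⟩ := hG
  have hχ : ∀ x y, I.G.Adj x y → χ x ≠ χ y := fun x y h => χ.valid h
  have hc : ∀ x y : Fin I.n, u.arr 0 (3 + (x * I.n + y)) = I.colorMatrix x y := fun x y => by
    rw [hin, I.encode_matrix]
  have hcG := I.colorMatrix_ne_zero_iff
  obtain ⟨s1, s2⟩ := sides_spec (G := I.G) (χ := χ) hχ h (fun x y => by rw [hc]; exact hcG x y) h7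
  set u₁ := sides.eval u with hu₁
  set u₂ := (fillMat 0 14 arcEntry).eval u₁ with hu₂
  set u₃ := solve.eval u₂ with hu₃
  set side : Fin I.n → ℕ := fun x => u₁.arr 7 x with hside
  have hb₁ : Base I.n u₁ := h.eval (by decide) (by decide)
  have e01 : u₁.arr 0 = u.arr 0 := Cmd.eval_arr (by decide) u
  have hi₂ : Inst (arcColor side I.colorMatrix) u₂ := arcEntry_spec hb₁ (by rwa [e01])
  have e02 : u₂.arr 0 = u.arr 0 := (Cmd.eval_arr (by decide) u₁).trans e01
  have e03 : u₃.arr 0 = u.arr 0 := (Cmd.eval_arr (by decide) u₂).trans e02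
  have e73 : u₃.arr 7 = u₁.arr 7 :=
    (Cmd.eval_arr (by decide) u₂).trans (Cmd.eval_arr (by decide) u₁)
  have e30 : u₂.reg 30 = 0 :=
    ((Cmd.eval_reg (by decide) u₁).trans (Cmd.eval_reg (by decide) u)).trans h30
  obtain ⟨b1, b2⟩ := solve_spec (arcColor_le I.colorMatrix_le) hi₂ e30
  rw [← hu₃] at b1 b2
  have hb₃ : Base I.n u₃ := hi₂.base.eval (by decide) (by decide)
  have hfits : ∀ w : RamStore, w.arr 0 = u.arr 0 → ∀ r : ℕ, Fits w r ↔ (r : ℤ) ≤ I.k := by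
    intro w hw r
    rw [Fits, hw, hin, hin, I.encode_one, I.encode_two, I.le_k_iff]
  have hall : ∀ M, I.IsFeasible M → 1 ≤ u₃.reg 30 ∧ I.numRed M ≤ 3 * (u₃.reg 30 - 1) := by
    rintro M ⟨hM, hk⟩
    obtain ⟨σ, hσ, rfl⟩ := exists_matchingOf_eq hcG s2 s1 hM
    rw [I.numRed_matchingOf s2] at hk ⊢
    exact b2 σ hσ ((hfits u₂ e02 _).2 hk)
  have hev : main.eval u = answer.eval u₃ := rfl
  rw [hev]
  rcases b1 with hz | ⟨σ, hσ, hf, hr, h13⟩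
  · refine ⟨none, ?_, ?_⟩
    · simp [answer, Cmd.eval, Exp.eval, hz, RamStore.output, EMInstance.encodeAnswer]
    · rintro ⟨M, hM⟩
      have := (hall M hM).1
      omega
  · refine ⟨some (matchingOf hcG σ hσ), ?_, I.isApproxSolution_of_forall ⟨?_, ?_⟩ fun M hM => ?_⟩
    · have hne : u₃.reg 30 ≠ 0 := by omega
      have hb₄ : Base I.n ((fillMat 1 1 outEntry).eval u₃) := hb₃.eval (by decide) (by decide)
      rw [show I.encodeAnswer (some (matchingOf hcG σ hσ)) = 1 :: matrixList fun i j =>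
        if (matchingOf hcG σ hσ).Adj i j then 1 else 0 from rfl]
      have hans : answer.eval u₃ = (((fillMat 1 1 outEntry).eval u₃).setArr 1 0 1).setReg 0
          (1 + I.n * I.n) := by
        simp [answer, Cmd.eval, Exp.eval, hne, hb₄.r1, hb₄.t2]
      rw [hans]
      refine output_eq (by simp) (by simp) fun x y => ?_
      simp only [setReg_arr, setArr_arr, if_true]
      rw [Function.update_of_ne (by omega), outEntry_spec hb₃, e73, h13, h13]
      have hσs := hσ.side_eq_one_iff hcG s2
      have hadj : (matchingOf hcG σ hσ).Adj x y ↔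
        (side x = 1 ∧ σ x = y) ∨ (side y = 1 ∧ σ y = x) := Iff.rfl
      change (if side x = 1 then _ else if side y = 1 then _ else _) = _
      simp only [Fin.val_inj]
      by_cases hx : side x = 1
      -- The output entry tests only the first alternative of adjacency when `x` is on side 1; the
      -- second cannot hold, because `σ` leaves side 1.
      · have hxy : ¬ (side y = 1 ∧ σ y = x) := fun h => (hσs y).1 (h.2.symm ▸ hx) h.1
        simp [hx, hxy, hadj]
      · by_cases hy : side y = 1 <;> simp [hx, hy, hadj]
    · exact matchingOf_isPerfectMatching hcG s2 hσ
    · rw [I.numRed_matchingOf s2]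
      exact (hfits u₃ e03 _).1 hf
    · rw [I.numRed_matchingOf s2]
      have := (hall M hM).2
      rwa [hr, Nat.add_sub_cancel] at this

/-- The whole program. -/
def program : RamProgram :=
  .seq (bounds.comp 40) (.seq ((Cmd.seq tables tableSize).comp 40) (main.comp 40))

open Polynomial in
/-- A bound on the running time in terms of the length of the input. -/
noncomputable def runningTime : Polynomial ℕ :=
  bounds.time + (Cmd.seq tables tableSize).time.comp (3 * X + 2)
    + main.time.comp ((X + 1) * (X * (X * ((3 * X + 2) * (3 * X + 2))))) + 2

/-- The program consists of three pieces because loop bounds must stay fixed within a piece: the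
straight-line `bounds` sets registers 1 to 3, the tables use these and set register 4, and `main`
uses all four. -/
theorem program_outputsWithin (I : EMInstance) (hG : I.G.IsBipartite) :
    ∃ out : Option I.G.Subgraph, program.OutputsWithin I.encode (I.encodeAnswer out)
      (runningTime.eval (bitLength I.encode)) ∧ I.IsApproxSolution 3 out := by
  set L := bitLength I.encode with hL
  have hlen : I.n * I.n + 3 ≤ L := I.length_encode ▸ length_le_bitLength _
  have hnL : I.n ≤ L := by nlinarith
  -- The matrix is part of the input, so n² is at most its length.
  have hKL : sumBound I.n ≤ 3 * L + 2 := by unfold sumBound; nlinarith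
  set s₀ := RamStore.init I.encode with hs₀
  have arr0 : s₀.arr 0 = fun i => I.encode.getD i 0 := by simp [hs₀, RamStore.init]
  have arr7 : s₀.arr 7 = fun _ => 0 := by simp [hs₀, RamStore.init]
  have reg0 : s₀.reg 0 = I.n * I.n + 3 := by simp [hs₀, RamStore.init, I.length_encode]
  have reg30 : s₀.reg 30 = 0 := by simp [hs₀, RamStore.init]
  obtain ⟨s₁, T₁, x₁, l₁, a₁⟩ := Cmd.exec_comp (F := []) (c := bounds) (t := 40) (by simp)
    (by decide) L s₀ (by simp)
  obtain ⟨p1, p2, p3⟩ := bounds_spec reg0 (by rw [arr0]; rfl)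
  have q1 : s₁.reg 1 = I.n := (a₁.2 1 (by decide)).trans p1
  have q2 : s₁.reg 2 = I.n + 1 := (a₁.2 2 (by decide)).trans p2
  have q3 : s₁.reg 3 = sumBound I.n := (a₁.2 3 (by decide)).trans p3
  obtain ⟨s₂, T₂, x₂, l₂, a₂⟩ := Cmd.exec_comp (F := [1, 2, 3]) (c := .seq tables tableSize)
    (t := 40) (by decide) (by decide) (3 * L + 2) s₁ (by simp [q1, q2, q3]; omega)
  have hB := tables_spec q1 q2 q3
  have hB₂ : Base I.n s₂ := by
    have hr : ∀ r < 40, s₂.reg r = (tableSize.eval (tables.eval s₁)).reg r := a₂.2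
    have ha : ∀ a, s₂.arr a = (tableSize.eval (tables.eval s₁)).arr a := fun a => by
      rw [a₂.1]; rfl
    constructor
    · rw [hr 1 (by decide)]; exact hB.r1
    · rw [hr 2 (by decide)]; exact hB.r2
    · rw [hr 3 (by decide)]; exact hB.r3
    · rw [hr 4 (by decide)]; exact hB.r4
    · rw [ha]; exact hB.t2
    · rw [ha]; exact hB.t3
    · rw [ha]; exact hB.t4
    · rw [ha]; exact hB.t5
    · rw [ha]; exact hB.t6
  have e2 : ∀ a ∉ (Cmd.seq tables tableSize).wArr, a ∉ bounds.wArr → s₂.arr a = s₀.arr a := by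
    intro a h1 h2
    rw [a₂.1, Cmd.eval_arr h1, a₁.1, Cmd.eval_arr h2]
  have r30 : s₂.reg 30 = 0 := by
    rw [a₂.2 30 (by decide), Cmd.eval_reg (by decide), a₁.2 30 (by decide),
      Cmd.eval_reg (by decide), reg30]
  obtain ⟨out, o1, o2⟩ := main_spec I hG hB₂
    (by rw [e2 0 (by decide) (by decide), arr0]; exact fun _ => rfl)
    (by rw [e2 7 (by decide) (by decide), arr7]; exact fun _ => rfl) r30
  set N := (L + 1) * (L * (L * ((3 * L + 2) * (3 * L + 2)))) with hN
  have hn1 : 1 ≤ L := by omega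
  have h9 : 1 ≤ (3 * L + 2) * (3 * L + 2) := Nat.mul_pos (by omega) (by omega)
  have hKN : 3 * L + 2 ≤ N := by
    rw [hN]
    calc 3 * L + 2 ≤ (3 * L + 2) * (3 * L + 2) := Nat.le_mul_self _
      _ ≤ L * ((3 * L + 2) * (3 * L + 2)) := Nat.le_mul_of_pos_left _ hn1
      _ ≤ L * (L * ((3 * L + 2) * (3 * L + 2))) := Nat.le_mul_of_pos_left _ hn1
      _ ≤ _ := Nat.le_mul_of_pos_left _ (by omega)
  obtain ⟨s₃, T₃, x₃, l₃, a₃⟩ := Cmd.exec_comp (F := [1, 2, 3, 4]) (c := main) (t := 40)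
    (by decide) (by decide) N s₂ (by
      simp only [List.forall_mem_cons, hB₂.r1, hB₂.r2, hB₂.r3, hB₂.r4]
      refine ⟨by omega, by omega, by omega, ?_, by simp⟩
      rw [hN]
      gcongr)
  refine ⟨out, ?_, o2⟩
  have ho : s₃.output = I.encodeAnswer out := by
    rw [← o1, RamStore.output, RamStore.output, a₃.2 0 (by decide), a₃.1]
  rw [← ho]
  refine RamProgram.Exec.outputsWithin (x₁.seq (x₂.seq x₃)) ?_
  simp only [runningTime, Polynomial.eval_add, Polynomial.eval_comp, Polynomial.eval_mul,
    Polynomial.eval_X, Polynomial.eval_ofNat, Polynomial.eval_one]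
  rw [← hN]
  omega

end Prog

theorem theorem1 :
    ∃ (P : RamProgram) (p : Polynomial ℕ), ∀ I : EMInstance, I.G.IsBipartite →
      ∃ out : Option I.G.Subgraph,
        P.OutputsWithin I.encode (I.encodeAnswer out) (p.eval (bitLength I.encode)) ∧
        I.IsApproxSolution 3 out :=
  ⟨Prog.program, Prog.runningTime, Prog.program_outputsWithin⟩
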